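/- **Conventions.** Manifolds are smooth, finite-dimensional, Hausdorff, second countable and without boundary. A *foliation* on a manifold $M$ is a $C^\infty(M)$-submodule $\mathcal F$ of $C_c^\infty(M;TM)$ which is locally finitely generated and stable under Lie brackets. Its *fiber* at $x\in M$ is the real vector space $\mathcal F_x=\mathcal F/I_x\mathcal F$, where $I_x=\{f\in C^\infty(M): f(x)=0\}$. For a smooth map $\varphi:N\to M$, let $\varphi^*(\mathcal F)\subset C_c^\infty(N;\varphi^*TM)$ be the $C^\infty(N)$-submodule generated by the sections $f\,(\xi\circ\varphi)$ with $f\in C_c^\infty(N)$, $\xi\in\mathcal F$, and let $\varphi^{-1}(\mathcal F)=\{X\in C_c^\infty(N;TN): d\varphi(X)\in\varphi^*(\mathcal F)\}$. The restriction of $\mathcal F$ to an open set $U\subset M$ is its pull-back $\iota^*(\mathcal F)$ under the inclusion $\iota:U\to M$. A submodule $\mathcal E$ of the compactly supported smooth sections is *finitely generated* if there are finitely many smooth sections $\xi_1,\dots,\xi_k$ (not necessarily compactly supported) with $f\xi_i\in\mathcal E$ for all smooth compactly supported $f$, such that every element of $\mathcal E$ has the form $\sum f_i\xi_i$ with $f_i$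 smooth and compactly supported; $\mathcal F$ is *locally finitely generated* if every point of $M$ has an open neighborhood on which the restriction of $\mathcal F$ is finitely generated. A *bi-submersion* of $(M,\mathcal F)$ is a triple $(U,t,s)$ consisting of a manifold $U$ and two smooth submersions $t,s:U\to M$ such that $s^{-1}(\mathcal F)=t^{-1}(\mathcal F)=C_c^\infty(U;\ker ds)+C_c^\infty(U;\ker dt)$. A *morphism* of bi-submersions $(U,t_U,s_U)\to(V,t_V,s_V)$ is a smooth map $g:U\to V$ with $s_V\circ g=s_U$ and $t_V\circ g=t_U$. A *bisection* of $(U,t,s)$ is a locally closed submanifold $B\subset U$ such that $s|_B$ and $t|_B$ are diffeomorphisms onto open subsets of $M$. The identity of $M$ *is carried by* $(U,t,s)$ *at* $u\in U$ if there is a bisection $B$ with $u\in B$ such that $t|_B\circ(s|_B)^{-1}$ coincides with the identity in a neighborhood of $s(u)$. **Proposition.** Let $\mathcal F$ be a foliation on a manifold $M$, let $x\in M$, and let $X_1,\dots,X_n\in\mathcal F$ be vector fields whose images form a basis of $\mathcal F_x$. For $y=(y_1,\dots,y_n)\in\mathbb R^n$ let $\varphi_y=\exp(\sum_i y_iX_i)$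 be the time-one flow of $\sum_i y_iX_i$. On $\mathcal W_0=\mathbb R^n\times M$ put $s_0(y,p)=p$ and $t_0(y,p)=\varphi_y(p)$. (a) There is an open neighborhood $\mathcal W$ of $(0,x)$ in $\mathcal W_0$ such that $(\mathcal W,t_0|_{\mathcal W},s_0|_{\mathcal W})$ is a bi-submersion of $(M,\mathcal F)$. (b) Let $\mathcal W$ be any open neighborhood of $(0,x)$ as in (a). Let $(V,t_V,s_V)$ be a bi-submersion of $(M,\mathcal F)$ and $v\in V$ such that $s_V(v)=x$ and the identity of $M$ is carried by $(V,t_V,s_V)$ at $v$. Then there exist an open neighborhood $V'$ of $v$ in $V$ and a smooth submersion $g:V'\to\mathcal W$ with $g(v)=(0,x)$ which is a morphism of bi-submersions, that is, $s_0\circ g=s_V|_{V'}$ and $t_0\circ g=t_V|_{V'}$. -/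

import Mathlib

open scoped Manifold ContDiff Topology
open TopologicalSpace

namespace SingFol

universe u₁ u₂ u₃ u₄ u₅ u₆

section Scalars

variable {E : Type u₁} [NormedAddCommGroup E] [NormedSpace ℝ E]
  {H : Type u₂} [TopologicalSpace H]
  (I : ModelWithCorners ℝ E H)
  (M : Type u₃) [TopologicalSpace M] [ChartedSpace H M]

/-- The real algebra `C^∞(M)` of smooth real functions on `M`. -/
abbrev Smooth : Type _ := C^∞⟮I, M; 𝓘(ℝ, ℝ), ℝ⟯

variable {I M}

/-- Smooth functions act by pointwise multiplication on the (set-theoretic) sections of any family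
of real vector spaces over the manifold. -/
noncomputable instance sectionModule (A : M → Type u₄) [∀ u, AddCommGroup (A u)] [∀ u, Module ℝ (A u)] :
    Module (Smooth I M) (∀ u, A u) where
  smul f X := fun u => f u • X u
  one_smul X := by
    funext u
    exact one_smul ℝ (X u)
  mul_smul f g X := by
    funext u
    exact mul_smul (f u) (g u) (X u)
  smul_zero f := by
    funext u
    exact smul_zero (f u)
  smul_add f X Y := by
    funext u
    exact smul_add (f u) (X u) (Y u)
  add_smul f g X := by
    funext u
    exact add_smul (f u) (g u) (X u)
  zero_smul X := by
    funext u
    exact zero_smul ℝ (X u)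

theorem smul_section_apply (A : M → Type u₄) [∀ u, AddCommGroup (A u)] [∀ u, Module ℝ (A u)]
    (f : Smooth I M) (X : ∀ u, A u) (u : M) : (f • X) u = f u • X u := rfl

instance sectionTower (A : M → Type u₄) [∀ u, AddCommGroup (A u)] [∀ u, Module ℝ (A u)] :
    IsScalarTower ℝ (Smooth I M) (∀ u, A u) where
  smul_assoc c f X := by
    funext u
    exact mul_smul c (f u) (X u)

variable (I) in
/-- The ideal `I_x` of smooth functions vanishing at `x`. -/
def vanishingIdeal (x : M) : Ideal (Smooth I M) where
  carrier := {f | f x = 0}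
  add_mem' {f g} hf hg := by
    change f x + g x = 0
    rw [show f x = 0 from hf, show g x = 0 from hg, add_zero]
  zero_mem' := rfl
  smul_mem' f g hg := by
    change f x * g x = 0
    rw [show g x = 0 from hg, mul_zero]

end Scalars

section Sections

variable {E : Type u₁} [NormedAddCommGroup E] [NormedSpace ℝ E]
  {H : Type u₂} [TopologicalSpace H] (I : ModelWithCorners ℝ E H)
  {M : Type u₃} [TopologicalSpace M] [ChartedSpace H M] [IsManifold I ∞ M]
  {E' : Type u₄} [NormedAddCommGroup E'] [NormedSpace ℝ E']
  {H' : Type u₅} [TopologicalSpace H'] (J : ModelWithCorners ℝ E' H')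
  {N : Type u₆} [TopologicalSpace N] [ChartedSpace H' N] [IsManifold J ∞ N]

/-- A section `Y` of the pull-back bundle `φ^*(TM)` over `N` (that is, `Y u ∈ T_{φ u} M`) is smooth:
it is smooth as a map from `N` to the total space `TM`. For `φ = id` these are the smooth vector
fields on `M`. -/
def IsSmoothSection (φ : N → M) (Y : ∀ u : N, TangentSpace I (φ u)) : Prop :=
  ContMDiff J I.tangent ∞ (fun u => (⟨φ u, Y u⟩ : TangentBundle I M))

/-- Membership in `C_c^∞(M; TM)`: smooth vector fields with compact support. -/
def IsCompactlySupportedField (X : ∀ x : M, TangentSpace I x) : Prop :=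
  IsSmoothSection I I (fun x : M => x) X ∧ IsCompact (closure {x | X x ≠ 0})

/-- The pull-back module `φ^*(𝓔)`: the `C^∞(N)`-module of sections of `φ^*(TM)` generated by the
`f (ξ ∘ φ)` with `f ∈ C_c^∞(N)` and `ξ ∈ 𝓔`. -/
noncomputable def pullbackModule (φ : N → M) (𝓔 : Submodule (Smooth I M) (∀ x : M, TangentSpace I x)) :
    Submodule (Smooth J N) (∀ u : N, TangentSpace I (φ u)) :=
  Submodule.span (Smooth J N)
    {Y | ∃ f : Smooth J N, HasCompactSupport (f : N → ℝ) ∧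
      ∃ ξ ∈ 𝓔, Y = fun u => f u • ξ (φ u)}

/-- A module `𝓔` of compactly supported sections of `φ^*(TM)` is finitely generated: there are
finitely many global sections `ξ_i` of `𝓔` (smooth sections with `f ξ_i ∈ 𝓔` for all
`f ∈ C_c^∞(N)`) such that every element of `𝓔` is a combination of the `ξ_i` with coefficients in
`C_c^∞(N)`; the converse inclusion is automatic. -/
def IsFinitelyGenerated (φ : N → M)
    (𝓔 : Submodule (Smooth J N) (∀ u : N, TangentSpace I (φ u))) : Prop :=
  ∃ (k : ℕ) (ξ : Fin k → ∀ u : N, TangentSpace I (φ u)),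
    (∀ i, IsSmoothSection I J φ (ξ i) ∧
      ∀ f : Smooth J N, HasCompactSupport (f : N → ℝ) → f • ξ i ∈ 𝓔) ∧
    ∀ Y ∈ 𝓔, ∃ f : Fin k → Smooth J N,
      (∀ i, HasCompactSupport (f i : N → ℝ)) ∧ Y = ∑ i, f i • ξ i

variable (M) in
/-- A (singular) foliation on `M`: a locally finitely generated `C^∞(M)`-submodule of
`C_c^∞(M; TM)` which is stable under Lie brackets. -/
structure Foliation where
  /-- the underlying module of vector fields -/
  toModule : Submodule (Smooth I M) (∀ x : M, TangentSpace I x)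
  compactlySupported : ∀ X ∈ toModule, IsCompactlySupportedField I X
  /-- every point has an open neighbourhood `U` such that the restriction of the module to `U`
  (its pull-back under the inclusion) is finitely generated -/
  locallyFinitelyGenerated : ∀ x : M, ∃ U : Opens M, x ∈ U ∧
    IsFinitelyGenerated I I (fun u : U => (u : M))
      (pullbackModule I I (fun u : U => (u : M)) toModule)
  lie_mem : ∀ X ∈ toModule, ∀ Y ∈ toModule, VectorField.mlieBracket I X Y ∈ toModule

variable {I}

/-- The fiber `𝓕_x = 𝓕 / I_x 𝓕` of a foliation at `x`. -/
abbrev Foliation.Fiber (F : Foliation I M) (x : M) : Type _ :=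
  F.toModule ⧸ (vanishingIdeal I x • (⊤ : Submodule (Smooth I M) F.toModule))

/-- The class in the fiber `𝓕_x` of an element of `𝓕`. -/
noncomputable def Foliation.toFiber (F : Foliation I M) (x : M) (X : F.toModule) : F.Fiber x :=
  Submodule.Quotient.mk X

variable (I) in
/-- The module `C_c^∞(N; ker dφ)` of compactly supported smooth vector fields on `N` that are
killed by the differential of `φ`, as a set of vector fields. -/
def kernelFields (φ : N → M) : Set (∀ u : N, TangentSpace J u) :=
  {X | IsCompactlySupportedField J X ∧ ∀ u, mfderiv J I φ u (X u) = 0}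

/-- The pull-back `φ^{-1}(𝓕)`: compactly supported smooth vector fields `X` on `N` with
`dφ(X) ∈ φ^*(𝓕)`. -/
def Foliation.preimage (F : Foliation I M) (φ : N → M) : Set (∀ u : N, TangentSpace J u) :=
  {X | IsCompactlySupportedField J X ∧
    (fun u => (mfderiv J I φ u (X u) : TangentSpace I (φ u))) ∈ pullbackModule I J φ F.toModule}

variable (I) in
/-- A smooth submersion (between finite-dimensional manifolds without boundary): a smooth map with
surjective differential at every point. -/
def IsSmoothSubmersion (φ : N → M) : Prop :=
  ContMDiff J I ∞ φ ∧ ∀ u, Function.Surjective (mfderiv J I φ u)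

end Sections

section Flow

variable {E : Type u₁} [NormedAddCommGroup E] [NormedSpace ℝ E]
  {H : Type u₂} [TopologicalSpace H] (I : ModelWithCorners ℝ E H)
  {M : Type u₃} [TopologicalSpace M] [ChartedSpace H M]

open Classical in
/-- The time-one flow `exp X` of a vector field: `p` is sent to `γ 1`, where `γ : ℝ → M` is the
integral curve of `X` with `γ 0 = p`. For smooth compactly supported `X` on a Hausdorff manifold
without boundary this curve exists and is unique; the value `p` chosen when there is no such curve
is then never used. -/
noncomputable def expField (X : ∀ x : M, TangentSpace I x) (p : M) : M :=
  if h : ∃ γ : ℝ → M, IsMIntegralCurve (I := I) γ X ∧ γ 0 = p then h.choose 1 else p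

/-- `expField` computes the time-one value of any integral curve. -/
theorem expField_eq [IsManifold I ∞ M] [T2Space M] [I.Boundaryless] [CompleteSpace E]
    {X : ∀ x : M, TangentSpace I x} (hX : IsSmoothSection I I (fun x : M => x) X) {γ : ℝ → M}
    (hγ : IsMIntegralCurve (I := I) γ X) : expField I X (γ 0) = γ 1 := by
  have h : ∃ δ : ℝ → M, IsMIntegralCurve (I := I) δ X ∧ δ 0 = γ 0 := ⟨γ, hγ, rfl⟩
  have hX1 : ContMDiff I I.tangent 1 (fun x => (⟨x, X x⟩ : TangentBundle I M)) :=
    ContMDiff.of_le hX (by norm_cast)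
  rw [expField, dif_pos h]
  exact congrFun (isMIntegralCurve_Ioo_eq_of_contMDiff_boundaryless (t₀ := 0) hX1
    h.choose_spec.1 hγ h.choose_spec.2) 1

/-- The map `(y, p) ↦ exp(∑ y_i X_i)(p)` on `ℝ^n × M`. -/
noncomputable def expMap {n : ℕ} (X : Fin n → ∀ x : M, TangentSpace I x)
    (w : EuclideanSpace ℝ (Fin n) × M) : M :=
  expField I (fun q => ∑ i, w.1 i • X i q) w.2

end Flow

section Bisubmersions

variable {E : Type u₁} [NormedAddCommGroup E] [NormedSpace ℝ E]
  {H : Type u₂} [TopologicalSpace H] {I : ModelWithCorners ℝ E H}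
  {M : Type u₃} [TopologicalSpace M] [ChartedSpace H M] [IsManifold I ∞ M]
  {E' : Type u₄} [NormedAddCommGroup E'] [NormedSpace ℝ E']
  {H' : Type u₅} [TopologicalSpace H'] (J : ModelWithCorners ℝ E' H')
  {U : Type u₆} [TopologicalSpace U] [ChartedSpace H' U] [IsManifold J ∞ U]

/-- `(U, t, s)` is a bi-submersion of the foliated manifold `(M, 𝓕)`: `s, t : U → M` are smooth
submersions with `s^{-1}(𝓕) = t^{-1}(𝓕)` and
`s^{-1}(𝓕) = C_c^∞(U; ker ds) + C_c^∞(U; ker dt)` (the last sum is the elementwise sum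
`{Y + Z}`). -/
structure IsBisubmersion (F : Foliation I M) (t s : U → M) : Prop where
  submersion_s : IsSmoothSubmersion I J s
  submersion_t : IsSmoothSubmersion I J t
  preimage_eq : F.preimage J s = F.preimage J t
  preimage_eq_add : F.preimage J s =
    {X | ∃ Y ∈ kernelFields I J s, ∃ Z ∈ kernelFields I J t, X = Y + Z}

/-- `B` is a locally closed (that is, embedded) smooth submanifold of `U`: near each of its points
there is a smooth chart of `U` in which `B` is an affine subspace. -/
def IsEmbeddedSubmanifold (B : Set U) : Prop :=
  ∀ b ∈ B, ∃ e ∈ IsManifold.maximalAtlas J ∞ U, b ∈ e.source ∧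
    ∃ K : Submodule ℝ E', ∀ u ∈ e.source, u ∈ B ↔ J (e u) - J (e b) ∈ K

variable (I) in
/-- The restriction of the smooth map `f : U → M` to the submanifold `B` is a diffeomorphism onto an
open subset of `M`: the image `f(B)` is open and `f|_B` has a smooth inverse `f(B) → B`. -/
def RestrictsToDiffeo (f : U → M) (B : Set U) : Prop :=
  IsOpen (f '' B) ∧ ∃ σ : M → U, ContMDiffOn I J ∞ σ (f '' B) ∧ Set.LeftInvOn σ f B

variable (I) in
/-- `B` is a bisection of `(U, t, s)`: a locally closed submanifold such that the restrictions of
`s` and `t` to `B` are diffeomorphisms onto open subsets of `M`. -/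
structure IsBisection (t s : U → M) (B : Set U) : Prop where
  submanifold : IsEmbeddedSubmanifold J B
  source : RestrictsToDiffeo I J s B
  target : RestrictsToDiffeo I J t B

variable (I) in
/-- The local diffeomorphism `φ` of `M` is carried by `(U, t, s)` at `u`: there is a bisection `B`
through `u` whose local diffeomorphism `t|_B ∘ (s|_B)⁻¹` coincides with `φ` near `s u`. -/
def Carries (t s : U → M) (φ : M → M) (u : U) : Prop :=
  ∃ B : Set U, IsBisection I J t s B ∧ u ∈ B ∧
    ∀ᶠ p in 𝓝 (s u), ∀ b ∈ B, s b = p → t b = φ p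

end Bisubmersions

end SingFol

set_option linter.unusedSectionVars false

/-! Both parts rest on one fact: the flow of an involutive family of fields maps combinations of
these fields to combinations of them. By Nakayama's lemma (`exists_generating_nhd`), fields
representing a basis of F_x generate F near x, so [X_l, X_j] = ∑ c_ljk X_k with smooth c. Let T(y,
p) be the time-one flow of ∑ y_i X_i. The linearized flow equation with source ∑ η_i X_i and initial
value ∑ b_j X_j is solved by ∑ a_j X_j along the curve, where the coefficients a satisfy a linear
ODE built from y and c (`hasDerivAt_transport`). Hence dT(η, ∑ b_j X_j) = ∑ R(b, η)_k X_k(T), with R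
smooth in (y, p) and R(b, η) = b + η at (0, x). Near (0, x) both partial maps of R, in b and in η,
are therefore invertible.

Part (a) is then linear algebra with smooth coefficients. A field Z on the product has a parameter
component η and an M-component. If the latter is ∑ g_j X_j, then dt(Z) = ∑ R(g, η)_k X_k; inverting
R in b gives the converse, so the two pull-backs of F agree. Inverting R in η produces a vertical
field (θ, 0), killed by ds, whose difference with Z is killed by dt.

For part (b), carrying the identity yields a common local section σ of s and t through v. The
equality of the two pull-backs of F with ker ds + ker dt provides fields Y_i in ker ds lifting X_i
along t, and fields Z_j in both kernels, which together span ker ds at v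
(`IsBisubmersion.exists_frame`). Flowing out of σ(p) along combinations of Y_i and Z_j is a
submersion onto a neighbourhood of v; a local section of it assigns to u the coefficients y(u) of
the Y_i. Along such a flow line s is constant, while t follows ∑ y_i X_i, so exp(∑ y_i(u) X_i)(s u)
= t u and g = (y, s) is a morphism. It is a submersion because dy(Y_i) is the i-th basis vector at
v: differentiating the morphism identity along Y_i expresses X_i through the X_k, and such relations
have prescribed coefficients at x because the X_k form a basis of the fiber
(`coeff_eq_zero_of_relation`).

The smooth dependence of flows on parameters is obtained from the inverse function theorem in a
Banach space of curves. Only parameters near 0 matter, where the field is small, so curves exist on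
the whole of [-2, 2]. -/

namespace SingFol

/-! ### Smoothness of superposition operators on spaces of continuous functions. -/

section Nemytskii

universe u v w

variable {K : Type w} [TopologicalSpace K] [CompactSpace K]

/-- Pointwise application of a continuous bilinear map to continuous functions on a compact
space. -/
noncomputable def pointwiseBilin {A B C : Type*} [NormedAddCommGroup A] [NormedSpace ℝ A]
    [NormedAddCommGroup B] [NormedSpace ℝ B] [NormedAddCommGroup C] [NormedSpace ℝ C]
    (β : A →L[ℝ] B →L[ℝ] C) : C(K, A) →L[ℝ] C(K, B) →L[ℝ] C(K, C) :=
  LinearMap.mkContinuous₂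
    (LinearMap.mk₂ ℝ
      (fun (a : C(K, A)) (b : C(K, B)) => (⟨fun k => β (a k) (b k), by fun_prop⟩ : C(K, C)))
      (fun a a' b => by ext k; simp)
      (fun c a b => by ext k; simp)
      (fun a b b' => by ext k; simp)
      (fun c a b => by ext k; simp))
    ‖β‖ (fun a b => by
      refine (ContinuousMap.norm_le _ (by positivity)).2 fun k => ?_
      refine (β.le_opNorm₂ (a k) (b k)).trans ?_
      gcongr
      · exact a.norm_coe_le_norm k
      · exact b.norm_coe_le_norm k)

@[simp]
theorem pointwiseBilin_apply {A B C : Type*} [NormedAddCommGroup A] [NormedSpace ℝ A]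
    [NormedAddCommGroup B] [NormedSpace ℝ B] [NormedAddCommGroup C] [NormedSpace ℝ C]
    (β : A →L[ℝ] B →L[ℝ] C) (a : C(K, A)) (b : C(K, B)) (k : K) :
    pointwiseBilin β a b k = β (a k) (b k) := rfl

/-- Constant functions, as a continuous linear map. -/
noncomputable def constCLM (K : Type w) [TopologicalSpace K] [CompactSpace K] (A : Type*)
    [NormedAddCommGroup A] [NormedSpace ℝ A] : A →L[ℝ] C(K, A) :=
  LinearMap.mkContinuous
    { toFun := fun a => ContinuousMap.const K a
      map_add' := fun a b => by ext k; simp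
      map_smul' := fun c a => by ext k; simp } 1
    (fun a => by
      rw [one_mul]
      exact (ContinuousMap.norm_le _ (norm_nonneg a)).2 fun k => le_rfl)

@[simp]
theorem constCLM_apply {A : Type*} [NormedAddCommGroup A] [NormedSpace ℝ A] (a : A) (k : K) :
    constCLM K A a k = a := rfl

/-- Pointwise application of a fixed continuous linear map. -/
noncomputable def postcompCLM (K : Type w) [TopologicalSpace K] [CompactSpace K] {A B : Type*}
    [NormedAddCommGroup A] [NormedSpace ℝ A] [NormedAddCommGroup B] [NormedSpace ℝ B]
    (L : A →L[ℝ] B) : C(K, A) →L[ℝ] C(K, B) :=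
  pointwiseBilin (ContinuousLinearMap.id ℝ (A →L[ℝ] B)) (constCLM K _ L)

@[simp]
theorem postcompCLM_apply {A B : Type*} [NormedAddCommGroup A] [NormedSpace ℝ A]
    [NormedAddCommGroup B] [NormedSpace ℝ B] (L : A →L[ℝ] B) (a : C(K, A)) (k : K) :
    postcompCLM K L a k = L (a k) := rfl

variable {E : Type u} [NormedAddCommGroup E] [NormedSpace ℝ E]

/-- The superposition operator `γ ↦ f ∘ γ`. -/
def superpose {F : Type*} [TopologicalSpace F] (f : E → F) (hf : Continuous f) (γ : C(K, E)) :
    C(K, F) := (⟨f, hf⟩ : C(E, F)).comp γ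

@[simp]
theorem superpose_apply {F : Type*} [TopologicalSpace F] (f : E → F) (hf : Continuous f)
    (γ : C(K, E)) (k : K) : superpose f hf γ k = f (γ k) := rfl

/-- The range of γ is compact, so the derivative of f varies by at most ε within some δ of it. The
mean value inequality on the ball around γ k then bounds the remainder by ε times the sup norm of
the increment, uniformly in k. -/
theorem hasFDerivAt_superpose {F : Type*} [NormedAddCommGroup F] [NormedSpace ℝ F] (f : E → F)
    (hf : ContDiff ℝ 1 f) (γ : C(K, E)) :
    HasFDerivAt (superpose (K := K) f hf.continuous)
      (pointwiseBilin (ContinuousLinearMap.id ℝ (E →L[ℝ] F))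
        (superpose (fderiv ℝ f) (hf.continuous_fderiv one_ne_zero) γ)) γ := by
  rw [hasFDerivAt_iff_isLittleO, Asymptotics.isLittleO_iff]
  intro ε hε
  have hcomp : IsCompact (Set.range γ) := isCompact_range γ.continuous
  have huc := hcomp.uniformContinuousAt_of_continuousAt (fderiv ℝ f)
    (fun a _ => (hf.continuous_fderiv one_ne_zero).continuousAt) (Metric.dist_mem_uniformity hε)
  obtain ⟨δ, hδ, hδ'⟩ := Metric.mem_uniformity_dist.1 huc
  filter_upwards [Metric.ball_mem_nhds γ hδ] with γ' hγ'
  refine (ContinuousMap.norm_le _ (by positivity)).2 fun k => ?_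
  have hk : dist (γ' k) (γ k) < δ := (ContinuousMap.dist_apply_le_dist k).trans_lt hγ'
  have hmv := (convex_ball (γ k) δ).norm_image_sub_le_of_norm_hasFDerivWithin_le'
    (f := f) (f' := fderiv ℝ f) (φ := fderiv ℝ f (γ k)) (C := ε)
    (fun z _ => ((hf.differentiable one_ne_zero) z).hasFDerivAt.hasFDerivWithinAt)
    (fun z hz => by
      have h1 : dist (γ k) z < δ := by rw [dist_comm]; exact hz
      have := hδ' h1 ⟨k, rfl⟩
      rw [← dist_eq_norm, dist_comm]
      exact le_of_lt this)
    (Metric.mem_ball_self hδ) hk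
  refine hmv.trans ?_
  gcongr
  exact (γ' - γ).norm_coe_le_norm k

/-- The derivative is superposition by `fderiv ℝ f` followed by a bounded linear map, so induction
on the order applies. The target must range over a universe closed under passing from F to E →L[ℝ]
F, hence `max u v`. -/
theorem contDiff_nat_superpose (n : ℕ) : ∀ {F : Type (max u v)} [NormedAddCommGroup F]
    [NormedSpace ℝ F] (f : E → F) (hf : ContDiff ℝ n f),
    ContDiff ℝ n (superpose (K := K) f hf.continuous) := by
  induction n with
  | zero =>
    intro F _ _ f hf
    exact contDiff_zero.2 (ContinuousMap.continuous_postcomp _)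
  | succ n ih =>
    intro F _ _ f hf
    have h1 : ContDiff ℝ 1 f := hf.of_le (by exact_mod_cast Nat.le_add_left 1 n)
    have hd := fun γ => hasFDerivAt_superpose (K := K) f h1 γ
    have hc : ContDiff ℝ n (fderiv ℝ f) := (contDiff_succ_iff_fderiv.1 (by exact_mod_cast hf)).2.2
    have key : ContDiff ℝ ((n : WithTop ℕ∞) + 1) (superpose (K := K) f hf.continuous) := by
      refine contDiff_succ_iff_fderiv.2 ⟨fun γ => (hd γ).differentiableAt, by simp, ?_⟩
      have : fderiv ℝ (superpose (K := K) f hf.continuous) = fun γ =>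
          pointwiseBilin (ContinuousLinearMap.id ℝ (E →L[ℝ] F))
            (superpose (fderiv ℝ f) hc.continuous γ) := funext fun γ => (hd γ).fderiv
      rw [this]
      exact (pointwiseBilin (ContinuousLinearMap.id ℝ (E →L[ℝ] F))).contDiff.comp
        (ih (fderiv ℝ f) hc)
    exact_mod_cast key

theorem contDiff_superpose {F : Type v} [NormedAddCommGroup F]
    [NormedSpace ℝ F] (f : E → F) (hf : ContDiff ℝ ∞ f) :
    ContDiff ℝ ∞ (superpose (K := K) f hf.continuous) := by
  rw [contDiff_infty]
  intro n
  -- The zero component in E only raises the universe of the target to the one used in the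
  -- induction; it is projected away afterwards.
  have h1 : ContDiff ℝ n (fun e => (f e, (0 : E))) :=
    (hf.of_le (by exact_mod_cast le_top)).prodMk contDiff_const
  have h2 := contDiff_nat_superpose.{u, v, w} (K := K) n _ h1
  exact (postcompCLM K (ContinuousLinearMap.fst ℝ F E)).contDiff.comp h2

end Nemytskii

/-! ### Integration of curves on [-2, 2]. -/

section Volterra

/-- The time interval on which curves are considered. -/
abbrev TimeInterval : Type := Set.Icc (-2 : ℝ) 2

theorem two_le : (-2 : ℝ) ≤ 2 := by norm_num

/-- The constant extension of a curve to all times. -/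
noncomputable def extend {F : Type*} [TopologicalSpace F] (g : C(TimeInterval, F)) (t : ℝ) : F :=
  g (Set.projIcc (-2) 2 two_le t)

variable {F : Type*} [NormedAddCommGroup F] [NormedSpace ℝ F]

theorem continuous_extend (g : C(TimeInterval, F)) : Continuous (extend g) :=
  g.continuous.comp continuous_projIcc

theorem extend_of_mem (g : C(TimeInterval, F)) {t : ℝ} (ht : t ∈ Set.Icc (-2 : ℝ) 2) :
    extend g t = g ⟨t, ht⟩ := by
  rw [extend, Set.projIcc_of_mem]

/-- The integration operator `g ↦ (τ ↦ ∫₀^τ g)`. -/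
noncomputable def integrate (F : Type*) [NormedAddCommGroup F] [NormedSpace ℝ F] :
    C(TimeInterval, F) →L[ℝ] C(TimeInterval, F) :=
  LinearMap.mkContinuous
    { toFun := fun g => ⟨fun τ => ∫ s in (0 : ℝ)..τ, extend g s,
        (intervalIntegral.continuous_primitive
          (fun a b => (continuous_extend g).intervalIntegrable a b) 0).comp continuous_subtype_val⟩
      map_add' := fun g h => by
        ext τ
        exact intervalIntegral.integral_add ((continuous_extend g).intervalIntegrable _ _)
          ((continuous_extend h).intervalIntegrable _ _)
      map_smul' := fun c g => by
        ext τ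
        exact intervalIntegral.integral_smul c (extend g) } 2
    (fun g => by
      refine (ContinuousMap.norm_le _ (by positivity)).2 fun τ => ?_
      refine (intervalIntegral.norm_integral_le_of_norm_le_const (C := ‖g‖)
        (fun s _ => g.norm_coe_le_norm _)).trans ?_
      rw [mul_comm, sub_zero]
      gcongr
      exact abs_le.2 τ.2)

theorem integrate_apply (g : C(TimeInterval, F)) (τ : TimeInterval) :
    integrate F g τ = ∫ s in (0 : ℝ)..τ, extend g s := rfl

theorem hasDerivAt_integral_extend [CompleteSpace F] (g : C(TimeInterval, F)) (t : ℝ) :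
    HasDerivAt (fun t => ∫ s in (0 : ℝ)..t, extend g s) (extend g t) t :=
  intervalIntegral.integral_hasDerivAt_right ((continuous_extend g).intervalIntegrable _ _)
    ((continuous_extend g).stronglyMeasurableAtFilter _ _) (continuous_extend g).continuousAt

/-- The fundamental theorem of calculus in terms of the integration operator. -/
theorem eq_const_add_integrate [CompleteSpace F] {h : ℝ → F} {g w : C(TimeInterval, F)}
    (hw : ∀ τ : TimeInterval, w τ = h τ)
    (hd : ∀ τ : TimeInterval, HasDerivAt h (g τ) τ) : w = constCLM _ F (h 0) + integrate F g := by
  ext τ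
  have hsub : Set.uIcc (0 : ℝ) τ ⊆ Set.Icc (-2) 2 :=
    Set.uIcc_subset_Icc ⟨by norm_num, by norm_num⟩ τ.2
  have h1 : ∫ s in (0 : ℝ)..τ, extend g s = h τ - h 0 := by
    refine intervalIntegral.integral_eq_sub_of_hasDerivAt (fun s hs => ?_)
      ((continuous_extend g).intervalIntegrable _ _)
    rw [extend_of_mem g (hsub hs)]
    exact hd ⟨s, hsub hs⟩
  rw [ContinuousMap.add_apply, integrate_apply, h1, constCLM_apply, hw]
  abel

end Volterra


/-- The inverse function theorem: a smooth map with invertible derivative at a point has a smooth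
local right inverse on a neighbourhood of the image point. -/
theorem exists_contDiffOn_rightInverse {A B : Type*} [NormedAddCommGroup A] [NormedSpace ℝ A]
    [CompleteSpace A] [NormedAddCommGroup B] [NormedSpace ℝ B] {G : A → B} {O : Set A}
    (hO : IsOpen O) (hG : ContDiffOn ℝ ∞ G O) {z₀ : A} (hz₀ : z₀ ∈ O) {e : A ≃L[ℝ] B}
    (hGd : HasFDerivAt G (e : A →L[ℝ] B) z₀) :
    ∃ N : Set B, IsOpen N ∧ G z₀ ∈ N ∧ ∃ S : B → A, ContDiffOn ℝ ∞ S N ∧ S (G z₀) = z₀ ∧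
      ∀ b ∈ N, S b ∈ O ∧ G (S b) = b := by
  have hat : ∀ z ∈ O, ContDiffAt ℝ ∞ G z := fun z hz => hG.contDiffAt (hO.mem_nhds hz)
  set Θ := (hat z₀ hz₀).toOpenPartialHomeomorph G hGd (by simp)
  have hzs : z₀ ∈ Θ.source := (hat z₀ hz₀).mem_toOpenPartialHomeomorph_source hGd (by simp)
  have hinv : Θ.symm (G z₀) = z₀ := Θ.left_inv hzs
  have hopen : IsOpen (Set.range ((↑) : (A ≃L[ℝ] B) → A →L[ℝ] B)) := ContinuousLinearEquiv.isOpen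
  -- The inverse is smooth at every point where the derivative of G is invertible, not only at the
  -- image of z₀. Invertibility is an open condition, so the domain is cut down to such points.
  have hinvo : IsOpen (O ∩ fderiv ℝ G ⁻¹' Set.range ((↑) : (A ≃L[ℝ] B) → A →L[ℝ] B)) :=
    (hG.continuousOn_fderiv_of_isOpen hO (by simp)).isOpen_inter_preimage hO hopen
  refine ⟨Θ.symm.source ∩ Θ.symm ⁻¹' (O ∩ fderiv ℝ G ⁻¹' Set.range
    ((↑) : (A ≃L[ℝ] B) → A →L[ℝ] B)), Θ.symm.isOpen_inter_preimage hinvo,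
    ⟨Θ.map_source hzs, ?_⟩, Θ.symm, fun b hb => ?_, hinv, fun b hb => ⟨hb.2.1, Θ.right_inv hb.1⟩⟩
  · change Θ.symm (G z₀) ∈ O ∩ fderiv ℝ G ⁻¹' Set.range ((↑) : (A ≃L[ℝ] B) → A →L[ℝ] B)
    rw [hinv]
    exact ⟨hz₀, e, hGd.fderiv.symm⟩
  · obtain ⟨hbO, e', he'⟩ := hb.2
    refine (Θ.contDiffAt_symm (f₀' := e') hb.1 ?_ (hat _ hbO)).contDiffWithinAt
    rw [he']
    exact ((hat _ hbO).differentiableAt (by simp)).hasFDerivAt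

/-! ### Solution curves depending smoothly on parameter and initial value. -/

section Flow

variable {P : Type*} [NormedAddCommGroup P] [NormedSpace ℝ P]
  {E : Type*} [NormedAddCommGroup E] [NormedSpace ℝ E]

variable (P E) in
/-- A parameter and a curve, combined to a curve with constant first component. -/
noncomputable def graphCLM : P × C(TimeInterval, E) →L[ℝ] C(TimeInterval, P × E) :=
  (constCLM TimeInterval (P × E)).comp
      ((ContinuousLinearMap.inl ℝ P E).comp (ContinuousLinearMap.fst ℝ P C(TimeInterval, E))) +
    (postcompCLM TimeInterval (ContinuousLinearMap.inr ℝ P E)).comp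
      (ContinuousLinearMap.snd ℝ P C(TimeInterval, E))

@[simp]
theorem graphCLM_apply (z : P × C(TimeInterval, E)) (τ : TimeInterval) :
    graphCLM P E z τ = (z.1, z.2 τ) := by
  simp [graphCLM]

/-- The velocity `τ ↦ f (y, γ τ)` of a parametrized vector field along a curve. -/
noncomputable def velocity {F : Type*} [TopologicalSpace F] (f : P × E → F) (hf : Continuous f)
    (z : P × C(TimeInterval, E)) : C(TimeInterval, F) :=
  superpose f hf (graphCLM P E z)

@[simp]
theorem velocity_apply {F : Type*} [TopologicalSpace F] (f : P × E → F) (hf : Continuous f)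
    (z : P × C(TimeInterval, E)) (τ : TimeInterval) : velocity f hf z τ = f (z.1, z.2 τ) := by
  simp [velocity]

theorem contDiff_velocity {F : Type*} [NormedAddCommGroup F] [NormedSpace ℝ F] (f : P × E → F)
    (hf : ContDiff ℝ ∞ f) : ContDiff ℝ ∞ (velocity f hf.continuous) :=
  (contDiff_superpose f hf).comp (graphCLM P E).contDiff

theorem hasFDerivAt_velocity {F : Type*} [NormedAddCommGroup F] [NormedSpace ℝ F] (f : P × E → F)
    (hf : ContDiff ℝ ∞ f) (z : P × C(TimeInterval, E)) :
    HasFDerivAt (velocity f hf.continuous)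
      ((pointwiseBilin (ContinuousLinearMap.id ℝ (P × E →L[ℝ] F))
        (velocity (fderiv ℝ f) (hf.continuous_fderiv (by simp)) z)).comp (graphCLM P E)) z :=
  (hasFDerivAt_superpose f (hf.of_le (by simp)) _).comp z (graphCLM P E).hasFDerivAt

variable [CompleteSpace P] [CompleteSpace E]

/-- Smooth dependence of solution curves on parameters and initial values, for parameters close to a
value where the vector field vanishes. -/
theorem exists_solution_curve (f : P × E → E) (hf : ContDiff ℝ ∞ f) (hf0 : ∀ q, f (0, q) = 0)
    (x₀ : E) : ∃ 𝒰 : Set (P × E), IsOpen 𝒰 ∧ ((0 : P), x₀) ∈ 𝒰 ∧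
      ∃ Γ : P × E → C(TimeInterval, E), ContDiffOn ℝ ∞ Γ 𝒰 ∧
        ∀ w ∈ 𝒰, Γ w = constCLM _ E w.2 +
          integrate E (velocity f hf.continuous (w.1, Γ w)) := by
  set D : P × E →L[ℝ] C(TimeInterval, E) :=
    (constCLM _ E).comp (ContinuousLinearMap.snd ℝ P E) + (integrate E).comp ((constCLM _ E).comp
      ((fderiv ℝ f (0, x₀)).comp
        ((ContinuousLinearMap.inl ℝ P E).comp (ContinuousLinearMap.fst ℝ P E)))) with hD
  -- The second component vanishes exactly on solutions of the integral equation. Keeping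
  -- (parameter, initial value) as first component turns the implicit function problem into
  -- inversion of G.
  let G : (P × E) × C(TimeInterval, E) → (P × E) × C(TimeInterval, E) := fun z =>
    (z.1, z.2 - (constCLM _ E z.1.2 + integrate E (velocity f hf.continuous (z.1.1, z.2))))
  have hG : ContDiff ℝ ∞ G := by
    refine contDiff_fst.prodMk (contDiff_snd.sub (((constCLM _ E).contDiff.comp
      (contDiff_snd.comp contDiff_fst)).add ((integrate E).contDiff.comp
        ((contDiff_velocity f hf).comp ((contDiff_fst.comp contDiff_fst).prodMk contDiff_snd)))))
  set z₀ : (P × E) × C(TimeInterval, E) := ((0, x₀), constCLM _ E x₀) with hz₀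
  let e : ((P × E) × C(TimeInterval, E)) ≃L[ℝ] ((P × E) × C(TimeInterval, E)) :=
    (ContinuousLinearEquiv.refl ℝ (P × E)).skewProd (ContinuousLinearEquiv.refl ℝ _) (-D)
  -- The field vanishes for parameter 0, hence so does its derivative in the space variable. The
  -- linearization of G in the curve direction is thus the identity and dG is the shear `e`, with no
  -- smallness of time required.
  have hvert : ∀ v : E, fderiv ℝ f (0, x₀) (0, v) = 0 := by
    intro v
    have h1 : HasFDerivAt f (fderiv ℝ f (0, x₀)) ((0 : P), x₀) :=
      (hf.differentiable (by simp) _).hasFDerivAt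
    have h2 := h1.comp x₀ (hasFDerivAt_prodMk_right (𝕜 := ℝ) (0 : P) x₀)
    have h3 : f ∘ (fun q => ((0 : P), q)) = fun _ => 0 := funext hf0
    rw [h3] at h2
    have h4 := h2.unique (hasFDerivAt_const (0 : E) x₀)
    have := congrArg (fun L : E →L[ℝ] E => L v) h4
    simpa using this
  have hGd : HasFDerivAt G (e : ((P × E) × C(TimeInterval, E)) →L[ℝ]
      ((P × E) × C(TimeInterval, E))) z₀ := by
    have h1 := hasFDerivAt_velocity f hf ((0 : P), constCLM _ E x₀)
    have h2 := h1.comp z₀ (((ContinuousLinearMap.fst ℝ P E).comp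
      (ContinuousLinearMap.fst ℝ (P × E) C(TimeInterval, E))).prod
        (ContinuousLinearMap.snd ℝ (P × E) C(TimeInterval, E))).hasFDerivAt
    have h3 := ((ContinuousLinearMap.fst ℝ (P × E) C(TimeInterval, E)).hasFDerivAt (x := z₀)).prodMk
      (((ContinuousLinearMap.snd ℝ (P × E) C(TimeInterval, E)).hasFDerivAt (x := z₀)).sub
        ((((constCLM TimeInterval E).comp ((ContinuousLinearMap.snd ℝ P E).comp
          (ContinuousLinearMap.fst ℝ (P × E) C(TimeInterval, E)))).hasFDerivAt (x := z₀)).add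
          ((integrate E).hasFDerivAt.comp z₀ h2)))
    refine h3.congr_fderiv ?_
    refine ContinuousLinearMap.ext fun ⟨⟨η, ζ⟩, v⟩ => ?_
    refine Prod.ext rfl ?_
    have hint : (pointwiseBilin (ContinuousLinearMap.id ℝ (P × E →L[ℝ] E))
        (velocity (fderiv ℝ f) (hf.continuous_fderiv (by simp)) ((0 : P), constCLM _ E x₀)))
          (graphCLM P E (η, v)) = constCLM _ E (fderiv ℝ f (0, x₀) (η, 0)) := by
      ext τ
      have : ((η, v τ) : P × E) = (η, 0) + (0, v τ) := by simp
      simp [this, hvert, -Prod.mk_add_mk]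
    simp only [e, hD]
    simp
    rw [hint]
    abel
  have hG0 : G z₀ = ((0, x₀), 0) := by
    refine Prod.ext rfl ?_
    have : velocity f hf.continuous ((0 : P), constCLM _ E x₀) = 0 := by
      ext τ
      simp [hf0]
    simp [G, z₀, this]
  obtain ⟨N, hNo, hzN, S, hS, -, hGS⟩ := exists_contDiffOn_rightInverse isOpen_univ
    hG.contDiffOn (Set.mem_univ z₀) hGd
  -- The solution curve for w is the curve component of the inverse of G at (w, 0).
  let j : P × E → (P × E) × C(TimeInterval, E) := fun w => (w, 0)
  have hj : ContDiff ℝ ∞ j := contDiff_id.prodMk contDiff_const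
  refine ⟨j ⁻¹' N, hNo.preimage hj.continuous, show ((0, x₀), 0) ∈ N from by rwa [hG0] at hzN, fun w => (S (j w)).2,
    contDiff_snd.comp_contDiffOn (hS.comp hj.contDiffOn fun w hw => hw), fun w hw => ?_⟩
  have h1 : G (S (j w)) = j w := (hGS _ hw).2
  have h2 : (S (j w)).1 = w := congrArg Prod.fst h1
  have h3 := congrArg Prod.snd h1
  simp only [G, h2, j, sub_eq_zero] at h3
  exact h3

end Flow


/-! ### Families linear in the parameter and their linearized equation. -/

section LinearFamily

variable {ι : Type*} [Fintype ι]
  {E : Type*} [NormedAddCommGroup E] [NormedSpace ℝ E]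

/-- The field `(y, q) ↦ ∑ yᵢ Xᵢ(q)` depending linearly on the parameter. -/
def combField {F : Type*} [AddCommGroup F] [Module ℝ F] (X : ι → E → F)
    (w : EuclideanSpace ℝ ι × E) : F :=
  ∑ i, w.1 i • X i w.2

theorem contDiff_coord (i : ι) : ContDiff ℝ ∞ (fun y : EuclideanSpace ℝ ι => y i) :=
  (EuclideanSpace.proj (𝕜 := ℝ) i).contDiff

theorem contDiff_combField {F : Type*} [NormedAddCommGroup F] [NormedSpace ℝ F] {X : ι → E → F}
    (hX : ∀ i, ContDiff ℝ ∞ (X i)) : ContDiff ℝ ∞ (combField X) := by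
  unfold combField
  exact ContDiff.sum fun i _ => ((contDiff_coord i).comp contDiff_fst).smul
    ((hX i).comp contDiff_snd)

theorem fderiv_combField {X : ι → E → E} (hX : ∀ i, ContDiff ℝ ∞ (X i))
    (w u : EuclideanSpace ℝ ι × E) :
    fderiv ℝ (combField X) w u =
      ∑ i, u.1 i • X i w.2 + combField (fun i => fderiv ℝ (X i)) w u.2 := by
  have h1 : ∀ i ∈ Finset.univ, HasFDerivAt (fun w : EuclideanSpace ℝ ι × E => w.1 i • X i w.2)
      (w.1 i • (fderiv ℝ (X i) w.2).comp (ContinuousLinearMap.snd ℝ (EuclideanSpace ℝ ι) E) +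
        ((EuclideanSpace.proj (𝕜 := ℝ) i).comp
          (ContinuousLinearMap.fst ℝ (EuclideanSpace ℝ ι) E)).smulRight (X i w.2)) w := by
    intro i _
    exact (((EuclideanSpace.proj (𝕜 := ℝ) i).comp
      (ContinuousLinearMap.fst ℝ (EuclideanSpace ℝ ι) E)).hasFDerivAt (x := w)).smul
      ((((hX i).differentiable (by simp) w.2).hasFDerivAt).comp w hasFDerivAt_snd)
  have h2 : HasFDerivAt (combField X) _ w := HasFDerivAt.fun_sum h1
  rw [h2.fderiv]
  simp [combField, Finset.sum_add_distrib, add_comm]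

variable [CompleteSpace E]

/-- The solution curve with parameter and initial value `w`, where `Γ w` solves the integral
equation, extended to all times. -/
theorem exists_hasDerivAt_extend {F : Type*} [NormedAddCommGroup F] [NormedSpace ℝ F]
    [CompleteSpace F] {γ g : C(TimeInterval, F)} {p : F}
    (h : γ = constCLM _ F p + integrate F g) :
    ∃ δ : ℝ → F, δ 0 = p ∧ (∀ τ : TimeInterval, δ τ = γ τ) ∧
      ∀ τ : TimeInterval, HasDerivAt δ (g τ) τ := by
  -- Since the integrand is continued by constants beyond [-2, 2], the primitive has a two-sided
  -- derivative also at the endpoints.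
  refine ⟨fun t => p + ∫ s in (0 : ℝ)..t, extend g s, by simp, fun τ => ?_, fun τ => ?_⟩
  · conv_rhs => rw [h]
    rfl
  · have := (hasDerivAt_integral_extend g τ).const_add p
    rwa [extend_of_mem g τ.2] at this

variable {X : ι → E → E} (hX : ∀ i, ContDiff ℝ ∞ (X i))

/-- Integration composed with multiplication by a curve of coefficients. -/
noncomputable def volterra {A F : Type*} [NormedAddCommGroup A] [NormedSpace ℝ A]
    [NormedAddCommGroup F] [NormedSpace ℝ F] (β : A →L[ℝ] F →L[ℝ] F) :
    C(TimeInterval, A) →L[ℝ] C(TimeInterval, F) →L[ℝ] C(TimeInterval, F) :=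
  ((ContinuousLinearMap.compL ℝ C(TimeInterval, F) C(TimeInterval, F) C(TimeInterval, F))
    (integrate F)).comp (pointwiseBilin β)

theorem volterra_apply {A F : Type*} [NormedAddCommGroup A] [NormedSpace ℝ A]
    [NormedAddCommGroup F] [NormedSpace ℝ F] (β : A →L[ℝ] F →L[ℝ] F) (L : C(TimeInterval, A))
    (g : C(TimeInterval, F)) : volterra β L g = integrate F (pointwiseBilin β L g) := rfl

theorem velocity_zero_param {F : Type*} [NormedAddCommGroup F] [NormedSpace ℝ F] {X : ι → E → F}
    (hX : Continuous (combField X)) (γ : C(TimeInterval, E)) :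
    velocity (combField X) hX ((0 : EuclideanSpace ℝ ι), γ) = 0 := by
  ext τ
  simp [combField]

include hX in
/-- The derivative of a family of solution curves solves the linearized equation. -/
theorem fderiv_solution_eq {𝒰 : Set (EuclideanSpace ℝ ι × E)} (h𝒰 : IsOpen 𝒰)
    {Γ : EuclideanSpace ℝ ι × E → C(TimeInterval, E)} (hΓ : ContDiffOn ℝ ∞ Γ 𝒰)
    (heq : ∀ w ∈ 𝒰, Γ w = constCLM _ E w.2 +
      integrate E (velocity (combField X) (contDiff_combField hX).continuous (w.1, Γ w)))
    {w : EuclideanSpace ℝ ι × E} (hw : w ∈ 𝒰) (u : EuclideanSpace ℝ ι × E) :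
    fderiv ℝ Γ w u = constCLM _ E u.2 +
      (integrate E (∑ i, u.1 i • superpose (X i) (hX i).continuous (Γ w)) +
      volterra (ContinuousLinearMap.id ℝ (E →L[ℝ] E)) (velocity (combField fun i => fderiv ℝ (X i))
        (contDiff_combField fun i => (hX i).fderiv_right (m := ∞) (by simp)).continuous (w.1, Γ w))
        (fderiv ℝ Γ w u)) := by
  have h1 : HasFDerivAt Γ (fderiv ℝ Γ w) w :=
    ((hΓ.contDiffAt (h𝒰.mem_nhds hw)).differentiableAt (by simp)).hasFDerivAt
  have h2 := (hasFDerivAt_velocity (combField X) (contDiff_combField hX) (w.1, Γ w)).comp w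
    ((ContinuousLinearMap.fst ℝ (EuclideanSpace ℝ ι) E).hasFDerivAt.prodMk h1)
  have h3 := ((constCLM TimeInterval E).comp
    (ContinuousLinearMap.snd ℝ (EuclideanSpace ℝ ι) E)).hasFDerivAt (x := w) |>.add
      ((integrate E).hasFDerivAt.comp w h2)
  have h4 := h3.congr_of_eventuallyEq (f₁ := Γ) (by
    filter_upwards [h𝒰.mem_nhds hw] with w' hw' using heq w' hw')
  have h5 := congrArg (fun L => L u) (h1.unique h4)
  refine h5.trans ?_
  rw [volterra_apply, ← map_add]
  refine congrArg (fun z => constCLM TimeInterval E u.2 + integrate E z) ?_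
  ext τ
  simp [fderiv_combField hX, ContinuousMap.sum_apply]

end LinearFamily


/-! ### The time-one flow of an involutive family in a vector space. -/

section LocalFlow

variable {ι : Type*} [Fintype ι]
  {E : Type*} [NormedAddCommGroup E] [NormedSpace ℝ E] [CompleteSpace E]

theorem one_mem_Icc : (1 : ℝ) ∈ Set.Icc (-2 : ℝ) 2 := ⟨by norm_num, by norm_num⟩

/-- Evaluation of a curve at time one. -/
noncomputable def evalOne (F : Type*) [NormedAddCommGroup F] [NormedSpace ℝ F] :
    C(TimeInterval, F) →L[ℝ] F :=
  ContinuousMap.evalCLM ℝ (⟨1, one_mem_Icc⟩ : TimeInterval)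

theorem evalOne_apply {F : Type*} [NormedAddCommGroup F] [NormedSpace ℝ F]
    (g : C(TimeInterval, F)) : evalOne F g = g ⟨1, one_mem_Icc⟩ := rfl

theorem evalOne_constCLM {F : Type*} [NormedAddCommGroup F] [NormedSpace ℝ F] (a : F) :
    evalOne F (constCLM _ F a) = a := rfl

theorem evalOne_integrate_constCLM {F : Type*} [NormedAddCommGroup F] [NormedSpace ℝ F]
    [CompleteSpace F] (a : F) : evalOne F (integrate F (constCLM _ F a)) = a := by
  rw [evalOne_apply, integrate_apply]
  simp [extend]

theorem contDiff_volterra {A F : Type*} [NormedAddCommGroup A] [NormedSpace ℝ A]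
    [NormedAddCommGroup F] [NormedSpace ℝ F] (β : A →L[ℝ] F →L[ℝ] F) :
    ContDiff ℝ ∞ (fun L => volterra β L) :=
  ContinuousLinearMap.contDiff (𝕜 := ℝ) (E := C(TimeInterval, A))
    (F := C(TimeInterval, F) →L[ℝ] C(TimeInterval, F)) (volterra β)

theorem volterra_zero {A F : Type*} [NormedAddCommGroup A] [NormedSpace ℝ A]
    [NormedAddCommGroup F] [NormedSpace ℝ F] (β : A →L[ℝ] F →L[ℝ] F) : volterra β 0 = 0 :=
  map_zero _

theorem norm_lt_one_of_mem_ball {A : Type*} [NormedAddCommGroup A] {L : A}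
    (h : L ∈ Metric.ball (0 : A) 1) : ‖L‖ < 1 :=
  mem_ball_zero_iff.1 h

/-- The difference of the two solutions is fixed by an operator of norm less than 1, so it vanishes.
This is the uniqueness used for the linearized equation. -/
theorem eq_of_volterra_eq {A F : Type*} [NormedAddCommGroup A] [NormedSpace ℝ A]
    [NormedAddCommGroup F] [NormedSpace ℝ F] {β : A →L[ℝ] F →L[ℝ] F} {L : C(TimeInterval, A)}
    (hL : ‖volterra β L‖ < 1) {v w r : C(TimeInterval, F)} (hv : v = r + volterra β L v)
    (hw : w = r + volterra β L w) : v = w := by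
  have h : v - w = volterra β L (v - w) := by
    rw [map_sub]
    nth_rewrite 1 [hv, hw]
    abel
  have h2 : ‖v - w‖ ≤ ‖volterra β L‖ * ‖v - w‖ := by
    conv_lhs => rw [h]
    exact ContinuousLinearMap.le_opNorm _ _
  have h3 : ‖v - w‖ = 0 := by
    by_contra h0
    have : 0 < ‖v - w‖ := lt_of_le_of_ne (norm_nonneg _) (Ne.symm h0)
    nlinarith
  exact sub_eq_zero.1 (norm_eq_zero.1 h3)

/-- The structure matrix attached to bracket coefficients. -/
noncomputable def bracketMatrix [DecidableEq ι] (c : ι → ι → ι → E → ℝ) (l : ι) (q : E) :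
    EuclideanSpace ℝ ι →L[ℝ] EuclideanSpace ℝ ι :=
  ∑ j, ∑ k, c l j k q • (EuclideanSpace.proj (𝕜 := ℝ) j).smulRight (EuclideanSpace.single k (1 : ℝ))

theorem bracketMatrix_apply [DecidableEq ι] (c : ι → ι → ι → E → ℝ) (l : ι) (q : E)
    (a : EuclideanSpace ℝ ι) (k : ι) : bracketMatrix c l q a k = ∑ j, a j * c l j k q := by
  simp [bracketMatrix, mul_comm, Pi.single_apply]

theorem contDiff_bracketMatrix [DecidableEq ι] {c : ι → ι → ι → E → ℝ}
    (hc : ∀ l j k, ContDiff ℝ ∞ (c l j k)) (l : ι) : ContDiff ℝ ∞ (bracketMatrix c l) := by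
  unfold bracketMatrix
  exact ContDiff.sum fun j _ => ContDiff.sum fun k _ => (hc l j k).smul contDiff_const

variable {X : ι → E → E} (hX : ∀ i, ContDiff ℝ ∞ (X i))

/-- Differentiation produces a_j y_l DX_j(X_l). Exchanging the roles of j and l costs the bracket ∑
c_ljk X_k, and the equation imposed on a is chosen so that its matrix term cancels these brackets.
What remains is the linearized flow equation with source ∑ η_i X_i. -/
theorem hasDerivAt_transport [DecidableEq ι] (hX : ∀ i, ContDiff ℝ ∞ (X i))
    {c : ι → ι → ι → E → ℝ} {y η : EuclideanSpace ℝ ι} {γ : ℝ → E}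
    {a : ℝ → EuclideanSpace ℝ ι} {t : ℝ}
    (hbr : ∀ l j, fderiv ℝ (X j) (γ t) (X l (γ t)) - fderiv ℝ (X l) (γ t) (X j (γ t)) =
      ∑ k, c l j k (γ t) • X k (γ t))
    (hγ : HasDerivAt γ (combField X (y, γ t)) t)
    (ha : HasDerivAt a (η - combField (bracketMatrix c) (y, γ t) (a t)) t) :
    HasDerivAt (fun t => ∑ j, a t j • X j (γ t))
      (∑ i, η i • X i (γ t) +
        combField (fun i => fderiv ℝ (X i)) (y, γ t) (∑ j, a t j • X j (γ t))) t := by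
  have h1 : ∀ j ∈ Finset.univ, HasDerivAt (fun t => a t j • X j (γ t))
      (a t j • fderiv ℝ (X j) (γ t) (combField X (y, γ t)) +
        (η - combField (bracketMatrix c) (y, γ t) (a t)) j • X j (γ t)) t := by
    intro j _
    refine HasDerivAt.smul ?_ ?_
    · exact (EuclideanSpace.proj (𝕜 := ℝ) j).hasFDerivAt.comp_hasDerivAt t ha
    · exact (((hX j).differentiable (by simp) (γ t)).hasFDerivAt).comp_hasDerivAt t hγ
  refine (HasDerivAt.fun_sum h1).congr_deriv ?_
  have hbr' : ∀ l j, fderiv ℝ (X j) (γ t) (X l (γ t)) =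
      fderiv ℝ (X l) (γ t) (X j (γ t)) + ∑ k, c l j k (γ t) • X k (γ t) := fun l j => by
    rw [← hbr l j]
    abel
  have e1 : ∀ j, a t j • fderiv ℝ (X j) (γ t) (combField X (y, γ t)) =
      ∑ l, (a t j * y l) • fderiv ℝ (X l) (γ t) (X j (γ t)) +
      ∑ l, ∑ k, (a t j * y l * c l j k (γ t)) • X k (γ t) := by
    intro j
    rw [← Finset.sum_add_distrib, combField, map_sum, Finset.smul_sum]
    refine Finset.sum_congr rfl fun l _ => ?_
    rw [map_smul, hbr', smul_add, smul_add, smul_smul, Finset.smul_sum, Finset.smul_sum]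
    simp only [smul_smul, mul_assoc]
  have e2 : ∀ k, combField (bracketMatrix c) (y, γ t) (a t) k =
      ∑ j, ∑ l, a t j * y l * c l j k (γ t) := by
    intro k
    have : combField (bracketMatrix c) (y, γ t) (a t) k =
        ∑ l, y l * bracketMatrix c l (γ t) (a t) k := by
      simp [combField]
    rw [this, Finset.sum_comm]
    refine Finset.sum_congr rfl fun l _ => ?_
    rw [bracketMatrix_apply, Finset.mul_sum]
    refine Finset.sum_congr rfl fun j _ => by ring
  have e3 : ∑ k, combField (bracketMatrix c) (y, γ t) (a t) k • X k (γ t) =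
      ∑ j, ∑ l, ∑ k, (a t j * y l * c l j k (γ t)) • X k (γ t) := by
    simp only [e2, Finset.sum_smul]
    rw [Finset.sum_comm]
    refine Finset.sum_congr rfl fun j _ => ?_
    rw [Finset.sum_comm]
  have e4 : combField (fun i => fderiv ℝ (X i)) (y, γ t) (∑ j, a t j • X j (γ t)) =
      ∑ j, ∑ l, (a t j * y l) • fderiv ℝ (X l) (γ t) (X j (γ t)) := by
    simp only [combField, sum_apply, smul_apply, map_sum,
      map_smul]
    simp only [Finset.smul_sum, smul_smul]
  simp only [Finset.sum_add_distrib, e1, PiLp.sub_apply, sub_smul, Finset.sum_sub_distrib, e3, e4]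
  abel

/-- The local time-one flow of the fields `∑ yᵢ Xᵢ` for small `y`: it is smooth in all variables, and
if the `Xᵢ` are in involution its differential maps the `Xᵢ` and the parameter directions to smooth
combinations of the `Xᵢ`. -/
theorem exists_local_flow [DecidableEq ι] (hX : ∀ i, ContDiff ℝ ∞ (X i)) (x₀ : E) {O : Set E}
    (hO : O ∈ 𝓝 x₀) :
    ∃ 𝒰 : Set (EuclideanSpace ℝ ι × E), IsOpen 𝒰 ∧ (0, x₀) ∈ 𝒰 ∧
      ∃ T : EuclideanSpace ℝ ι × E → E, ContDiffOn ℝ ∞ T 𝒰 ∧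
        (∀ w ∈ 𝒰, ∃ γ : ℝ → E, γ 0 = w.2 ∧ γ 1 = T w ∧ ∀ t ∈ Set.Icc (-2 : ℝ) 2, γ t ∈ O ∧
          HasDerivAt γ (combField X (w.1, γ t)) t) ∧
        (∀ p, (0, p) ∈ 𝒰 → T (0, p) = p ∧
          ∀ η ζ, fderiv ℝ T (0, p) (η, ζ) = ζ + ∑ i, η i • X i p) ∧
        ∀ c : ι → ι → ι → E → ℝ, (∀ l j k, ContDiff ℝ ∞ (c l j k)) →
          (∀ q ∈ O, ∀ l j, fderiv ℝ (X j) q (X l q) - fderiv ℝ (X l) q (X j q) =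
            ∑ k, c l j k q • X k q) →
          ∃ 𝒱 ⊆ 𝒰, IsOpen 𝒱 ∧ (0, x₀) ∈ 𝒱 ∧
            ∃ R : EuclideanSpace ℝ ι × E →
              (EuclideanSpace ℝ ι × EuclideanSpace ℝ ι →L[ℝ] EuclideanSpace ℝ ι),
              ContDiffOn ℝ ∞ R 𝒱 ∧ (∀ p, (0, p) ∈ 𝒱 → ∀ b η, R (0, p) (b, η) = b + η) ∧
              ∀ w ∈ 𝒱, ∀ b η : EuclideanSpace ℝ ι,
                fderiv ℝ T w (η, ∑ j, b j • X j w.2) = ∑ j, R w (b, η) j • X j (T w) := by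
  obtain ⟨𝒰₀, h𝒰₀, hx₀, Γ, hΓ, heq⟩ := exists_solution_curve (combField X) (contDiff_combField hX)
    (fun q => by simp [combField]) x₀
  have hDX : ContDiff ℝ ∞ (combField (fun i => fderiv ℝ (X i))) :=
    contDiff_combField fun i => (hX i).fderiv_right (m := ∞) (by simp)
  have hΓ0 : ∀ p, (0, p) ∈ 𝒰₀ → Γ (0, p) = constCLM _ E p := fun p hp => by
    rw [heq _ hp, velocity_zero_param, map_zero, add_zero]
  have hpair : ContDiffOn ℝ ∞ (fun w => (w.1, Γ w)) 𝒰₀ := contDiff_fst.contDiffOn.prodMk hΓ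
  have hVol : ContDiffOn ℝ ∞ (fun w => volterra (ContinuousLinearMap.id ℝ (E →L[ℝ] E))
      (velocity _ hDX.continuous (w.1, Γ w))) 𝒰₀ :=
    (contDiff_volterra _).comp_contDiffOn
      ((contDiff_velocity _ hDX).comp_contDiffOn hpair)
  obtain ⟨r, hr, hrO⟩ := Metric.mem_nhds_iff.1 hO
  -- The first condition makes the Volterra operator of the linearized equation have norm below 1,
  -- which gives uniqueness; the second keeps the whole curve inside O. Both hold at (0, x₀), where
  -- the operator is 0 and the curve constant.
  set 𝒰 := 𝒰₀ ∩ (fun w => (volterra (ContinuousLinearMap.id ℝ (E →L[ℝ] E))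
      (velocity _ hDX.continuous (w.1, Γ w)), Γ w)) ⁻¹'
        (Metric.ball 0 1 ×ˢ Metric.ball (constCLM _ E x₀) r) with h𝒰def
  have h𝒰 : IsOpen 𝒰 := (hVol.continuousOn.prodMk hΓ.continuousOn).isOpen_inter_preimage h𝒰₀
    (Metric.isOpen_ball.prod Metric.isOpen_ball)
  have hx : ((0 : EuclideanSpace ℝ ι), x₀) ∈ 𝒰 := by
    refine ⟨hx₀, ?_, ?_⟩
    · change volterra _ (velocity _ hDX.continuous ((0 : EuclideanSpace ℝ ι), _)) ∈ _
      rw [velocity_zero_param, volterra_zero]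
      exact Metric.mem_ball_self one_pos
    · change Γ _ ∈ _
      rw [hΓ0 _ hx₀]
      exact Metric.mem_ball_self hr
  have hsub : 𝒰 ⊆ 𝒰₀ := fun w hw => hw.1
  have hΓO : ∀ w ∈ 𝒰, ∀ τ, Γ w τ ∈ O := fun w hw τ => hrO (by
    have h2 : dist (Γ w) (constCLM _ E x₀) < r := hw.2.2
    exact (ContinuousMap.dist_apply_le_dist τ).trans_lt h2)
  have hTd : ∀ w ∈ 𝒰, ∀ u, fderiv ℝ (fun w => evalOne E (Γ w)) w u =
      evalOne E (fderiv ℝ Γ w u) := fun w hw u => by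
    have h1 : HasFDerivAt Γ (fderiv ℝ Γ w) w :=
      ((hΓ.contDiffAt (h𝒰₀.mem_nhds hw.1)).differentiableAt (by simp)).hasFDerivAt
    have h2 := (evalOne E).hasFDerivAt.comp w h1
    exact congrArg (fun L => L u) h2.fderiv
  have hlin := fun (w) (hw : w ∈ 𝒰) => fderiv_solution_eq hX h𝒰₀ hΓ heq hw.1
  refine ⟨𝒰, h𝒰, hx, fun w => evalOne E (Γ w), (evalOne E).contDiff.comp_contDiffOn (hΓ.mono hsub),
    fun w hw => ?_, fun p hp => ⟨?_, fun η ζ => ?_⟩, fun c hc hbr => ?_⟩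
  · obtain ⟨δ, hδ0, hδ, hδd⟩ := exists_hasDerivAt_extend (heq w hw.1)
    refine ⟨δ, hδ0, hδ ⟨1, one_mem_Icc⟩, fun t ht => ?_⟩
    have h1 := hδ ⟨t, ht⟩
    have h2 := hδd ⟨t, ht⟩
    rw [velocity_apply, ← h1] at h2
    exact ⟨h1 ▸ hΓO w hw _, h2⟩
  · change evalOne E (Γ (0, p)) = p
    rw [hΓ0 _ hp.1, evalOne_constCLM]
  · rw [hTd _ hp, hlin _ hp, velocity_zero_param, volterra_zero, zero_apply, add_zero,
      map_add, evalOne_constCLM, hΓ0 _ hp.1]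
    have : ∑ i, η i • superpose (X i) (hX i).continuous (constCLM TimeInterval E p) =
        constCLM _ E (∑ i, η i • X i p) := by
      ext τ
      simp [ContinuousMap.sum_apply]
    rw [this, evalOne_integrate_constCLM]
  · have hC : ContDiff ℝ ∞ (combField (bracketMatrix c)) :=
      contDiff_combField fun l => contDiff_bracketMatrix hc l
    -- The coefficient equation a' = η - C a, a(0) = b, in integrated form reads Q a = N(b, η),
    -- where N(b, η) is the curve τ ↦ b + τ η. At parameter 0 the operator Q is the identity, so it
    -- is invertible nearby, and R is the time-one value of its inverse applied to N.
    set Q : EuclideanSpace ℝ ι × E →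
        (C(TimeInterval, EuclideanSpace ℝ ι) →L[ℝ] C(TimeInterval, EuclideanSpace ℝ ι)) :=
      fun w => 1 + volterra (ContinuousLinearMap.id ℝ _) (velocity _ hC.continuous (w.1, Γ w))
    have hQ : ContDiffOn ℝ ∞ Q 𝒰₀ := contDiffOn_const.add
      ((contDiff_volterra _).comp_contDiffOn
        ((contDiff_velocity _ hC).comp_contDiffOn hpair))
    have hQ0 : ∀ p, (0, p) ∈ 𝒰₀ → Q (0, p) = 1 := fun p hp => by
      simp only [Q]
      rw [velocity_zero_param, volterra_zero, add_zero]
    set N : EuclideanSpace ℝ ι × EuclideanSpace ℝ ι →L[ℝ]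
        C(TimeInterval, EuclideanSpace ℝ ι) :=
      (constCLM _ _).comp (ContinuousLinearMap.fst ℝ _ _) + ((integrate _).comp
        ((constCLM _ _).comp (ContinuousLinearMap.snd ℝ _ _))) with hN
    refine ⟨𝒰 ∩ Q ⁻¹' {u | IsUnit u}, Set.inter_subset_left,
      (hQ.mono hsub).continuousOn.isOpen_inter_preimage h𝒰
        (Units.isOpen (R := C(TimeInterval, EuclideanSpace ℝ ι) →L[ℝ]
          C(TimeInterval, EuclideanSpace ℝ ι))),
      ⟨hx, by simp [hQ0 _ hx₀]⟩,
      fun w => (evalOne _).comp ((Ring.inverse (Q w)).comp N), ?_, fun p hp b η => ?_,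
      fun w hw b η => ?_⟩
    · refine contDiffOn_const.clm_comp (ContDiffOn.clm_comp ?_ contDiffOn_const)
      intro w hw
      obtain ⟨u, hu⟩ := hw.2
      have h1 : ContDiffAt ℝ ∞ Ring.inverse (Q w) := by
        rw [← hu]
        exact contDiffAt_ringInverse ℝ (R := C(TimeInterval, EuclideanSpace ℝ ι) →L[ℝ]
          C(TimeInterval, EuclideanSpace ℝ ι)) u
      exact h1.comp_contDiffWithinAt w ((hQ w (hsub hw.1)).mono fun z hz => hsub hz.1)
    · simp only [hQ0 _ hp.1.1, Ring.inverse_one]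
      change evalOne _ (N (b, η)) = _
      rw [hN]
      change evalOne _ (constCLM _ _ b + integrate _ (constCLM _ _ η)) = _
      rw [map_add, evalOne_constCLM, evalOne_integrate_constCLM]
    · obtain ⟨hw𝒰, hu⟩ := hw
      set a := Ring.inverse (Q w) (N (b, η)) with ha
      have hQa : Q w a = N (b, η) := by
        rw [ha, ← mul_apply_eq_comp, Ring.mul_inverse_cancel _ hu]
        rfl
      have haeq : a = constCLM _ _ b + integrate _ (constCLM _ _ η -
          pointwiseBilin (ContinuousLinearMap.id ℝ _) (velocity _ hC.continuous (w.1, Γ w)) a) := by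
        rw [map_sub, ← add_sub_assoc, eq_sub_iff_add_eq]
        exact hQa
      obtain ⟨α, hα0, hα, hαd⟩ := exists_hasDerivAt_extend haeq
      obtain ⟨δ, hδ0, hδ, hδd⟩ := exists_hasDerivAt_extend (heq w hw𝒰.1)
      -- The curve ∑ a_j X_j(Γ w) satisfies the same linear integral equation as the derivative of Γ
      -- in the direction (η, ∑ b_j X_j), with the same source and initial value. Uniqueness
      -- identifies the two, and evaluation at time 1 gives the claim.
      set W : C(TimeInterval, E) := ∑ j,
        pointwiseBilin (ContinuousLinearMap.lsmul ℝ ℝ)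
          (postcompCLM _ (EuclideanSpace.proj (𝕜 := ℝ) j) a)
          (superpose (X j) (hX j).continuous (Γ w)) with hW
      have hWapp : ∀ τ, W τ = ∑ j, a τ j • X j (Γ w τ) := fun τ => by
        simp [hW, ContinuousMap.sum_apply]
      have hWeq := eq_const_add_integrate (h := fun t => ∑ j, α t j • X j (δ t)) (w := W)
        (g := ∑ i, η i • superpose (X i) (hX i).continuous (Γ w) +
          pointwiseBilin (ContinuousLinearMap.id ℝ _) (velocity _ hDX.continuous (w.1, Γ w)) W)
        (fun τ => by simp only [hWapp, hα, hδ])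
        (fun τ => by
          have h1 := hδd τ
          have h2 := hαd τ
          rw [velocity_apply, ← hδ] at h1
          have h3 := hasDerivAt_transport (η := η) (a := α) hX
            (fun l j => hbr (δ τ) (hδ τ ▸ hΓO w hw𝒰 τ) l j) h1
            (h2.congr_deriv (by simp [hα, hδ]))
          refine h3.congr_deriv ?_
          simp [ContinuousMap.sum_apply, hWapp, hα, hδ])
      have hveq := hlin w hw𝒰 (η, ∑ j, b j • X j w.2)
      rw [map_add, ← add_assoc] at hWeq
      rw [← add_assoc] at hveq
      simp only [hα0, hδ0] at hWeq
      have hVlt : ‖volterra (ContinuousLinearMap.id ℝ (E →L[ℝ] E))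
          (velocity _ hDX.continuous (w.1, Γ w))‖ < 1 := by
        exact norm_lt_one_of_mem_ball (A := C(TimeInterval, E) →L[ℝ] C(TimeInterval, E)) hw𝒰.2.1
      have hvW := eq_of_volterra_eq hVlt hveq hWeq
      rw [hTd w hw𝒰, hvW, evalOne_apply, hWapp]
      rfl

end LocalFlow


/-! ### Cut-off functions and extension of smooth functions. -/

section Cutoff

variable {E : Type*} [NormedAddCommGroup E] [NormedSpace ℝ E] [FiniteDimensional ℝ E]
  {H : Type*} [TopologicalSpace H] {I : ModelWithCorners ℝ E H}
  {M : Type*} [TopologicalSpace M] [ChartedSpace H M] [IsManifold I ∞ M] [T2Space M]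

/-- A smooth cut-off function with compact support in a given neighbourhood. -/
theorem exists_bump {x : M} {O : Set M} (hO : O ∈ 𝓝 x) :
    ∃ χ : Smooth I M, HasCompactSupport (χ : M → ℝ) ∧ tsupport (χ : M → ℝ) ⊆ O ∧
      ∃ V : Set M, IsOpen V ∧ x ∈ V ∧ V ⊆ O ∧ ∀ p ∈ V, χ p = 1 := by
  obtain ⟨f, -, hf⟩ := (SmoothBumpFunction.nhds_basis_tsupport (I := I) x).mem_iff.1 hO
  obtain ⟨V, hV, hVo, hxV⟩ := eventually_nhds_iff.1 f.eventuallyEq_one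
  refine ⟨⟨f, f.contMDiff⟩, f.hasCompactSupport, hf, V, hVo, hxV, fun p hp => ?_, hV⟩
  refine hf (subset_tsupport _ ?_)
  change f p ≠ 0
  rw [hV p hp]
  exact one_ne_zero

/-- Cutting off a locally defined smooth function. -/
theorem contMDiff_smul_of_tsupport {F : Type*} [NormedAddCommGroup F] [NormedSpace ℝ F]
    {χ : Smooth I M} {g : M → F} {O : Set M} (hO : IsOpen O)
    (hχ : tsupport (χ : M → ℝ) ⊆ O) (hg : ContMDiffOn I 𝓘(ℝ, F) ∞ g O) :
    ContMDiff I 𝓘(ℝ, F) ∞ (fun p => χ p • g p) := by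
  refine contMDiff_of_tsupport fun p hp => ?_
  exact χ.contMDiff.contMDiffAt.smul (hg.contMDiffAt (hO.mem_nhds
    (hχ (closure_mono (Function.support_smul_subset_left _ _) hp))))

theorem exists_contMDiff_extension {F : Type*} [NormedAddCommGroup F] [NormedSpace ℝ F]
    {g : M → F} {O : Set M} (hO : IsOpen O) (hg : ContMDiffOn I 𝓘(ℝ, F) ∞ g O) {x : M}
    (hx : x ∈ O) : ∃ h : M → F, ContMDiff I 𝓘(ℝ, F) ∞ h ∧ h =ᶠ[𝓝 x] g := by
  obtain ⟨χ, -, hχ, V, hV, hxV, -, hχV⟩ := exists_bump (I := I) (hO.mem_nhds hx)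
  refine ⟨_, contMDiff_smul_of_tsupport hO hχ hg, ?_⟩
  filter_upwards [hV.mem_nhds hxV] with p hp
  rw [hχV p hp, one_smul]

/-- Extension by zero of a compactly supported function on an open set. -/
theorem exists_extend_zero {U : Opens M} (f : Smooth I U) (hf : HasCompactSupport (f : U → ℝ)) :
    ∃ g : Smooth I M, HasCompactSupport (g : M → ℝ) ∧ ∀ u : U, g u = f u := by
  refine ⟨⟨Function.extend Subtype.val f 0, ContMDiff.extend_zero hf f.contMDiff⟩, ?_, fun u =>
    Subtype.val_injective.extend_apply _ _ u⟩
  have hcpt : IsCompact (Subtype.val '' tsupport (f : U → ℝ)) :=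
    IsCompact.image hf continuous_subtype_val
  refine HasCompactSupport.intro hcpt fun p hp => ?_
  change Function.extend Subtype.val f 0 p = 0
  by_cases hpU : p ∈ U
  · have h1 := Subtype.val_injective.extend_apply f 0 (⟨p, hpU⟩ : U)
    change Function.extend Subtype.val f 0 p = f ⟨p, hpU⟩ at h1
    rw [h1]
    exact image_eq_zero_of_notMem_tsupport fun h => hp ⟨_, h, rfl⟩
  · rw [Function.extend_apply' _ _ _ (by simpa using hpU)]
    rfl

end Cutoff

/-! ### Elements of pull-back modules and of foliations. -/

section Modules

variable {E : Type*} [NormedAddCommGroup E] [NormedSpace ℝ E]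
  {H : Type*} [TopologicalSpace H] {I : ModelWithCorners ℝ E H}
  {M : Type*} [TopologicalSpace M] [ChartedSpace H M] [IsManifold I ∞ M]
  {E' : Type*} [NormedAddCommGroup E'] [NormedSpace ℝ E']
  {H' : Type*} [TopologicalSpace H'] {J : ModelWithCorners ℝ E' H'}
  {N : Type*} [TopologicalSpace N] [ChartedSpace H' N] [IsManifold J ∞ N]

theorem sum_section_apply {ι : Type*} (s : Finset ι) (φ : N → M)
    (Y : ι → ∀ u : N, TangentSpace I (φ u)) (u : N) : (∑ i ∈ s, Y i) u = ∑ i ∈ s, Y i u :=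
  Finset.sum_apply u s Y

/-- Elements of a pull-back module are finite sums of the generators. -/
theorem mem_pullbackModule_iff {φ : N → M}
    {𝓔 : Submodule (Smooth I M) (∀ x : M, TangentSpace I x)}
    {Y : ∀ u : N, TangentSpace I (φ u)} :
    Y ∈ pullbackModule I J φ 𝓔 ↔ ∃ (m : ℕ) (f : Fin m → Smooth J N)
      (ξ : Fin m → ∀ x : M, TangentSpace I x), (∀ i, HasCompactSupport (f i : N → ℝ)) ∧
        (∀ i, ξ i ∈ 𝓔) ∧ ∀ u, Y u = ∑ i, f i u • ξ i (φ u) := by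
  constructor
  · intro hY
    obtain ⟨m, h, g, rfl⟩ := Submodule.mem_span_set'.1 hY
    choose f hf ξ hξ hg using fun i => (g i).2
    refine ⟨m, fun i => h i * f i, ξ, fun i => ?_, hξ, fun u => ?_⟩
    · exact (hf i).mul_left
    · rw [sum_section_apply]
      refine Finset.sum_congr rfl fun i _ => ?_
      rw [smul_section_apply, hg]
      exact smul_smul _ _ _
  · rintro ⟨m, f, ξ, hf, hξ, hY⟩
    have : Y = ∑ i, fun u => f i u • ξ i (φ u) := by
      funext u
      rw [sum_section_apply, hY]
    rw [this]
    exact Submodule.sum_mem _ fun i _ => Submodule.subset_span ⟨f i, hf i, ξ i, hξ i, rfl⟩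

/-- The constant function, as an element of the algebra of smooth functions. -/
def constSmooth (I : ModelWithCorners ℝ E H) (M : Type*) [TopologicalSpace M] [ChartedSpace H M]
    (c : ℝ) : Smooth I M := ⟨fun _ => c, contMDiff_const⟩

/-- Needed so that each ∑ y_i X_i is compactly supported, hence complete. -/
theorem sum_smul_mem (F : Foliation I M) {ι : Type*} [Fintype ι] (X : ι → F.toModule)
    (y : ι → ℝ) :
    (fun q => ∑ i, y i • (X i : ∀ q : M, TangentSpace I q) q) ∈ F.toModule := by
  have : (fun q => ∑ i, y i • (X i : ∀ q : M, TangentSpace I q) q) =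
      ∑ i, constSmooth I M (y i) • (X i : ∀ q : M, TangentSpace I q) := by
    funext q
    rw [Finset.sum_apply]
    rfl
  rw [this]
  exact Submodule.sum_mem _ fun i _ => Submodule.smul_mem _ _ (X i).2

end Modules

/-! ### Local generators, Nakayama's lemma and relations in the fiber. -/

section Generators

variable {E : Type*} [NormedAddCommGroup E] [NormedSpace ℝ E] [FiniteDimensional ℝ E]
  {H : Type*} [TopologicalSpace H] {I : ModelWithCorners ℝ E H}
  {M : Type*} [TopologicalSpace M] [ChartedSpace H M] [IsManifold I ∞ M] [T2Space M]

/-- Elements of the restriction of a foliation to an open set extend to elements of the foliation. -/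
theorem exists_extension_of_mem_restriction (F : Foliation I M) {U : Opens M}
    {Y : ∀ u : U, TangentSpace I (u : M)}
    (hY : Y ∈ pullbackModule I I (fun u : U => (u : M)) F.toModule) :
    ∃ ζ : F.toModule, ∀ u : U, (ζ : ∀ x : M, TangentSpace I x) u = Y u := by
  obtain ⟨m, f, ξ, hf, hξ, hYe⟩ := mem_pullbackModule_iff.1 hY
  choose g _ hgf using fun i => exists_extend_zero (f i) (hf i)
  refine ⟨⟨∑ i, g i • ξ i, Submodule.sum_mem _ fun i _ => Submodule.smul_mem _ _ (hξ i)⟩,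
    fun u => ?_⟩
  rw [hYe]
  change (∑ i, g i • ξ i) (u : M) = _
  rw [Finset.sum_apply]
  refine Finset.sum_congr rfl fun i _ => ?_
  rw [smul_section_apply, hgf]

/-- A foliation is generated near each point by finitely many of its elements. -/
theorem exists_local_generators (F : Foliation I M) (x : M) :
    ∃ (k : ℕ) (ξ : Fin k → F.toModule) (V : Set M), IsOpen V ∧ x ∈ V ∧
      ∀ ζ ∈ F.toModule, ∃ c : Fin k → Smooth I M, ∀ p ∈ V,
        ζ p = ∑ i, c i p • (ξ i : ∀ x : M, TangentSpace I x) p := by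
  obtain ⟨U, hxU, k, ξ, hξ, hgen⟩ := F.locallyFinitelyGenerated x
  obtain ⟨χ, hχc, hχU, V, hV, hxV, hVU, hχV⟩ := exists_bump (I := I) (U.isOpen.mem_nhds hxU)
  -- The generators over U need not belong to the restricted module, but their multiples by the
  -- compactly supported ψ do. These extend to elements of F and are unchanged where ψ = 1.
  let ψ : Smooth I U := ⟨fun u => χ u, χ.contMDiff.comp contMDiff_subtype_val⟩
  have hψ : HasCompactSupport (ψ : U → ℝ) := by
    have hK : IsCompact (Subtype.val ⁻¹' tsupport (χ : M → ℝ) : Set U) :=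
      Topology.IsInducing.subtypeVal.isCompact_preimage_iff (by simpa using hχU) |>.2 hχc
    refine HasCompactSupport.intro hK fun u hu => ?_
    exact image_eq_zero_of_notMem_tsupport (f := (χ : M → ℝ)) hu
  choose ξ' hξ' using fun i => exists_extension_of_mem_restriction F ((hξ i).2 ψ hψ)
  refine ⟨k, ξ', V, hV, hxV, fun ζ hζ => ?_⟩
  have hmem : (fun u : U => ψ u • ζ u) ∈ pullbackModule I I (fun u : U => (u : M)) F.toModule :=
    Submodule.subset_span ⟨ψ, hψ, ζ, hζ, rfl⟩
  obtain ⟨f, hf, hfe⟩ := hgen _ hmem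
  choose g _ hgf using fun i => exists_extend_zero (f i) (hf i)
  refine ⟨g, fun p hp => ?_⟩
  have h1 := congrFun hfe ⟨p, hVU hp⟩
  have hψ1 : ψ ⟨p, hVU hp⟩ = 1 := hχV p hp
  simp only [hψ1, one_smul] at h1
  rw [h1, Finset.sum_apply]
  refine Finset.sum_congr rfl fun i _ => ?_
  have h2 := hξ' i ⟨p, hVU hp⟩
  have h3 := hgf i ⟨p, hVU hp⟩
  rw [smul_section_apply, hψ1, one_smul] at h2
  rw [smul_section_apply]
  change _ = g i p • (ξ' i : ∀ x : M, TangentSpace I x) p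
  rw [show g i p = f i ⟨p, hVU hp⟩ from h3]
  exact congrArg _ h2.symm

theorem mem_vanishingIdeal {x : M} {f : Smooth I M} : f ∈ vanishingIdeal I x ↔ f x = 0 := Iff.rfl

/-- The operator on row vectors attached to a square matrix. -/
noncomputable def rowOperator {ι : Type*} [Fintype ι] [DecidableEq ι] (m : ι → ι → ℝ) :
    EuclideanSpace ℝ ι →L[ℝ] EuclideanSpace ℝ ι :=
  ∑ j, ∑ k, m j k • (EuclideanSpace.proj (𝕜 := ℝ) j).smulRight (EuclideanSpace.single k (1 : ℝ))

theorem rowOperator_apply {ι : Type*} [Fintype ι] [DecidableEq ι] (m : ι → ι → ℝ)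
    (a : EuclideanSpace ℝ ι) (k : ι) : rowOperator m a k = ∑ j, a j * m j k := by
  simp [rowOperator, mul_comm, Pi.single_apply]

/-- Inversion of a smooth family of operators. -/
theorem contMDiffOn_ringInverse {R : Type*} [NormedRing R] [NormedAlgebra ℝ R]
    [HasSummableGeomSeries R] {B : M → R} {O : Set M} (hB : ContMDiffOn I 𝓘(ℝ, R) ∞ B O)
    (hu : ∀ p ∈ O, IsUnit (B p)) : ContMDiffOn I 𝓘(ℝ, R) ∞ (fun p => Ring.inverse (B p)) O := by
  intro p hp
  obtain ⟨u, hu'⟩ := hu p hp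
  have h1 : ContDiffAt ℝ ∞ Ring.inverse (B p) := by
    rw [← hu']
    exact contDiffAt_ringInverse ℝ u
  exact h1.contMDiffAt.comp_contMDiffWithinAt p (hB p hp)

theorem contMDiffOn_coord {ι : Type*} [Fintype ι] {f : M → EuclideanSpace ℝ ι} {O : Set M}
    (hf : ContMDiffOn I 𝓘(ℝ, EuclideanSpace ℝ ι) ∞ f O) (i : ι) :
    ContMDiffOn I 𝓘(ℝ, ℝ) ∞ (fun p => f p i) O :=
  (contDiff_coord i).contMDiff.comp_contMDiffOn hf

theorem contMDiffOn_toLp {ι : Type*} [Fintype ι] {f : ι → M → ℝ} {O : Set M}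
    (hf : ∀ i, ContMDiffOn I 𝓘(ℝ, ℝ) ∞ (f i) O) :
    ContMDiffOn I 𝓘(ℝ, EuclideanSpace ℝ ι) ∞ (fun p => WithLp.toLp 2 fun i => f i p) O :=
  (EuclideanSpace.equiv ι ℝ).symm.contDiff.contMDiff.comp_contMDiffOn
    (contMDiffOn_pi_space.2 hf)

section Fiber

variable (F : Foliation I M) (x : M) {n : ℕ} (X : Fin n → F.toModule)
  (b : Module.Basis (Fin n) ℝ (F.Fiber x)) (hb : ∀ i, b i = F.toFiber x (X i))

theorem sum_smul_toFiber (y : Fin n → ℝ) :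
    ∑ i, y i • F.toFiber x (X i) = F.toFiber x (∑ i, constSmooth I M (y i) • X i) := by
  have : ∀ i, y i • F.toFiber x (X i) = F.toFiber x (constSmooth I M (y i) • X i) := fun i => by
    change Submodule.Quotient.mk (y i • X i) = Submodule.Quotient.mk _
    rfl
  simp only [this]
  exact (map_sum (Submodule.mkQ _) _ _).symm

include b hb in
/-- Nakayama's lemma: fields representing a basis of the fiber at `x` generate the foliation
near `x`. -/
theorem exists_generating_nhd : ∃ U : Set M, IsOpen U ∧ x ∈ U ∧ ∀ ζ ∈ F.toModule,
    ∃ c : Fin n → M → ℝ, (∀ j, ContMDiffOn I 𝓘(ℝ, ℝ) ∞ (c j) U) ∧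
      ∀ p ∈ U, ζ p = ∑ j, c j p • (X j : ∀ x : M, TangentSpace I x) p := by
  obtain ⟨k, ξ, V, hV, hxV, hgen⟩ := exists_local_generators F x
  -- Elements of I_x F are, near x, combinations of the generators ξ with coefficients vanishing at
  -- x.
  have hideal : ∀ Y ∈ vanishingIdeal I x • (⊤ : Submodule (Smooth I M) F.toModule),
      ∃ m : Fin k → Smooth I M, (∀ l, m l x = 0) ∧ ∀ p ∈ V,
        (Y : ∀ x : M, TangentSpace I x) p =
          ∑ l, m l p • (ξ l : ∀ x : M, TangentSpace I x) p := by
    intro Y hY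
    induction hY using Submodule.smul_induction_on' with
    | smul g hg η _ =>
      obtain ⟨h, hh⟩ := hgen η η.2
      refine ⟨fun l => g * h l, fun l => ?_, fun p hp => ?_⟩
      · change g x * h l x = 0
        rw [mem_vanishingIdeal.1 hg, zero_mul]
      · change g p • (η : ∀ x : M, TangentSpace I x) p = _
        rw [hh p hp, Finset.smul_sum]
        exact Finset.sum_congr rfl fun l _ => smul_smul _ _ _
    | add Y _ Z _ hY hZ =>
      obtain ⟨m, hm, hmY⟩ := hY
      obtain ⟨m', hm', hmZ⟩ := hZ
      refine ⟨fun l => m l + m' l, fun l => ?_, fun p hp => ?_⟩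
      · change m l x + m' l x = 0
        rw [hm, hm', add_zero]
      · change (Y : ∀ x : M, TangentSpace I x) p + (Z : ∀ x : M, TangentSpace I x) p = _
        rw [hmY p hp, hmZ p hp, ← Finset.sum_add_distrib]
        exact Finset.sum_congr rfl fun l _ => (add_smul _ _ _).symm
  -- Expanding the class of ξ_i in the basis gives ξ = a X + m ξ with a a constant matrix and m(x) =
  -- 0.
  have hred : ∀ i, ∃ (a : Fin n → ℝ) (m : Fin k → Smooth I M), (∀ l, m l x = 0) ∧ ∀ p ∈ V,
      (ξ i : ∀ x : M, TangentSpace I x) p =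
        ∑ j, a j • (X j : ∀ x : M, TangentSpace I x) p +
          ∑ l, m l p • (ξ l : ∀ x : M, TangentSpace I x) p := by
    intro i
    set a := fun j => b.repr (F.toFiber x (ξ i)) j
    have h1 : F.toFiber x (ξ i) = F.toFiber x (∑ j, constSmooth I M (a j) • X j) := by
      rw [← sum_smul_toFiber]
      simp only [← hb, a]
      exact (b.sum_repr _).symm
    have h2 := (Submodule.Quotient.eq _).1 h1
    obtain ⟨m, hm, hmY⟩ := hideal _ h2
    refine ⟨a, m, hm, fun p hp => ?_⟩
    rw [← hmY p hp]
    change _ = _ + ((ξ i : ∀ x : M, TangentSpace I x) p -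
      ((∑ j, constSmooth I M (a j) • X j : F.toModule) : ∀ x : M, TangentSpace I x) p)
    rw [Submodule.coe_sum, Finset.sum_apply]
    change _ = ∑ j, a j • (X j : ∀ x : M, TangentSpace I x) p + (_ -
      ∑ j, a j • (X j : ∀ x : M, TangentSpace I x) p)
    abel
  choose a m hm hrel using hred
  -- From (1 - m) ξ = a X: a field ∑ f_i ξ_i is rewritten in the X_j by solving f = c (1 - m) for
  -- the row vector c, whence ∑ f_i ξ_i = c a X. The operator 1 - m is the identity at x, so it is
  -- invertible nearby.
  set B : M → (EuclideanSpace ℝ (Fin k) →L[ℝ] EuclideanSpace ℝ (Fin k)) :=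
    fun p => 1 - rowOperator fun i l => m i l p with hB
  have hBs : ContMDiff I 𝓘(ℝ, EuclideanSpace ℝ (Fin k) →L[ℝ] EuclideanSpace ℝ (Fin k)) ∞ B := by
    refine contMDiff_const.sub ?_
    unfold rowOperator
    exact contMDiff_finsetSum fun j _ => contMDiff_finsetSum fun l _ =>
      (m j l).contMDiff.smul contMDiff_const
  have hBx : B x = 1 := by
    have : rowOperator (fun i l => m i l x) = 0 := by
      ext a l
      simp [rowOperator_apply, hm]
    simp [hB, this]
  refine ⟨V ∩ B ⁻¹' {u | IsUnit u}, hV.inter (Units.isOpen.preimage hBs.continuous),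
    ⟨hxV, by simp [hBx]⟩, fun ζ hζ => ?_⟩
  obtain ⟨f, hf⟩ := hgen ζ hζ
  set c : M → EuclideanSpace ℝ (Fin k) := fun p =>
    Ring.inverse (B p) (WithLp.toLp 2 fun i => f i p) with hc
  have hcs : ContMDiffOn I 𝓘(ℝ, EuclideanSpace ℝ (Fin k)) ∞ c (V ∩ B ⁻¹' {u | IsUnit u}) :=
    (contMDiffOn_ringInverse hBs.contMDiffOn fun p hp => hp.2).clm_apply
      (contMDiffOn_toLp fun i => (f i).contMDiff.contMDiffOn)
  refine ⟨fun j p => ∑ i, c p i * a i j, fun j => ?_, fun p hp => ?_⟩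
  · exact contMDiffOn_finsetSum fun i _ => (contMDiffOn_coord hcs i).mul contMDiffOn_const
  · have hBc : ∀ l, f l p = c p l - ∑ i, c p i * m i l p := fun l => by
      have h1 : B p (c p) = WithLp.toLp 2 fun i => f i p := by
        rw [hc, ← mul_apply_eq_comp, Ring.mul_inverse_cancel _ hp.2]
        rfl
      have h2 := congrArg (fun v : EuclideanSpace ℝ (Fin k) => v l) h1
      simp only [hB] at h2
      rw [← h2, ← rowOperator_apply fun i l => m i l p]
      rfl
    rw [hf p hp.1]
    simp only [hBc, sub_smul, Finset.sum_sub_distrib, Finset.sum_smul]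
    have e1 : ∀ l, c p l • (ξ l : ∀ x : M, TangentSpace I x) p =
        ∑ j, (c p l * a l j) • (X j : ∀ x : M, TangentSpace I x) p +
          ∑ l', (c p l * m l l' p) • (ξ l' : ∀ x : M, TangentSpace I x) p := fun l => by
      rw [hrel l p hp.1, smul_add, Finset.smul_sum, Finset.smul_sum]
      simp only [smul_smul]
    simp only [e1, Finset.sum_add_distrib]
    rw [add_sub_assoc, Finset.sum_comm, add_eq_left, sub_eq_zero]
    exact Finset.sum_comm

include b hb in
/-- Smooth relations between fields representing a basis of the fiber at `x` vanish at `x`. -/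
theorem coeff_eq_zero_of_relation {m : Fin n → M → ℝ} {O : Set M} (hO : IsOpen O) (hx : x ∈ O)
    (hm : ∀ k, ContMDiffOn I 𝓘(ℝ, ℝ) ∞ (m k) O)
    (hrel : ∀ p ∈ O, ∑ k, m k p • (X k : ∀ x : M, TangentSpace I x) p = 0) (k : Fin n) :
    m k x = 0 := by
  obtain ⟨χ, -, hχ, V, hV, hxV, -, hχV⟩ := exists_bump (I := I) (hO.mem_nhds hx)
  let f : Fin n → Smooth I M := fun k => ⟨_, contMDiff_smul_of_tsupport hO hχ (hm k)⟩
  have hfx : ∀ k, f k x = m k x := fun k => by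
    change χ x • m k x = m k x
    rw [hχV x hxV, one_smul]
  have hsum : ∑ k, f k • X k = 0 := by
    refine Subtype.ext ?_
    rw [Submodule.coe_sum]
    funext p
    rw [Finset.sum_apply]
    change ∑ k, (χ p • m k p) • (X k : ∀ x : M, TangentSpace I x) p = 0
    have hχp : ∑ k, (χ p • m k p) • (X k : ∀ x : M, TangentSpace I x) p =
        χ p • ∑ k, m k p • (X k : ∀ x : M, TangentSpace I x) p := by
      rw [Finset.smul_sum]
      exact Finset.sum_congr rfl fun k _ => mul_smul _ _ _
    rw [hχp]
    by_cases hp : p ∈ O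
    · rw [hrel p hp, smul_zero]
    · rw [image_eq_zero_of_notMem_tsupport fun h => hp (hχ h), zero_smul]
  have hz : ∑ k, m k x • b k = 0 := by
    simp only [hb]
    rw [sum_smul_toFiber]
    refine (Submodule.Quotient.mk_eq_zero _).2 ?_
    -- Subtracting the global relation ∑ f_k X_k = 0 leaves the coefficients m_k(x) - f_k, which
    -- vanish at x; the sum therefore lies in I_x F and its class is 0.
    have : ∑ k, constSmooth I M (m k x) • X k =
        ∑ k, (constSmooth I M (m k x) - f k) • X k := by
      rw [← sub_zero (∑ k, constSmooth I M (m k x) • X k), ← hsum, ← Finset.sum_sub_distrib]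
      exact Finset.sum_congr rfl fun k _ => (sub_smul _ _ _).symm
    rw [this]
    refine Submodule.sum_mem _ fun k _ => Submodule.smul_mem_smul ?_ trivial
    change m k x - f k x = 0
    rw [hfx, sub_self]
  exact Fintype.linearIndependent_iff.1 b.linearIndependent _ hz k

end Fiber

end Generators

/-! ### Pull-back modules in terms of coefficient functions. -/

section PullbackDescription

variable {E : Type*} [NormedAddCommGroup E] [NormedSpace ℝ E]
  {H : Type*} [TopologicalSpace H] {I : ModelWithCorners ℝ E H}
  {M : Type*} [TopologicalSpace M] [ChartedSpace H M] [IsManifold I ∞ M]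
  {E' : Type*} [NormedAddCommGroup E'] [NormedSpace ℝ E']
  {H' : Type*} [TopologicalSpace H'] {J : ModelWithCorners ℝ E' H'}
  {N : Type*} [TopologicalSpace N] [ChartedSpace H' N] [IsManifold J ∞ N]

/-- Local coefficients of the elements of a pull-back module with respect to local generators. -/
theorem exists_coeff_of_mem_pullback [T2Space N] (F : Foliation I M) {n : ℕ} {X : Fin n → F.toModule}
    {U : Set M} (hU : ∀ ζ ∈ F.toModule,
      ∃ c : Fin n → M → ℝ, (∀ j, ContMDiffOn I 𝓘(ℝ, ℝ) ∞ (c j) U) ∧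
        ∀ p ∈ U, ζ p = ∑ j, c j p • (X j : ∀ x : M, TangentSpace I x) p)
    {φ : N → M} {O : Set N} (hφ : ContMDiffOn J I ∞ φ O) (hφU : ∀ u ∈ O, φ u ∈ U)
    {Y : ∀ u : N, TangentSpace I (φ u)} (hY : Y ∈ pullbackModule I J φ F.toModule) :
    ∃ g : Fin n → N → ℝ, (∀ j, ContMDiffOn J 𝓘(ℝ, ℝ) ∞ (g j) O) ∧
      (∀ j, HasCompactSupport (g j)) ∧
      ∀ u ∈ O, Y u = ∑ j, g j u • (X j : ∀ x : M, TangentSpace I x) (φ u) := by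
  obtain ⟨m, f, ξ, hf, hξ, hYe⟩ := mem_pullbackModule_iff.1 hY
  choose c hc hcξ using fun i => hU (ξ i) (hξ i)
  -- The functions c are uncontrolled outside U, but the factors f_i confine the support globally.
  refine ⟨fun j u => ∑ i, f i u * c i j (φ u), fun j => ?_, fun j => ?_, fun u hu => ?_⟩
  · exact contMDiffOn_finsetSum fun i _ => (f i).contMDiff.contMDiffOn.mul
      ((hc i j).comp hφ fun u hu => hφU u hu)
  · have hK : IsCompact (⋃ i, tsupport (f i : N → ℝ)) := isCompact_iUnion fun i => hf i
    refine HasCompactSupport.of_support_subset_isCompact hK fun u hu => ?_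
    obtain ⟨i, -, hi⟩ := Finset.exists_ne_zero_of_sum_ne_zero hu
    exact Set.mem_iUnion.2 ⟨i, subset_tsupport _ (left_ne_zero_of_mul hi)⟩
  · rw [hYe]
    simp only [Finset.sum_smul]
    rw [Finset.sum_comm]
    refine Finset.sum_congr rfl fun i _ => ?_
    rw [hcξ i _ (hφU u hu), Finset.smul_sum]
    exact Finset.sum_congr rfl fun j _ => smul_smul _ _ _

theorem mem_pullback_of_coeff (F : Foliation I M) {n : ℕ} (X : Fin n → F.toModule)
    {φ : N → M} {g : Fin n → N → ℝ} (hg : ∀ j, ContMDiff J 𝓘(ℝ, ℝ) ∞ (g j))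
    (hgc : ∀ j, HasCompactSupport (g j)) {Y : ∀ u : N, TangentSpace I (φ u)}
    (hY : ∀ u, Y u = ∑ j, g j u • (X j : ∀ x : M, TangentSpace I x) (φ u)) :
    Y ∈ pullbackModule I J φ F.toModule :=
  mem_pullbackModule_iff.2 ⟨n, fun j => ⟨g j, hg j⟩, fun j => X j, hgc, fun j => (X j).2, hY⟩

end PullbackDescription


/-! ### Differentials of inclusions and derivatives along fields. -/

section Calculus

variable {E : Type*} [NormedAddCommGroup E] [NormedSpace ℝ E]
  {H : Type*} [TopologicalSpace H] {I : ModelWithCorners ℝ E H}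
  {M : Type*} [TopologicalSpace M] [ChartedSpace H M] [IsManifold I ∞ M]

/-- Charts of an open subset are restrictions of charts of M, so the inclusion reads as the identity
in them. -/
theorem hasMFDerivAt_subtype_val (U : Opens M) (u : U) :
    HasMFDerivAt I I (Subtype.val : U → M) u (ContinuousLinearMap.id ℝ E) := by
  refine ⟨continuous_subtype_val.continuousAt, ?_⟩
  have hid : HasFDerivWithinAt (id : E → E) (ContinuousLinearMap.id ℝ E) (Set.range I)
      (extChartAt I u u) := hasFDerivWithinAt_id _ _
  refine hid.congr_of_eventuallyEq ?_ ?_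
  · filter_upwards [extChartAt_target_mem_nhdsWithin (I := I) u] with z hz
    exact (extChartAt I u).right_inv hz
  · have := (extChartAt I u).left_inv (mem_extChartAt_source (I := I) u)
    exact congrArg _ (congrArg Subtype.val this)

/-- The derivative of a smooth function along a smooth vector field is smooth. -/
theorem contMDiffOn_mfderiv_section {F : Type*} [NormedAddCommGroup F] [NormedSpace ℝ F]
    {Z : ∀ u : M, TangentSpace I u} (hZ : IsSmoothSection I I (fun u : M => u) Z) {f : M → F}
    {O : Set M} (hO : IsOpen O) (hf : ContMDiffOn I 𝓘(ℝ, F) ∞ f O) :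
    ContMDiffOn I 𝓘(ℝ, F) ∞ (fun u => (mfderiv I 𝓘(ℝ, F) f u (Z u) : F)) O := by
  have h1 : ContMDiffOn I.tangent 𝓘(ℝ, F).tangent ∞ (tangentMapWithin I 𝓘(ℝ, F) f O) _ :=
    hf.contMDiffOn_tangentMapWithin (m := ∞) (by simp) hO.uniqueMDiffOn
  have h2 : ContMDiffOn I 𝓘(ℝ, F).tangent ∞
      (fun u => tangentMapWithin I 𝓘(ℝ, F) f O (⟨u, Z u⟩ : TangentBundle I M)) O :=
    h1.comp hZ.contMDiffOn fun u hu => hu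
  have h3 := (contMDiff_snd_tangentBundle_modelSpace (𝕜 := ℝ) (n := ∞) F
    𝓘(ℝ, F)).comp_contMDiffOn h2
  refine h3.congr fun u hu => ?_
  change _ = mfderivWithin I 𝓘(ℝ, F) f O u (Z u)
  rw [mfderivWithin_of_isOpen hO hu]

end Calculus

/-! ### Vector fields and Lie brackets in a chart. -/

section Charts

variable {E : Type*} [NormedAddCommGroup E] [NormedSpace ℝ E]
  {M : Type*} [TopologicalSpace M] [ChartedSpace E M] [IsManifold 𝓘(ℝ, E) ∞ M]

theorem contMDiffOn_chartAt_self (x : M) :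
    ContMDiffOn 𝓘(ℝ, E) 𝓘(ℝ, E) ∞ (chartAt E x) (chartAt E x).source := contMDiffOn_chart

theorem contMDiffOn_chartAt_symm_self (x : M) :
    ContMDiffOn 𝓘(ℝ, E) 𝓘(ℝ, E) ∞ (chartAt E x).symm (chartAt E x).target := contMDiffOn_chart_symm

theorem chart_mdifferentiable (x : M) :
    (chartAt E x).MDifferentiable 𝓘(ℝ, E) 𝓘(ℝ, E) := mdifferentiable_chart x

/-- The coordinate expression of a vector field in the chart at a point. -/
noncomputable def chartField (x : M) (X : ∀ q : M, TangentSpace 𝓘(ℝ, E) q) (q : E) : E :=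
  mfderiv 𝓘(ℝ, E) 𝓘(ℝ, E) (chartAt E x) ((chartAt E x).symm q) (X ((chartAt E x).symm q))

theorem contDiffOn_chartField (x : M) {X : ∀ q : M, TangentSpace 𝓘(ℝ, E) q}
    (hX : IsSmoothSection 𝓘(ℝ, E) 𝓘(ℝ, E) (fun q : M => q) X) :
    ContDiffOn ℝ ∞ (chartField x X) (chartAt E x).target := by
  have h1 := contMDiffOn_mfderiv_section hX (chartAt E x).open_source (contMDiffOn_chartAt_self x)
  have h2 := h1.comp (contMDiffOn_chartAt_symm_self x) fun q hq => (chartAt E x).map_target hq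
  exact h2.contDiffOn

theorem mfderiv_symm_chartField (x : M) (X : ∀ q : M, TangentSpace 𝓘(ℝ, E) q) {q : E}
    (hq : q ∈ (chartAt E x).target) :
    mfderiv 𝓘(ℝ, E) 𝓘(ℝ, E) (chartAt E x).symm q (chartField (E := E) x X q : E) =
      X ((chartAt E x).symm q) := by
  have h1 := (chart_mdifferentiable x).symm_comp_deriv ((chartAt E x).map_target hq)
  rw [(chartAt E x).right_inv hq] at h1
  exact congrArg (fun L : E →L[ℝ] E => L (X ((chartAt E x).symm q))) h1

theorem mfderiv_chart_comp (x : M) {q : E} (hq : q ∈ (chartAt E x).target) (v : E) :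
    mfderiv 𝓘(ℝ, E) 𝓘(ℝ, E) (chartAt E x) ((chartAt E x).symm q)
      (mfderiv 𝓘(ℝ, E) 𝓘(ℝ, E) (chartAt E x).symm q v) = v :=
  congrArg (fun L : E →L[ℝ] E => L v) ((chart_mdifferentiable x).comp_symm_deriv hq)

/-- This makes the naturality of the Lie bracket under pull-back available for coordinate
expressions. -/
theorem chartField_eq_mpullback (x : M) (X : ∀ q : M, TangentSpace 𝓘(ℝ, E) q) {q : E}
    (hq : q ∈ (chartAt E x).target) :
    chartField x X q = VectorField.mpullback 𝓘(ℝ, E) 𝓘(ℝ, E) (chartAt E x).symm X q := by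
  set A : E →L[ℝ] E := mfderiv 𝓘(ℝ, E) 𝓘(ℝ, E) (chartAt E x).symm q with hA
  set B : E →L[ℝ] E := mfderiv 𝓘(ℝ, E) 𝓘(ℝ, E) (chartAt E x) ((chartAt E x).symm q) with hB
  have h1 : B.comp A = ContinuousLinearMap.id ℝ E := (chart_mdifferentiable x).comp_symm_deriv hq
  have h2 := (chart_mdifferentiable x).symm_comp_deriv ((chartAt E x).map_target hq)
  rw [(chartAt E x).right_inv hq] at h2
  have h3 : A.comp B = ContinuousLinearMap.id ℝ E := h2
  have : A.inverse = B := ContinuousLinearMap.inverse_eq h3 h1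
  change B _ = A.inverse _
  rw [this]

/-- The coordinate expression of a Lie bracket. -/
theorem chartField_mlieBracket [CompleteSpace E] (x : M) {X Y : ∀ q : M, TangentSpace 𝓘(ℝ, E) q}
    (hX : IsSmoothSection 𝓘(ℝ, E) 𝓘(ℝ, E) (fun q : M => q) X)
    (hY : IsSmoothSection 𝓘(ℝ, E) 𝓘(ℝ, E) (fun q : M => q) Y) {q : E}
    (hq : q ∈ (chartAt E x).target) :
    chartField x (VectorField.mlieBracket 𝓘(ℝ, E) X Y) q =
      fderiv ℝ (chartField x Y) q (chartField x X q) -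
        fderiv ℝ (chartField x X) q (chartField x Y q) := by
  have hev : ∀ Z : ∀ q : M, TangentSpace 𝓘(ℝ, E) q, chartField x Z =ᶠ[𝓝 q]
      VectorField.mpullback 𝓘(ℝ, E) 𝓘(ℝ, E) (chartAt E x).symm Z := fun Z => by
    filter_upwards [(chartAt E x).open_target.mem_nhds hq] with z hz
    exact chartField_eq_mpullback x Z hz
  have hat : ContMDiffAt 𝓘(ℝ, E) 𝓘(ℝ, E) ∞ (chartAt E x).symm q :=
    (contMDiffOn_chartAt_symm_self x).contMDiffAt ((chartAt E x).open_target.mem_nhds hq)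
  have : IsManifold 𝓘(ℝ, E) (minSmoothness ℝ 3) M :=
    IsManifold.of_le (n := ∞) (by
      rw [minSmoothness_of_isRCLikeNormedField]
      exact WithTop.coe_le_coe.2 (le_top : (3 : ℕ∞) ≤ ⊤))
  rw [chartField_eq_mpullback x _ hq, VectorField.mpullback_mlieBracket
    (hX.contMDiffAt.mdifferentiableAt (by simp)) (hY.contMDiffAt.mdifferentiableAt (by simp)) hat
    (by
      rw [minSmoothness_of_isRCLikeNormedField]
      exact WithTop.coe_le_coe.2 (le_top : (2 : ℕ∞) ≤ ⊤)),
    ← (hev X).mlieBracket_vectorField_eq (hev Y)]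
  have h := congrFun (VectorField.mlieBracketWithin_eq_lieBracketWithin (𝕜 := ℝ) (V := chartField x X)
    (W := chartField x Y) (s := Set.univ)) q
  rw [VectorField.lieBracketWithin_univ] at h
  exact (congrFun VectorField.mlieBracketWithin_univ.symm q).trans h

/-- Curves in a chart give curves on the manifold. -/
theorem hasMFDerivAt_chart_symm_comp (x : M) {γ : ℝ → E} {t : ℝ} {w : E} (hγ : HasDerivAt γ w t)
    (ht : γ t ∈ (chartAt E x).target) :
    HasMFDerivAt 𝓘(ℝ, ℝ) 𝓘(ℝ, E) (fun t => (chartAt E x).symm (γ t)) t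
      ((1 : ℝ →L[ℝ] ℝ).smulRight
        (mfderiv 𝓘(ℝ, E) 𝓘(ℝ, E) (chartAt E x).symm (γ t) w : E)) := by
  have h1 := ((chart_mdifferentiable x).mdifferentiableAt_symm ht).hasMFDerivAt
  have h2 := h1.comp t hγ.hasFDerivAt.hasMFDerivAt
  refine h2.congr_mfderiv ?_
  refine ContinuousLinearMap.ext fun r => ?_
  let A : E →L[ℝ] E := mfderiv 𝓘(ℝ, E) 𝓘(ℝ, E) (chartAt E x).symm (γ t)
  have h3 : ∀ r : ℝ, A (r • w) = r • A w := fun r => map_smul A r w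
  exact h3 r

end Charts


/-! ### Differentials and fields with values in fixed model spaces. -/

section FlatDerivative

variable {E : Type*} [NormedAddCommGroup E] [NormedSpace ℝ E]
  {H : Type*} [TopologicalSpace H] (I : ModelWithCorners ℝ E H)
  {M : Type*} [TopologicalSpace M] [ChartedSpace H M]
  {E' : Type*} [NormedAddCommGroup E'] [NormedSpace ℝ E']
  {H' : Type*} [TopologicalSpace H'] (J : ModelWithCorners ℝ E' H')
  {N : Type*} [TopologicalSpace N] [ChartedSpace H' N]

/-- The differential of a map between manifolds, as a linear map between the model spaces. -/
noncomputable def modelDeriv (f : M → N) (u : M) : E →L[ℝ] E' := mfderiv I J f u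

variable {I J} in
theorem _root_.MDifferentiableAt.hasMFDerivAt_modelDeriv {f : M → N} {u : M}
    (hf : MDifferentiableAt I J f u) :
    HasMFDerivAt I J f u (modelDeriv (E := E) (E' := E') I J f u) := hf.hasMFDerivAt

variable {I} in
/-- A vector field, as a map to the model space. -/
def modelField (X : ∀ u : M, TangentSpace I u) (u : M) : E := X u

variable {I} in
theorem _root_.HasMFDerivAt.prodMk_model {F F' : Type*} [NormedAddCommGroup F] [NormedSpace ℝ F]
    [NormedAddCommGroup F'] [NormedSpace ℝ F'] {f : M → F} {g : M → F'} {x : M}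
    {f' : E →L[ℝ] F} {g' : E →L[ℝ] F'} (hf : HasMFDerivAt I 𝓘(ℝ, F) f x f')
    (hg : HasMFDerivAt I 𝓘(ℝ, F') g x g') :
    HasMFDerivAt I 𝓘(ℝ, F × F') (fun x => (f x, g x)) x (f'.prod g') :=
  ⟨hf.1.prodMk hg.1, hf.2.prodMk hg.2⟩

end FlatDerivative

/-! ### The local flow on a manifold, transported through a chart. -/

section Flow

variable {E : Type*} [NormedAddCommGroup E] [NormedSpace ℝ E] [FiniteDimensional ℝ E]
  {M : Type*} [TopologicalSpace M] [ChartedSpace E M] [IsManifold 𝓘(ℝ, E) ∞ M]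

theorem modelDeriv_chart_flow {ι : Type*} [Fintype ι]
    {x : M} {T : EuclideanSpace ℝ ι × E → E}
    {w : EuclideanSpace ℝ ι × M} (hw : w.2 ∈ (chartAt E x).source)
    (hT : DifferentiableAt ℝ T (w.1, chartAt E x w.2))
    (hTw : T (w.1, chartAt E x w.2) ∈ (chartAt E x).target)
    (η : EuclideanSpace ℝ ι) (ζ : E) :
    modelDeriv (𝓘(ℝ, EuclideanSpace ℝ ι).prod 𝓘(ℝ, E)) 𝓘(ℝ, E)
      (fun w : EuclideanSpace ℝ ι × M => (chartAt E x).symm (T (w.1, chartAt E x w.2))) w (η, ζ) =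
    modelDeriv 𝓘(ℝ, E) 𝓘(ℝ, E) (chartAt E x).symm (T (w.1, chartAt E x w.2))
      (fderiv ℝ T (w.1, chartAt E x w.2)
        (η, modelDeriv 𝓘(ℝ, E) 𝓘(ℝ, E) (chartAt E x) w.2 ζ)) := by
  have h0 := ((chart_mdifferentiable x).mdifferentiableAt hw).hasMFDerivAt_modelDeriv
  have hf : HasMFDerivAt (𝓘(ℝ, EuclideanSpace ℝ ι).prod 𝓘(ℝ, E)) 𝓘(ℝ, EuclideanSpace ℝ ι)
      (fun w : EuclideanSpace ℝ ι × M => w.1) w (ContinuousLinearMap.fst ℝ (EuclideanSpace ℝ ι) E) :=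
    hasMFDerivAt_fst w
  have hs : HasMFDerivAt (𝓘(ℝ, EuclideanSpace ℝ ι).prod 𝓘(ℝ, E)) 𝓘(ℝ, E)
      (fun w : EuclideanSpace ℝ ι × M => w.2) w (ContinuousLinearMap.snd ℝ (EuclideanSpace ℝ ι) E) :=
    hasMFDerivAt_snd w
  have hc : HasMFDerivAt (𝓘(ℝ, EuclideanSpace ℝ ι).prod 𝓘(ℝ, E)) 𝓘(ℝ, E)
      (fun w : EuclideanSpace ℝ ι × M => chartAt E x w.2) w
      ((modelDeriv (E := E) (E' := E) 𝓘(ℝ, E) 𝓘(ℝ, E) (chartAt E x) w.2).comp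
        (ContinuousLinearMap.snd ℝ (EuclideanSpace ℝ ι) E)) := h0.comp w hs
  have h1 : HasMFDerivAt (𝓘(ℝ, EuclideanSpace ℝ ι).prod 𝓘(ℝ, E)) 𝓘(ℝ, EuclideanSpace ℝ ι × E)
      (fun w : EuclideanSpace ℝ ι × M => (w.1, chartAt E x w.2)) w
      ((ContinuousLinearMap.fst ℝ (EuclideanSpace ℝ ι) E).prod
        ((modelDeriv (E := E) (E' := E) 𝓘(ℝ, E) 𝓘(ℝ, E) (chartAt E x) w.2).comp
          (ContinuousLinearMap.snd ℝ (EuclideanSpace ℝ ι) E))) :=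
    hf.prodMk_model hc
  have h2 : HasMFDerivAt 𝓘(ℝ, EuclideanSpace ℝ ι × E) 𝓘(ℝ, E) T (w.1, chartAt E x w.2) _ :=
    hT.hasFDerivAt.hasMFDerivAt
  have h3 : HasMFDerivAt 𝓘(ℝ, E) 𝓘(ℝ, E) (chartAt E x).symm (T (w.1, chartAt E x w.2)) _ :=
    ((chart_mdifferentiable x).mdifferentiableAt_symm hTw).hasMFDerivAt
  exact congrArg (fun L : EuclideanSpace ℝ ι × E →L[ℝ] E => L (η, ζ))
    (h3.comp w (h2.comp w h1)).mfderiv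

/-- The local flow of a finite family of vector fields on a manifold. -/
theorem exists_local_flow_manifold [T2Space M] {ι : Type*} [Fintype ι] [DecidableEq ι]
    (X : ι → ∀ q : M, TangentSpace 𝓘(ℝ, E) q)
    (hX : ∀ i, IsSmoothSection 𝓘(ℝ, E) 𝓘(ℝ, E) (fun q : M => q) (X i)) (x : M) {O : Set M}
    (hO : IsOpen O) (hx : x ∈ O) :
    ∃ 𝒰 : Set (EuclideanSpace ℝ ι × M), IsOpen 𝒰 ∧ ((0 : EuclideanSpace ℝ ι), x) ∈ 𝒰 ∧
      ∃ τ : EuclideanSpace ℝ ι × M → M,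
        ContMDiffOn (𝓘(ℝ, EuclideanSpace ℝ ι).prod 𝓘(ℝ, E)) 𝓘(ℝ, E) ∞ τ 𝒰 ∧
        (∀ w ∈ 𝒰, ∃ γ : ℝ → M, γ 0 = w.2 ∧ γ 1 = τ w ∧ ∀ t ∈ Set.Icc (-2 : ℝ) 2, γ t ∈ O ∧
          HasMFDerivAt 𝓘(ℝ, ℝ) 𝓘(ℝ, E) γ t
            ((1 : ℝ →L[ℝ] ℝ).smulRight (∑ i, w.1 i • X i (γ t)))) ∧
        (∀ p, ((0 : EuclideanSpace ℝ ι), p) ∈ 𝒰 → τ (0, p) = p ∧ ∀ η ζ,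
          modelDeriv (𝓘(ℝ, EuclideanSpace ℝ ι).prod 𝓘(ℝ, E)) 𝓘(ℝ, E) τ (0, p) (η, ζ) =
            ζ + ∑ i, η i • modelField (X i) p) ∧
        (∀ w ∈ 𝒰, Function.Injective fun ζ : E =>
          modelDeriv (𝓘(ℝ, EuclideanSpace ℝ ι).prod 𝓘(ℝ, E)) 𝓘(ℝ, E) τ w (0, ζ)) ∧
        (∀ w ∈ 𝒰, Function.Surjective
          (modelDeriv (𝓘(ℝ, EuclideanSpace ℝ ι).prod 𝓘(ℝ, E)) 𝓘(ℝ, E) τ w)) ∧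
        ∀ c : ι → ι → ι → M → ℝ, (∀ l j k, ContMDiffOn 𝓘(ℝ, E) 𝓘(ℝ, ℝ) ∞ (c l j k) O) →
          (∀ q ∈ O, ∀ l j, VectorField.mlieBracket 𝓘(ℝ, E) (X l) (X j) q =
            ∑ k, c l j k q • X k q) →
          ∃ 𝒱 ⊆ 𝒰, IsOpen 𝒱 ∧ ((0 : EuclideanSpace ℝ ι), x) ∈ 𝒱 ∧
            ∃ R : EuclideanSpace ℝ ι × M →
              (EuclideanSpace ℝ ι × EuclideanSpace ℝ ι →L[ℝ] EuclideanSpace ℝ ι),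
              ContMDiffOn (𝓘(ℝ, EuclideanSpace ℝ ι).prod 𝓘(ℝ, E))
                𝓘(ℝ, EuclideanSpace ℝ ι × EuclideanSpace ℝ ι →L[ℝ] EuclideanSpace ℝ ι) ∞ R 𝒱 ∧
              (∀ p, ((0 : EuclideanSpace ℝ ι), p) ∈ 𝒱 → ∀ b η, R (0, p) (b, η) = b + η) ∧
              ∀ w ∈ 𝒱, ∀ b η,
                modelDeriv (𝓘(ℝ, EuclideanSpace ℝ ι).prod 𝓘(ℝ, E)) 𝓘(ℝ, E) τ w
                  (η, ∑ j, b j • modelField (X j) w.2) = ∑ j, R w (b, η) j • modelField (X j) (τ w) := by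
  set e := chartAt E x with he
  have hOe : IsOpen (e.target ∩ e.symm ⁻¹' O) := e.isOpen_inter_preimage_symm hO
  have hxs : x ∈ e.source := mem_chart_source E x
  have hxO : e x ∈ e.target ∩ e.symm ⁻¹' O := ⟨e.map_source hxs, by
    rw [Set.mem_preimage, e.left_inv hxs]
    exact hx⟩
  obtain ⟨χ, -, hχ, V, hV, hxV, hVO, hχV⟩ := exists_bump (I := 𝓘(ℝ, E)) (hOe.mem_nhds hxO)
  -- The coordinate fields are cut off to be smooth on all of E. They are unchanged on V, and the
  -- flow curves used below stay in V.
  set Y : ι → E → E := fun i q => χ q • chartField x (X i) q with hY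
  have hYs : ∀ i, ContDiff ℝ ∞ (Y i) := fun i =>
    (contMDiff_smul_of_tsupport hOe hχ
      ((contDiffOn_chartField x (hX i)).contMDiffOn.mono Set.inter_subset_left)).contDiff
  have hYV : ∀ q ∈ V, ∀ i, Y i q = chartField x (X i) q := fun q hq i => by
    simp only [hY, hχV q hq, one_smul]
  have hYV' : ∀ q ∈ V, ∀ i, Y i =ᶠ[𝓝 q] chartField x (X i) := fun q hq i => by
    filter_upwards [hV.mem_nhds hq] with z hz using hYV z hz i
  have hback : ∀ q ∈ V, ∀ a : ι → ℝ, modelDeriv 𝓘(ℝ, E) 𝓘(ℝ, E) e.symm q (∑ i, a i • Y i q) =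
      ∑ i, a i • modelField (X i) (e.symm q) := fun q hq a => by
    rw [map_sum]
    refine Finset.sum_congr rfl fun i _ => ?_
    rw [map_smul, hYV q hq]
    exact congrArg _ (mfderiv_symm_chartField x (X i) (hVO hq).1)
  have hsymm_inj : ∀ q ∈ e.target, Function.Injective (modelDeriv 𝓘(ℝ, E) 𝓘(ℝ, E) e.symm q) :=
    fun q hq => Function.LeftInverse.injective
      (g := modelDeriv 𝓘(ℝ, E) 𝓘(ℝ, E) e (e.symm q)) fun v => mfderiv_chart_comp x hq v
  have he_inj : ∀ p ∈ e.source, Function.Injective (modelDeriv 𝓘(ℝ, E) 𝓘(ℝ, E) e p) :=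
    fun p hp => Function.LeftInverse.injective
      (g := modelDeriv 𝓘(ℝ, E) 𝓘(ℝ, E) e.symm (e p)) fun v =>
        congrArg (fun L : E →L[ℝ] E => L v) ((chart_mdifferentiable x).symm_comp_deriv hp)
  have hforth : ∀ p ∈ e.source, e p ∈ V → ∀ a : ι → ℝ,
      modelDeriv 𝓘(ℝ, E) 𝓘(ℝ, E) e p (∑ i, a i • modelField (X i) p) = ∑ i, a i • Y i (e p) := by
    intro p hp hpV a
    rw [map_sum]
    refine Finset.sum_congr rfl fun i _ => ?_
    rw [map_smul, hYV _ hpV, chartField, ← he, e.left_inv hp]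
    rfl
  obtain ⟨𝒰₁, h𝒰₁, hx𝒰₁, T, hT₁, hcurve₁, hzero₁, hbr⟩ :=
    exists_local_flow hYs (e x) (hV.mem_nhds hxV)
  -- At parameter 0 the spatial derivative of the flow is the identity. Restricting to the open set
  -- where it is invertible yields the injectivity and surjectivity claims.
  set 𝒰 : Set (EuclideanSpace ℝ ι × E) := 𝒰₁ ∩ (fun w => (fderiv ℝ T w).comp
    (ContinuousLinearMap.inr ℝ (EuclideanSpace ℝ ι) E)) ⁻¹' {L | IsUnit L} with h𝒰d
  have h𝒰 : IsOpen 𝒰 := by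
    refine ContinuousOn.isOpen_inter_preimage ?_ h𝒰₁ Units.isOpen
    exact (ContinuousLinearMap.continuous ((ContinuousLinearMap.compL ℝ E
      (EuclideanSpace ℝ ι × E) E).flip (ContinuousLinearMap.inr ℝ _ E))).comp_continuousOn
      (hT₁.continuousOn_fderiv_of_isOpen h𝒰₁ (by simp))
  have hx𝒰 : ((0 : EuclideanSpace ℝ ι), e x) ∈ 𝒰 := by
    refine ⟨hx𝒰₁, ?_⟩
    have : (fderiv ℝ T (0, e x)).comp (ContinuousLinearMap.inr ℝ (EuclideanSpace ℝ ι) E) = 1 := by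
      ext ζ
      simp [(hzero₁ _ hx𝒰₁).2]
    simp only [Set.mem_preimage, this]
    exact isUnit_one
  have hT := hT₁.mono (Set.inter_subset_left : 𝒰 ⊆ 𝒰₁)
  have hcurve := fun w (hw : w ∈ 𝒰) => hcurve₁ w hw.1
  have hzero := fun p (hp : (0, p) ∈ 𝒰) => hzero₁ p hp.1
  set Φ : EuclideanSpace ℝ ι × M → EuclideanSpace ℝ ι × E := fun w => (w.1, e w.2) with hΦ
  have hΦs : ContMDiffOn (𝓘(ℝ, EuclideanSpace ℝ ι).prod 𝓘(ℝ, E)) 𝓘(ℝ, EuclideanSpace ℝ ι × E) ∞ Φ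
      (Prod.snd ⁻¹' e.source) :=
    contMDiff_fst.contMDiffOn.prodMk_space
      ((contMDiffOn_chartAt_self x).comp contMDiff_snd.contMDiffOn fun w hw => hw)
  have hopen : ∀ 𝒱 : Set (EuclideanSpace ℝ ι × E), IsOpen 𝒱 →
      IsOpen (Prod.snd ⁻¹' e.source ∩ Φ ⁻¹' 𝒱) := fun 𝒱 h𝒱 =>
    hΦs.continuousOn.isOpen_inter_preimage (e.open_source.preimage continuous_snd) h𝒱
  have hTV : ∀ w ∈ 𝒰, w.2 ∈ V ∧ T w ∈ V := fun w hw => by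
    obtain ⟨γ, h0, h1, hγ⟩ := hcurve w hw
    exact ⟨h0 ▸ (hγ 0 (by norm_num)).1, h1 ▸ (hγ 1 (by norm_num)).1⟩
  have hTd : ∀ w ∈ 𝒰, DifferentiableAt ℝ T w := fun w hw =>
    (hT.contDiffAt (h𝒰.mem_nhds hw)).differentiableAt (by simp)
  refine ⟨Prod.snd ⁻¹' e.source ∩ Φ ⁻¹' 𝒰, hopen 𝒰 h𝒰, ⟨hxs, hx𝒰⟩,
    fun w => e.symm (T (Φ w)), ?_, fun w hw => ?_, fun p hp => ?_, fun w hw => ?_, fun w hw => ?_, ?_⟩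
  · exact (contMDiffOn_chartAt_symm_self x).comp
      (hT.contMDiffOn.comp (hΦs.mono Set.inter_subset_left) fun w hw => hw.2)
      fun w hw => (hVO (hTV _ hw.2).2).1
  · obtain ⟨γ, h0, h1, hγ⟩ := hcurve _ hw.2
    refine ⟨fun t => e.symm (γ t), ?_, ?_, fun t ht => ⟨(hVO (hγ t ht).1).2, ?_⟩⟩
    · change e.symm (γ 0) = _
      rw [h0, hΦ]
      exact e.left_inv hw.1
    · change e.symm (γ 1) = _
      rw [h1]
    · refine (hasMFDerivAt_chart_symm_comp x (hγ t ht).2 (hVO (hγ t ht).1).1).congr_mfderiv ?_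
      exact congrArg (fun v : E => (1 : ℝ →L[ℝ] ℝ).smulRight v) (hback _ (hγ t ht).1 w.1)
  · obtain ⟨h1, h2⟩ := hzero _ hp.2
    have hpV := (hTV _ hp.2).1
    refine ⟨?_, fun η ζ => ?_⟩
    · change e.symm (T (0, e p)) = p
      rw [h1, e.left_inv hp.1]
    · refine (modelDeriv_chart_flow (x := x) (T := T) (w := ((0 : EuclideanSpace ℝ ι), p)) hp.1
        (hTd _ hp.2) (hVO (hTV _ hp.2).2).1 η ζ).trans ?_
      have h3 : T (((0 : EuclideanSpace ℝ ι), p).1, e ((0 : EuclideanSpace ℝ ι), p).2) = e p := h1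
      rw [← he, h3, h2, map_add, hback _ hpV, e.left_inv hp.1]
      refine congrArg (· + _) ?_
      exact congrArg (fun L : E →L[ℝ] E => L ζ) ((chart_mdifferentiable x).symm_comp_deriv hp.1)
  · obtain ⟨u, hu⟩ := hw.2.2
    intro ζ ζ' h
    have h0 := modelDeriv_chart_flow (x := x) (T := T) hw.1 (hTd _ hw.2) (hVO (hTV _ hw.2).2).1 0
    have h1 := hsymm_inj _ (hVO (hTV _ hw.2).2).1 ((h0 ζ).symm.trans (h.trans (h0 ζ')))
    have h2 : ∀ ξ : E, fderiv ℝ T (Φ w) (0, ξ) = (u : E →L[ℝ] E) ξ := fun ξ => by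
      rw [hu]
      rfl
    have h3 : (u : E →L[ℝ] E) _ = (u : E →L[ℝ] E) _ := (h2 _).symm.trans (h1.trans (h2 _))
    have h4 := congrArg (fun ξ => ((u⁻¹ : (E →L[ℝ] E)ˣ) : E →L[ℝ] E) ξ) h3
    have h6 : ∀ ξ : E, ((u⁻¹ : (E →L[ℝ] E)ˣ) : E →L[ℝ] E) ((u : E →L[ℝ] E) ξ) = ξ := fun ξ => by
      rw [← mul_apply_eq_comp, Units.inv_mul]
      rfl
    simp only [h6] at h4
    exact he_inj _ hw.1 h4
  · obtain ⟨u, hu⟩ := hw.2.2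
    intro ζ
    refine ⟨(0, modelDeriv 𝓘(ℝ, E) 𝓘(ℝ, E) e.symm (e w.2) (((u⁻¹ : (E →L[ℝ] E)ˣ) : E →L[ℝ] E)
      (modelDeriv 𝓘(ℝ, E) 𝓘(ℝ, E) e (e.symm (T (Φ w))) ζ))), ?_⟩
    refine (modelDeriv_chart_flow (x := x) (T := T) hw.1 (hTd _ hw.2) (hVO (hTV _ hw.2).2).1
      _ _).trans ?_
    have h2 : ∀ ξ : E, fderiv ℝ T (Φ w) (0, ξ) = (u : E →L[ℝ] E) ξ := fun ξ => by
      rw [hu]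
      rfl
    have h4 : ∀ ξ : E, modelDeriv 𝓘(ℝ, E) 𝓘(ℝ, E) e w.2
        (modelDeriv 𝓘(ℝ, E) 𝓘(ℝ, E) e.symm (e w.2) ξ) = ξ := fun ξ => by
      have := mfderiv_chart_comp x (e.map_source hw.1) ξ
      rw [← he, e.left_inv hw.1] at this
      exact this
    rw [← he, h4]
    refine (congrArg _ (h2 _)).trans ?_
    have h6 : ∀ ξ : E, (u : E →L[ℝ] E) (((u⁻¹ : (E →L[ℝ] E)ˣ) : E →L[ℝ] E) ξ) = ξ := fun ξ => by
      rw [← mul_apply_eq_comp, Units.mul_inv]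
      rfl
    rw [h6]
    have h5 := (chart_mdifferentiable x).symm_comp_deriv (e.map_target (hVO (hTV _ hw.2).2).1)
    rw [← he, e.right_inv (hVO (hTV _ hw.2).2).1] at h5
    exact congrArg (fun L : E →L[ℝ] E => L ζ) h5
  · intro c hc hrel
    -- The structure functions are cut off with the same χ, and the bracket relation is needed only
    -- on V, where χ = 1.
    set d : ι → ι → ι → E → ℝ := fun l j k q => χ q • c l j k (e.symm q) with hd
    have hds : ∀ l j k, ContDiff ℝ ∞ (d l j k) := fun l j k =>
      (contMDiff_smul_of_tsupport hOe hχ ((hc l j k).comp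
        ((contMDiffOn_chartAt_symm_self x).mono Set.inter_subset_left) fun q hq => hq.2)).contDiff
    obtain ⟨𝒱₁, -, h𝒱₁, hx𝒱₁, R, hR₁, hR0, hRT⟩ := hbr d hds fun q hq l j => by
      rw [(hYV' q hq j).fderiv_eq, (hYV' q hq l).fderiv_eq, hYV q hq, hYV q hq,
        ← chartField_mlieBracket x (hX l) (hX j) (hVO hq).1]
      have h1 : ∑ k, d l j k q • Y k q = ∑ k, c l j k (e.symm q) • Y k q :=
        Finset.sum_congr rfl fun k _ => by simp only [hd, hχV q hq, one_smul]
      have hq' : e (e.symm q) = q := e.right_inv (hVO hq).1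
      have h2 := hforth (e.symm q) (e.map_target (hVO hq).1) (by rwa [hq']) fun k =>
        c l j k (e.symm q)
      rw [hq'] at h2
      rw [h1, ← h2]
      exact congrArg (modelDeriv 𝓘(ℝ, E) 𝓘(ℝ, E) e (e.symm q)) (hrel _ (hVO hq).2 l j)
    set 𝒱 := 𝒱₁ ∩ 𝒰
    have h𝒱 : IsOpen 𝒱 := h𝒱₁.inter h𝒰
    have hx𝒱 : ((0 : EuclideanSpace ℝ ι), e x) ∈ 𝒱 := ⟨hx𝒱₁, hx𝒰⟩
    have hR := hR₁.mono (Set.inter_subset_left : 𝒱 ⊆ 𝒱₁)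
    have h𝒱𝒰 : 𝒱 ⊆ 𝒰 := Set.inter_subset_right
    refine ⟨Prod.snd ⁻¹' e.source ∩ Φ ⁻¹' 𝒱, fun w hw => ⟨hw.1, h𝒱𝒰 hw.2⟩, hopen 𝒱 h𝒱,
      ⟨hxs, hx𝒱⟩, fun w => R (Φ w), ?_, fun p hp => hR0 _ hp.2.1, fun w hw b η => ?_⟩
    · exact hR.contMDiffOn.comp (hΦs.mono Set.inter_subset_left) fun w hw => hw.2
    · have hw𝒰 := h𝒱𝒰 hw.2
      refine (modelDeriv_chart_flow (x := x) (T := T) hw.1 (hTd _ hw𝒰) (hVO (hTV _ hw𝒰).2).1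
        η _).trans ?_
      have h2 := hRT _ hw.2.1 b η
      rw [← hback _ (hTV _ hw𝒰).2, ← h2, ← he, hforth _ hw.1 (hTV _ hw𝒰).1]

end Flow


/-! ### Completeness of compactly supported fields. -/

section Completeness

variable {E : Type*} [NormedAddCommGroup E] [NormedSpace ℝ E] [FiniteDimensional ℝ E]
  {M : Type*} [TopologicalSpace M] [ChartedSpace E M] [IsManifold 𝓘(ℝ, E) ∞ M] [T2Space M]

/-- For the single field X, the flow domain contains all (δ/2, p) with p near x, and the curve of
(δ/2) X lives on (-1, 1). Rescaling time turns it into a curve of X on (-δ/2, δ/2). -/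
theorem exists_uniform_local_curve {X : ∀ q : M, TangentSpace 𝓘(ℝ, E) q}
    (hX : IsSmoothSection 𝓘(ℝ, E) 𝓘(ℝ, E) (fun q : M => q) X) (x : M) :
    ∃ N ∈ 𝓝 x, ∃ ε > 0, ∀ p ∈ N, ∃ γ : ℝ → M, γ 0 = p ∧
      IsMIntegralCurveOn (I := 𝓘(ℝ, E)) γ X (Set.Ioo (-ε) ε) := by
  obtain ⟨𝒰, h𝒰, hx, τ, -, hτ, -⟩ := exists_local_flow_manifold (fun _ : Unit => X) (fun _ => hX) x
    isOpen_univ (Set.mem_univ x)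
  let j : ℝ → M → EuclideanSpace ℝ Unit × M := fun δ p => (δ • EuclideanSpace.single () 1, p)
  have hj : Continuous (Function.uncurry j) := by
    unfold j Function.uncurry
    fun_prop
  have h0 : Function.uncurry j (0, x) ∈ 𝒰 := by
    simpa [j] using hx
  have h1 := hj.continuousAt.preimage_mem_nhds (h𝒰.mem_nhds h0)
  rw [nhds_prod_eq, Filter.mem_prod_iff] at h1
  obtain ⟨D, hD, N, hN, hDN⟩ := h1
  obtain ⟨δ, hδ, hδD⟩ := Metric.mem_nhds_iff.1 hD
  have hδ2 : (δ / 2) ∈ D := hδD (by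
    rw [Metric.mem_ball, Real.dist_eq, sub_zero, abs_of_pos (by positivity)]
    linarith)
  refine ⟨N, hN, δ / 2, by positivity, fun p hp => ?_⟩
  obtain ⟨γ, hγ0, -, hγ⟩ := hτ (j (δ / 2) p) (hDN (Set.mk_mem_prod hδ2 hp))
  have h2 : IsMIntegralCurveOn (I := 𝓘(ℝ, E)) γ ((δ / 2) • X) (Set.Ioo (-1) 1) := fun t ht => by
    refine ((hγ t ⟨by linarith [ht.1], by linarith [ht.2]⟩).2.congr_mfderiv ?_).hasMFDerivWithinAt
    have : ∑ i, (j (δ / 2) p).1 i • X (γ t) = (δ / 2) • X (γ t) := by simp [j]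
    rw [this]
    rfl
  have h3 := h2.comp_mul (δ / 2)⁻¹
  rw [smul_smul, inv_mul_cancel₀ (by positivity), one_smul] at h3
  refine ⟨γ ∘ (· * (δ / 2)⁻¹), by simpa using hγ0, h3.mono fun t ht => ?_⟩
  constructor
  · rw [← div_eq_mul_inv, lt_div_iff₀ (by positivity)]
    linarith [ht.1]
  · rw [← div_eq_mul_inv, div_lt_iff₀ (by positivity)]
    linarith [ht.2]

/-- Compactly supported vector fields are complete. -/
theorem exists_integralCurve_of_compactSupport {X : ∀ q : M, TangentSpace 𝓘(ℝ, E) q}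
    (hX : IsCompactlySupportedField 𝓘(ℝ, E) X) (p : M) :
    ∃ γ : ℝ → M, γ 0 = p ∧ IsMIntegralCurve (I := 𝓘(ℝ, E)) γ X := by
  have hX1 : ContMDiff 𝓘(ℝ, E) 𝓘(ℝ, E).tangent 1
      (fun x => (⟨x, X x⟩ : TangentBundle 𝓘(ℝ, E) M)) := ContMDiff.of_le hX.1 (by norm_cast)
  obtain ⟨ε, hε, h⟩ : ∃ ε > 0, ∀ p ∈ closure {q | X q ≠ 0}, ∃ γ : ℝ → M, γ 0 = p ∧
      IsMIntegralCurveOn (I := 𝓘(ℝ, E)) γ X (Set.Ioo (-ε) ε) := by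
    refine hX.2.induction_on ⟨1, one_pos, by simp⟩ ?_ ?_ ?_
    · rintro s t hst ⟨ε, hε, h⟩
      exact ⟨ε, hε, fun p hp => h p (hst hp)⟩
    · rintro s t ⟨ε, hε, h⟩ ⟨ε', hε', h'⟩
      refine ⟨min ε ε', lt_min hε hε', fun p hp => ?_⟩
      rcases hp with hp | hp
      · obtain ⟨γ, h0, hγ⟩ := h p hp
        exact ⟨γ, h0, hγ.mono (Set.Ioo_subset_Ioo (neg_le_neg (min_le_left _ _)) (min_le_left _ _))⟩
      · obtain ⟨γ, h0, hγ⟩ := h' p hp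
        exact ⟨γ, h0, hγ.mono (Set.Ioo_subset_Ioo (neg_le_neg (min_le_right _ _))
          (min_le_right _ _))⟩
    · intro x _
      obtain ⟨N, hN, ε, hε, h⟩ := exists_uniform_local_curve hX.1 x
      exact ⟨N, mem_nhdsWithin_of_mem_nhds hN, ε, hε, h⟩
  -- A lifespan bounded below independently of the starting point suffices for global existence.
  -- Compactness gives such an ε on the support, and where X vanishes the curve is constant.
  refine exists_isMIntegralCurve_of_isMIntegralCurveOn hX1 hε (fun q => ?_) p
  by_cases hq : X q = 0
  · exact ⟨fun _ => q, rfl, (isMIntegralCurve_const hq).isMIntegralCurveOn _⟩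
  · exact h q (subset_closure hq)

/-- The time-one flow can be computed from any integral curve on a neighbourhood of `[0, 1]`. -/
theorem expField_eq_of_curve {X : ∀ q : M, TangentSpace 𝓘(ℝ, E) q}
    (hX : IsCompactlySupportedField 𝓘(ℝ, E) X) {γ : ℝ → M}
    (hγ : ∀ t ∈ Set.Icc (-2 : ℝ) 2, HasMFDerivAt 𝓘(ℝ, ℝ) 𝓘(ℝ, E) γ t
      ((1 : ℝ →L[ℝ] ℝ).smulRight (X (γ t)))) : expField 𝓘(ℝ, E) X (γ 0) = γ 1 := by
  have hX1 : ContMDiff 𝓘(ℝ, E) 𝓘(ℝ, E).tangent 1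
      (fun x => (⟨x, X x⟩ : TangentBundle 𝓘(ℝ, E) M)) := ContMDiff.of_le hX.1 (by norm_cast)
  obtain ⟨δ, hδ0, hδ⟩ := exists_integralCurve_of_compactSupport hX (γ 0)
  have h := isMIntegralCurveOn_Ioo_eqOn_of_contMDiff_boundaryless (t₀ := 0) (a := -2) (b := 2)
    (by norm_num) hX1 (hδ.isMIntegralCurveOn _) (fun t ht => (hγ t
      (Set.Ioo_subset_Icc_self ht)).hasMFDerivWithinAt) hδ0
  rw [← hδ0, expField_eq _ hX.1 hδ]
  exact h (by norm_num)

end Completeness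

/-! ### The exponential map near (0, x). -/

section ExponentialMap

variable {E : Type*} [NormedAddCommGroup E] [NormedSpace ℝ E] [FiniteDimensional ℝ E]
  {M : Type*} [TopologicalSpace M] [ChartedSpace E M] [IsManifold 𝓘(ℝ, E) ∞ M] [T2Space M]

theorem modelDeriv_congr {E H M E' H' N : Type*} [NormedAddCommGroup E] [NormedSpace ℝ E]
    [TopologicalSpace H] (I : ModelWithCorners ℝ E H) [TopologicalSpace M] [ChartedSpace H M]
    [NormedAddCommGroup E'] [NormedSpace ℝ E'] [TopologicalSpace H']
    (J : ModelWithCorners ℝ E' H') [TopologicalSpace N] [ChartedSpace H' N] {f g : M → N} {u : M}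
    (h : f =ᶠ[𝓝 u] g) : modelDeriv I J f u = modelDeriv I J g u := h.mfderiv_eq

/-- The vector fields of a family in a foliation. -/
abbrev fieldsOf (F : Foliation 𝓘(ℝ, E) M) {ι : Type*} (X : ι → F.toModule) (i : ι) :
    ∀ q : M, TangentSpace 𝓘(ℝ, E) q := X i

theorem expMap_eq_of_curve (F : Foliation 𝓘(ℝ, E) M) {n : ℕ} (X : Fin n → F.toModule)
    (y : EuclideanSpace ℝ (Fin n)) {γ : ℝ → M}
    (hγ : ∀ t ∈ Set.Icc (-2 : ℝ) 2, HasMFDerivAt 𝓘(ℝ, ℝ) 𝓘(ℝ, E) γ t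
      ((1 : ℝ →L[ℝ] ℝ).smulRight (∑ i, y i • fieldsOf F X i (γ t)))) :
    expMap 𝓘(ℝ, E) (fieldsOf F X) (y, γ 0) = γ 1 :=
  expField_eq_of_curve (F.compactlySupported _ (sum_smul_mem F X y)) hγ

/-- Units of the Banach algebra P →L[ℝ] P form an open set; this serves to shrink neighbourhoods to
where a square block of an operator is invertible. -/
theorem isUnit_comp_nhds {P Q : Type*} [NormedAddCommGroup P] [NormedSpace ℝ P] [CompleteSpace P]
    [NormedAddCommGroup Q] [NormedSpace ℝ Q] {N : Type*} [TopologicalSpace N]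
    {R : N → (Q →L[ℝ] P)} {O : Set N} (hO : IsOpen O) (hR : ContinuousOn R O) (L : P →L[ℝ] Q) :
    IsOpen (O ∩ {w | IsUnit ((R w).comp L)}) :=
  ContinuousOn.isOpen_inter_preimage (f := fun w => (R w).comp L) (t := {L | IsUnit L})
    ((ContinuousLinearMap.continuous ((ContinuousLinearMap.compL ℝ P Q P).flip L)).comp_continuousOn
      hR) hO Units.isOpen

/-- Description of `(y, p) ↦ exp (∑ y_i X_i) p` near `(0, x)`. -/
theorem exists_expMap_nhd (F : Foliation 𝓘(ℝ, E) M) (x : M) {n : ℕ} (X : Fin n → F.toModule)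
    (b : Module.Basis (Fin n) ℝ (F.Fiber x)) (hb : ∀ i, b i = F.toFiber x (X i)) :
    ∃ U : Set M, IsOpen U ∧ x ∈ U ∧ (∀ ζ ∈ F.toModule,
      ∃ c : Fin n → M → ℝ, (∀ j, ContMDiffOn 𝓘(ℝ, E) 𝓘(ℝ, ℝ) ∞ (c j) U) ∧
        ∀ p ∈ U, ζ p = ∑ j, c j p • (X j : ∀ q : M, TangentSpace 𝓘(ℝ, E) q) p) ∧
    ∃ 𝒱 : Set (EuclideanSpace ℝ (Fin n) × M), IsOpen 𝒱 ∧
      ((0 : EuclideanSpace ℝ (Fin n)), x) ∈ 𝒱 ∧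
      ContMDiffOn (𝓘(ℝ, EuclideanSpace ℝ (Fin n)).prod 𝓘(ℝ, E)) 𝓘(ℝ, E) ∞
        (expMap 𝓘(ℝ, E) (fieldsOf F X)) 𝒱 ∧
      (∀ w ∈ 𝒱, w.2 ∈ U ∧ expMap 𝓘(ℝ, E) (fieldsOf F X) w ∈ U) ∧
      expMap 𝓘(ℝ, E) (fieldsOf F X) (0, x) = x ∧
      (∀ w ∈ 𝒱, Function.Injective fun ζ : E =>
        modelDeriv (𝓘(ℝ, EuclideanSpace ℝ (Fin n)).prod 𝓘(ℝ, E)) 𝓘(ℝ, E)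
          (expMap 𝓘(ℝ, E) (fieldsOf F X)) w (0, ζ)) ∧
      (∀ w ∈ 𝒱, Function.Surjective
        (modelDeriv (𝓘(ℝ, EuclideanSpace ℝ (Fin n)).prod 𝓘(ℝ, E)) 𝓘(ℝ, E)
          (expMap 𝓘(ℝ, E) (fieldsOf F X)) w)) ∧
      ∃ R : EuclideanSpace ℝ (Fin n) × M → (EuclideanSpace ℝ (Fin n) × EuclideanSpace ℝ (Fin n) →L[ℝ]
          EuclideanSpace ℝ (Fin n)),
        ContMDiffOn (𝓘(ℝ, EuclideanSpace ℝ (Fin n)).prod 𝓘(ℝ, E)) 𝓘(ℝ, EuclideanSpace ℝ (Fin n) ×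
          EuclideanSpace ℝ (Fin n) →L[ℝ] EuclideanSpace ℝ (Fin n)) ∞ R 𝒱 ∧
        (∀ b η, R (0, x) (b, η) = b + η) ∧
        (∀ w ∈ 𝒱, ∀ b η, modelDeriv (𝓘(ℝ, EuclideanSpace ℝ (Fin n)).prod 𝓘(ℝ, E)) 𝓘(ℝ, E)
          (expMap 𝓘(ℝ, E) (fieldsOf F X)) w (η, ∑ j, b j • modelField (fieldsOf F X j) w.2) =
            ∑ j, R w (b, η) j •
              modelField (fieldsOf F X j) (expMap 𝓘(ℝ, E) (fieldsOf F X) w)) ∧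
        (∀ w ∈ 𝒱, IsUnit ((R w).comp (ContinuousLinearMap.inl ℝ _ _))) ∧
        ∀ w ∈ 𝒱, IsUnit ((R w).comp (ContinuousLinearMap.inr ℝ _ _)) := by
  obtain ⟨U, hU, hxU, hgen⟩ := exists_generating_nhd F x X b hb
  have hsm : ∀ i, IsSmoothSection 𝓘(ℝ, E) 𝓘(ℝ, E) (fun q : M => q) (fieldsOf F X i) := fun i =>
    (F.compactlySupported _ (X i).2).1
  obtain ⟨𝒰, h𝒰, hx𝒰, τ, hτ, hcurve, hzero, hinj, hsurj, hbr⟩ :=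
    exists_local_flow_manifold (fieldsOf F X) hsm x hU hxU
  -- Stability under brackets enters here: each [X_l, X_j] lies in F, so it has smooth coefficients
  -- in the generators over U.
  choose c hc hcrel using fun l j => hgen _ (F.lie_mem _ (X l).2 _ (X j).2)
  obtain ⟨𝒱, h𝒱𝒰, h𝒱, hx𝒱, R, hR, hR0, hRτ⟩ := hbr c hc fun q hq l j => hcrel l j q hq
  have hexp : ∀ w ∈ 𝒰, expMap 𝓘(ℝ, E) (fieldsOf F X) w = τ w := fun w hw => by
    obtain ⟨γ, h0, h1, hγ⟩ := hcurve w hw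
    have := expMap_eq_of_curve F X w.1 fun t ht => (hγ t ht).2
    rwa [h0, h1] at this
  have hexp' : ∀ w ∈ 𝒰, expMap 𝓘(ℝ, E) (fieldsOf F X) =ᶠ[𝓝 w] τ := fun w hw => by
    filter_upwards [h𝒰.mem_nhds hw] with z hz using hexp z hz
  have hDexp : ∀ w ∈ 𝒰, modelDeriv (𝓘(ℝ, EuclideanSpace ℝ (Fin n)).prod 𝓘(ℝ, E)) 𝓘(ℝ, E)
      (expMap 𝓘(ℝ, E) (fieldsOf F X)) w =
      modelDeriv (𝓘(ℝ, EuclideanSpace ℝ (Fin n)).prod 𝓘(ℝ, E)) 𝓘(ℝ, E) τ w := fun w hw =>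
    modelDeriv_congr _ _ (hexp' w hw)
  -- Both blocks of R are the identity at (0, x), because R(b, η) = b + η there.
  have ho1 := isUnit_comp_nhds h𝒱 hR.continuousOn (ContinuousLinearMap.inl ℝ _ _)
  have ho2 := isUnit_comp_nhds h𝒱 hR.continuousOn (ContinuousLinearMap.inr ℝ _ _)
  have hsub : (𝒱 ∩ {w | IsUnit ((R w).comp (ContinuousLinearMap.inl ℝ _ _))}) ∩
      (𝒱 ∩ {w | IsUnit ((R w).comp (ContinuousLinearMap.inr ℝ _ _))}) ⊆ 𝒱 := fun w hw => hw.1.1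
  refine ⟨U, hU, hxU, hgen, _, ho1.inter ho2, ⟨⟨hx𝒱, ?_⟩, ⟨hx𝒱, ?_⟩⟩, ?_, fun w hw => ?_, ?_,
    fun w hw => ?_, fun w hw => ?_, R, hR.mono hsub, hR0 x hx𝒱, fun w hw b η => ?_,
    fun w hw => hw.1.2, fun w hw => hw.2.2⟩
  · have : (R (0, x)).comp (ContinuousLinearMap.inl ℝ _ _) = 1 := by
      ext a : 1
      simp [hR0 x hx𝒱]
    simp only [Set.mem_ofPred_eq, this, isUnit_one]
  · have : (R (0, x)).comp (ContinuousLinearMap.inr ℝ _ _) = 1 := by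
      ext a : 1
      simp [hR0 x hx𝒱]
    simp only [Set.mem_ofPred_eq, this, isUnit_one]
  · exact (hτ.mono (hsub.trans h𝒱𝒰)).congr fun w hw => hexp w (h𝒱𝒰 (hsub hw))
  · obtain ⟨γ, h0, h1, hγ⟩ := hcurve w (h𝒱𝒰 (hsub hw))
    rw [hexp w (h𝒱𝒰 (hsub hw)), ← h0, ← h1]
    exact ⟨(hγ 0 (by norm_num)).1, (hγ 1 (by norm_num)).1⟩
  · rw [hexp _ hx𝒰, (hzero x hx𝒰).1]
  · rw [hDexp w (h𝒱𝒰 (hsub hw))]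
    exact hinj w (h𝒱𝒰 (hsub hw))
  · rw [hDexp w (h𝒱𝒰 (hsub hw))]
    exact hsurj w (h𝒱𝒰 (hsub hw))
  · rw [hDexp w (h𝒱𝒰 (hsub hw)), hexp w (h𝒱𝒰 (hsub hw))]
    exact hRτ w (hsub hw) b η

end ExponentialMap


/-! ### Smooth fields in coordinates and the pull-back of a foliation. -/

section SmoothFields

variable {E : Type*} [NormedAddCommGroup E] [NormedSpace ℝ E]
  {H : Type*} [TopologicalSpace H] {I : ModelWithCorners ℝ E H}
  {M : Type*} [TopologicalSpace M] [ChartedSpace H M] [IsManifold I ∞ M]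
  {E' : Type*} [NormedAddCommGroup E'] [NormedSpace ℝ E']
  {H' : Type*} [TopologicalSpace H'] {J : ModelWithCorners ℝ E' H'}
  {N : Type*} [TopologicalSpace N] [ChartedSpace H' N] [IsManifold J ∞ N]

/-- Smoothness of a vector field in terms of its coordinates. -/
theorem contMDiffAt_field_iff {X : ∀ u : M, TangentSpace I u} {x : M} :
    ContMDiffAt I I.tangent ∞ (fun u => (⟨u, X u⟩ : TangentBundle I M)) x ↔
      ContMDiffAt I 𝓘(ℝ, E) ∞
        (fun u => modelDeriv I 𝓘(ℝ, E) (extChartAt I x) u (modelField X u)) x := by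
  have h := Bundle.contMDiffAt_section (IB := I) (F := E) (n := ∞)
    (E := (TangentSpace I : M → Type _)) (s := X) x
  refine h.trans (Filter.EventuallyEq.contMDiffAt_iff ?_)
  filter_upwards [(chartAt H x).open_source.mem_nhds (mem_chart_source H x)] with u hu
  have h2 := TangentBundle.continuousLinearMapAt_trivializationAt (I := I) hu
  have h3 : (trivializationAt E (TangentSpace I) x).continuousLinearMapAt ℝ u (X u) =
      mfderiv I 𝓘(ℝ, E) (extChartAt I x) u (X u) := congrArg (fun L => L (X u)) h2
  refine Eq.trans ?_ h3
  rw [Bundle.Trivialization.continuousLinearMapAt_apply,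
    Bundle.Trivialization.linearMapAt_apply, if_pos]
  exact hu

theorem isSmoothSection_id_iff {X : ∀ u : M, TangentSpace I u} :
    IsSmoothSection I I (fun u : M => u) X ↔ ∀ x, ContMDiffAt I 𝓘(ℝ, E) ∞
      (fun u => modelDeriv I 𝓘(ℝ, E) (extChartAt I x) u (modelField X u)) x :=
  forall_congr' fun _ => contMDiffAt_field_iff

theorem IsCompactlySupportedField.add {X Y : ∀ u : M, TangentSpace I u}
    (hX : IsCompactlySupportedField I X) (hY : IsCompactlySupportedField I Y) :
    IsCompactlySupportedField I (X + Y) := by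
  refine ⟨ContMDiff.add_section hX.1 hY.1, (hX.2.union hY.2).of_isClosed_subset isClosed_closure ?_⟩
  rw [← closure_union]
  refine closure_mono fun u hu => ?_
  by_contra h
  simp only [Set.mem_union, Set.mem_ofPred_eq, not_or, not_not] at h
  exact hu (by rw [Pi.add_apply, h.1, h.2, add_zero])

theorem IsCompactlySupportedField.neg {X : ∀ u : M, TangentSpace I u}
    (hX : IsCompactlySupportedField I X) : IsCompactlySupportedField I (-X) := by
  refine ⟨ContMDiff.neg_section hX.1, hX.2.of_isClosed_subset isClosed_closure ?_⟩
  exact closure_mono fun u hu h => hu (by rw [Pi.neg_apply, h, neg_zero])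

theorem isCompactlySupportedField_of_support {X : ∀ u : M, TangentSpace I u}
    (hX : IsSmoothSection I I (fun u : M => u) X) {K : Set M} (hK : IsCompact K) (hKc : IsClosed K)
    (h : ∀ u ∉ K, X u = 0) : IsCompactlySupportedField I X :=
  ⟨hX, hK.of_isClosed_subset isClosed_closure (closure_minimal (fun u hu => by
    by_contra hn
    exact hu (h u hn)) hKc)⟩

/-- Elements of the preimage of a foliation under a map into a set where the foliation is generated
by given fields. -/
theorem mem_preimage_iff [T2Space N] [FiniteDimensional ℝ E'] (F : Foliation I M) {n : ℕ} {X : Fin n → F.toModule}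
    {U : Set M} (hU : ∀ ζ ∈ F.toModule,
      ∃ c : Fin n → M → ℝ, (∀ j, ContMDiffOn I 𝓘(ℝ, ℝ) ∞ (c j) U) ∧
        ∀ p ∈ U, ζ p = ∑ j, c j p • (X j : ∀ x : M, TangentSpace I x) p)
    {φ : N → M} (hφ : ContMDiff J I ∞ φ) (hφU : ∀ u, φ u ∈ U) {Z : ∀ u : N, TangentSpace J u} :
    Z ∈ F.preimage J φ ↔ IsCompactlySupportedField J Z ∧
      ∃ g : N → EuclideanSpace ℝ (Fin n), ContMDiff J 𝓘(ℝ, EuclideanSpace ℝ (Fin n)) ∞ g ∧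
        HasCompactSupport g ∧ ∀ u, modelDeriv J I φ u (modelField Z u) =
          ∑ j, g u j • modelField (X j : ∀ x : M, TangentSpace I x) (φ u) := by
  constructor
  · rintro ⟨hZ, hmem⟩
    obtain ⟨g, hg, hgc, hgZ⟩ := exists_coeff_of_mem_pullback F hU (O := Set.univ) hφ.contMDiffOn
      (fun u _ => hφU u) hmem
    refine ⟨hZ, fun u => WithLp.toLp 2 fun j => g j u, contMDiffOn_univ.1 (contMDiffOn_toLp hg), ?_,
      fun u => hgZ u trivial⟩
    have hK : IsCompact (⋃ j, tsupport (g j)) := isCompact_iUnion fun j => hgc j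
    refine HasCompactSupport.of_support_subset_isCompact hK fun u hu => ?_
    by_contra h
    refine hu ?_
    simp only [Set.mem_iUnion, not_exists] at h
    ext j
    exact image_eq_zero_of_notMem_tsupport (f := g j) (h j)
  · rintro ⟨hZ, g, hg, hgc, hgZ⟩
    refine ⟨hZ, mem_pullback_of_coeff F X (g := fun j u => g u j)
      (fun j => contMDiffOn_univ.1 (contMDiffOn_coord hg.contMDiffOn j)) (fun j => ?_) hgZ⟩
    exact hgc.comp_left (g := fun v : EuclideanSpace ℝ (Fin n) => v j) rfl

theorem modelDeriv_comp_val {W : Opens N} {f : N → M} (u : W) (hf : MDifferentiableAt J I f u) :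
    modelDeriv J I (fun u : W => f u) u = modelDeriv J I f u := by
  have h : HasMFDerivAt J I (fun u : W => f u) u
      ((modelDeriv J I f u).comp (ContinuousLinearMap.id ℝ E')) :=
    hf.hasMFDerivAt_modelDeriv.comp u (hasMFDerivAt_subtype_val W u)
  exact h.mfderiv

end SmoothFields

/-! ### Vertical fields on open subsets of a product with a vector space. -/

section Products

variable {P : Type*} [NormedAddCommGroup P] [NormedSpace ℝ P]
  {E : Type*} [NormedAddCommGroup E] [NormedSpace ℝ E]
  {M : Type*} [TopologicalSpace M] [ChartedSpace E M] [IsManifold 𝓘(ℝ, E) ∞ M]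

theorem modelDeriv_fst (w : P × M) :
    modelDeriv (𝓘(ℝ, P).prod 𝓘(ℝ, E)) 𝓘(ℝ, P) (Prod.fst : P × M → P) w =
      ContinuousLinearMap.fst ℝ P E := (hasMFDerivAt_fst w).mfderiv

theorem modelDeriv_snd (w : P × M) :
    modelDeriv (𝓘(ℝ, P).prod 𝓘(ℝ, E)) 𝓘(ℝ, E) (Prod.snd : P × M → M) w =
      ContinuousLinearMap.snd ℝ P E := (hasMFDerivAt_snd w).mfderiv

/-- The vector field on an open subset of a product with a vector space given by a vector valued
function. -/
def verticalField (W : Opens (P × M)) (θ : W → P) :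
    ∀ u : W, TangentSpace (𝓘(ℝ, P).prod 𝓘(ℝ, E)) u := fun u => ((θ u, (0 : E)) : P × E)

/-- In the product chart the components of the field are (θ, 0), since the first factor carries the
identity chart. -/
theorem isSmoothSection_verticalField {W : Opens (P × M)} {θ : W → P}
    (hθ : ContMDiff (𝓘(ℝ, P).prod 𝓘(ℝ, E)) 𝓘(ℝ, P) ∞ θ) :
    IsSmoothSection (𝓘(ℝ, P).prod 𝓘(ℝ, E)) (𝓘(ℝ, P).prod 𝓘(ℝ, E)) (fun u : W => u)
      (verticalField (E := E) W θ) := by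
  refine isSmoothSection_id_iff.2 fun w => ?_
  have hsm : ContMDiffAt (𝓘(ℝ, P).prod 𝓘(ℝ, E)) 𝓘(ℝ, P × E) ∞ (fun u => (θ u, (0 : E))) w :=
    hθ.contMDiffAt.prodMk_space contMDiffAt_const
  refine hsm.congr_of_eventuallyEq ?_
  have hopen : IsOpen {u : W | (u : P × M).2 ∈ (chartAt E (w : P × M).2).source} :=
    (chartAt E (w : P × M).2).open_source.preimage (continuous_snd.comp continuous_subtype_val)
  filter_upwards [hopen.mem_nhds (mem_chart_source E (w : P × M).2)] with u hu
  have h1 : HasMFDerivAt (𝓘(ℝ, P).prod 𝓘(ℝ, E)) 𝓘(ℝ, P) (fun u : W => (u : P × M).1) u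
      (ContinuousLinearMap.fst ℝ P E) :=
    (hasMFDerivAt_fst (u : P × M)).comp u (hasMFDerivAt_subtype_val W u)
  have h2 : HasMFDerivAt (𝓘(ℝ, P).prod 𝓘(ℝ, E)) 𝓘(ℝ, E) (fun u : W => (u : P × M).2) u
      (ContinuousLinearMap.snd ℝ P E) :=
    (hasMFDerivAt_snd (u : P × M)).comp u (hasMFDerivAt_subtype_val W u)
  have h3 := ((chart_mdifferentiable (w : P × M).2).mdifferentiableAt hu).hasMFDerivAt_modelDeriv
  have h4 : HasMFDerivAt (𝓘(ℝ, P).prod 𝓘(ℝ, E)) 𝓘(ℝ, E)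
      (fun u : W => chartAt E (w : P × M).2 (u : P × M).2) u
      ((modelDeriv (E := E) (E' := E) 𝓘(ℝ, E) 𝓘(ℝ, E) (chartAt E (w : P × M).2)
        (u : P × M).2).comp (ContinuousLinearMap.snd ℝ P E)) := h3.comp u h2
  have h5 := (h1.prodMk_model h4).mfderiv
  refine (congrArg (fun L : P × E →L[ℝ] P × E => L (θ u, 0)) h5).trans ?_
  exact Prod.ext rfl (map_zero (modelDeriv (E := E) (E' := E) 𝓘(ℝ, E) 𝓘(ℝ, E)
    (chartAt E (w : P × M).2) (u : P × M).2))

end Products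


/-! ### The exponential family is a bi-submersion. -/

section PathHolonomy

variable {E : Type*} [NormedAddCommGroup E] [NormedSpace ℝ E] [FiniteDimensional ℝ E]
  {M : Type*} [TopologicalSpace M] [ChartedSpace E M] [IsManifold 𝓘(ℝ, E) ∞ M] [T2Space M]

/-- Applied to coefficient functions built pointwise from g and from a field with support K. -/
theorem hasCompactSupport_of_zero {A B : Type*} {N : Type*} [TopologicalSpace N] [T2Space N]
    [Zero A] [Zero B] {K : Set N} (hK : IsCompact K) {g : N → A} (hg : HasCompactSupport g)
    {f : N → B} (h : ∀ u ∉ K, g u = 0 → f u = 0) : HasCompactSupport f := by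
  refine HasCompactSupport.of_support_subset_isCompact (hK.union hg) fun u hu => ?_
  by_contra hn
  rw [Set.mem_union, not_or] at hn
  exact hu (h u hn.1 (image_eq_zero_of_notMem_tsupport hn.2))

/-- A neighbourhood of `(0, x)` on which `(y, p) ↦ exp (∑ y_i X_i) p` and the projection form a
bi-submersion. -/
theorem exists_pathHolonomy_bisubmersion (F : Foliation 𝓘(ℝ, E) M) (x : M) {n : ℕ}
    (X : Fin n → F.toModule)
    (b : Module.Basis (Fin n) ℝ (F.Fiber x)) (hb : ∀ i, b i = F.toFiber x (X i)) :
    ∃ W : Opens (EuclideanSpace ℝ (Fin n) × M), ((0 : EuclideanSpace ℝ (Fin n)), x) ∈ W ∧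
      IsBisubmersion (𝓘(ℝ, EuclideanSpace ℝ (Fin n)).prod 𝓘(ℝ, E)) F
        (fun w : W => expMap 𝓘(ℝ, E) (fieldsOf F X) (w : EuclideanSpace ℝ (Fin n) × M))
        (fun w : W => (w : EuclideanSpace ℝ (Fin n) × M).2) := by
  obtain ⟨U, hU, hxU, hgen, 𝒱, h𝒱, hx𝒱, ht, hWU, -, hinj, hsurj, R, hR, -, hRt, hA, hα⟩ :=
    exists_expMap_nhd F x X b hb
  set J := 𝓘(ℝ, EuclideanSpace ℝ (Fin n)).prod 𝓘(ℝ, E) with hJ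
  let W : Opens (EuclideanSpace ℝ (Fin n) × M) := ⟨𝒱, h𝒱⟩
  set t := expMap 𝓘(ℝ, E) (fieldsOf F X) with htdef
  have hval : ContMDiff J J ∞ (Subtype.val : W → EuclideanSpace ℝ (Fin n) × M) :=
    contMDiff_subtype_val
  have htW : ContMDiff J 𝓘(ℝ, E) ∞ (fun w : W => t w) := contMDiffOn_univ.1
    (ht.comp hval.contMDiffOn fun w _ => w.2)
  have hsW : ContMDiff J 𝓘(ℝ, E) ∞ (fun w : W => (w : EuclideanSpace ℝ (Fin n) × M).2) :=
    contMDiff_snd.comp hval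
  have hyW : ContMDiff J 𝓘(ℝ, EuclideanSpace ℝ (Fin n)) ∞
      (fun w : W => (w : EuclideanSpace ℝ (Fin n) × M).1) := contMDiff_fst.comp hval
  have hRW : ContMDiff J 𝓘(ℝ, EuclideanSpace ℝ (Fin n) × EuclideanSpace ℝ (Fin n) →L[ℝ]
      EuclideanSpace ℝ (Fin n)) ∞ (fun w : W => R w) := contMDiffOn_univ.1
    (hR.comp hval.contMDiffOn fun w _ => w.2)
  have hDt : ∀ w : W, modelDeriv J 𝓘(ℝ, E) (fun w : W => t w) w = modelDeriv J 𝓘(ℝ, E) t w :=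
    fun w => modelDeriv_comp_val w ((ht.contMDiffAt (h𝒱.mem_nhds w.2)).mdifferentiableAt (by simp))
  have hDs : ∀ w : W, modelDeriv J 𝓘(ℝ, E)
      (fun w : W => (w : EuclideanSpace ℝ (Fin n) × M).2) w =
      ContinuousLinearMap.snd ℝ (EuclideanSpace ℝ (Fin n)) E := fun w => by
    have h1 := modelDeriv_comp_val (J := J) (I := 𝓘(ℝ, E)) (W := W)
      (f := (Prod.snd : EuclideanSpace ℝ (Fin n) × M → M)) w
      (contMDiff_snd.mdifferentiableAt (n := ∞) (by simp))
    exact h1.trans (modelDeriv_snd _)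
  have hDy : ∀ w : W, modelDeriv J 𝓘(ℝ, EuclideanSpace ℝ (Fin n))
      (fun w : W => (w : EuclideanSpace ℝ (Fin n) × M).1) w =
      ContinuousLinearMap.fst ℝ (EuclideanSpace ℝ (Fin n)) E := fun w => by
    have h1 := modelDeriv_comp_val (J := J) (I := 𝓘(ℝ, EuclideanSpace ℝ (Fin n))) (W := W)
      (f := (Prod.fst : EuclideanSpace ℝ (Fin n) × M → EuclideanSpace ℝ (Fin n))) w
      (contMDiff_fst.mdifferentiableAt (n := ∞) (by simp))
    exact h1.trans (modelDeriv_fst _)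
  let η : (∀ u : W, TangentSpace J u) → W → EuclideanSpace ℝ (Fin n) := fun Z u =>
    (modelField Z u).1
  have hη : ∀ Z, IsCompactlySupportedField J Z →
      ContMDiff J 𝓘(ℝ, EuclideanSpace ℝ (Fin n)) ∞ (η Z) := fun Z hZ => by
    have h1 := contMDiffOn_univ.1 (contMDiffOn_mfderiv_section hZ.1 isOpen_univ hyW.contMDiffOn)
    refine h1.congr fun u => ?_
    exact (congrArg (fun L : EuclideanSpace ℝ (Fin n) × E →L[ℝ] EuclideanSpace ℝ (Fin n) =>
      L (modelField Z u)) (hDy u)).symm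
  have hzero : ∀ Z : ∀ u : W, TangentSpace J u, ∀ u ∉ closure {u | Z u ≠ 0},
      modelField Z u = 0 := fun Z u hu => by
    by_contra h
    exact hu (subset_closure h)
  have hs_iff := fun Z => mem_preimage_iff F hgen hsW (fun w => (hWU w w.2).1) (Z := Z)
  have ht_iff := fun Z => mem_preimage_iff F hgen htW (fun w => (hWU w w.2).2) (Z := Z)
  have hpair : ∀ (w : W) (c η : EuclideanSpace ℝ (Fin n)), R w (c, η) =
      (R w).comp (ContinuousLinearMap.inl ℝ _ _) c + (R w).comp (ContinuousLinearMap.inr ℝ _ _) η :=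
    fun w c η => by
      change R w (c, η) = R w (c, 0) + R w (0, η)
      rw [← map_add]
      simp
  have hR00 : ∀ w : EuclideanSpace ℝ (Fin n) × M, R w (0, 0) = 0 := fun w => map_zero (R w)
  have hcomp : ∀ L : EuclideanSpace ℝ (Fin n) →L[ℝ] EuclideanSpace ℝ (Fin n) ×
      EuclideanSpace ℝ (Fin n), ContMDiff J 𝓘(ℝ, EuclideanSpace ℝ (Fin n) →L[ℝ]
        EuclideanSpace ℝ (Fin n)) ∞ (fun w : W => (R w).comp L) := fun L =>
    hRW.clm_comp contMDiff_const
  have hAinv := contMDiffOn_univ.1 (contMDiffOn_ringInverse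
    (hcomp (ContinuousLinearMap.inl ℝ _ _)).contMDiffOn fun w _ => hA w w.2)
  have hαinv := contMDiffOn_univ.1 (contMDiffOn_ringInverse
    (hcomp (ContinuousLinearMap.inr ℝ _ _)).contMDiffOn fun w _ => hα w w.2)
  -- For Z with parameter component η, coefficients g along s become R(g, η) along t. Conversely,
  -- coefficients along t determine c with R(c, η) = g by inverting R in its first argument; then
  -- (0, ds(Z) - ∑ c_j X_j) is killed by dt, and dt is injective on the M-directions.
  have hst : F.preimage J (fun w : W => (w : EuclideanSpace ℝ (Fin n) × M).2) =
      F.preimage J (fun w : W => t w) := by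
    ext Z
    rw [hs_iff, ht_iff]
    refine and_congr_right fun hZ => ⟨?_, ?_⟩
    · rintro ⟨g, hg, hgc, hgZ⟩
      refine ⟨fun u => R u (g u, η Z u), hRW.clm_apply (hg.prodMk_space (hη Z hZ)),
        hasCompactSupport_of_zero hZ.2 hgc fun u hu h0 => ?_, fun u => ?_⟩
      · simp [h0, η, hzero Z u hu, hR00]
      · rw [hDt]
        refine Eq.trans ?_ (hRt u u.2 (g u) (η Z u))
        have h1 := hgZ u
        rw [hDs] at h1
        exact congrArg _ (Prod.ext rfl h1)
    · rintro ⟨g, hg, hgc, hgZ⟩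
      refine ⟨fun u => Ring.inverse ((R u).comp (ContinuousLinearMap.inl ℝ _ _))
        (g u - (R u).comp (ContinuousLinearMap.inr ℝ _ _) (η Z u)),
        hAinv.clm_apply (hg.sub ((hcomp _).clm_apply (hη Z hZ))),
        hasCompactSupport_of_zero hZ.2 hgc fun u hu h0 => ?_, fun u => ?_⟩
      · simp [h0, η, hzero Z u hu, hR00]
      · rw [hDs]
        set c := Ring.inverse ((R u).comp (ContinuousLinearMap.inl ℝ _ _))
          (g u - (R u).comp (ContinuousLinearMap.inr ℝ _ _) (η Z u)) with hc
        have h1 : R u (c, η Z u) = g u := by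
          rw [hpair, hc, ← mul_apply_eq_comp, Ring.mul_inverse_cancel _ (hA u u.2)]
          simp
        have h2 := hRt u u.2 c (η Z u)
        rw [h1] at h2
        have h3 := hgZ u
        rw [hDt] at h3
        have h4 : modelDeriv J 𝓘(ℝ, E) t u (0, (modelField Z u).2 -
            ∑ j, c j • modelField (fieldsOf F X j) (u : EuclideanSpace ℝ (Fin n) × M).2) =
            modelDeriv J 𝓘(ℝ, E) t u (0, 0) := by
          have : ((0 : EuclideanSpace ℝ (Fin n)), (modelField Z u).2 -
            ∑ j, c j • modelField (fieldsOf F X j) (u : EuclideanSpace ℝ (Fin n) × M).2) =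
            modelField Z u - (η Z u,
              ∑ j, c j • modelField (fieldsOf F X j) (u : EuclideanSpace ℝ (Fin n) × M).2) :=
            Prod.ext (sub_self _).symm rfl
          rw [this, map_sub, h2, h3, sub_self]
          exact (map_zero _).symm
        exact sub_eq_zero.1 (hinj u u.2 h4)
  refine ⟨W, hx𝒱, ⟨hsW, fun w => ?_⟩, ⟨htW, fun w => ?_⟩, hst, ?_⟩
  · have h1 : Function.Surjective (modelDeriv J 𝓘(ℝ, E)
      (fun w : W => (w : EuclideanSpace ℝ (Fin n) × M).2) w) := by
      rw [hDs]
      exact fun v => ⟨(0, v), rfl⟩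
    exact h1
  · have h1 : Function.Surjective (modelDeriv J 𝓘(ℝ, E) (fun w : W => t w) w) := by
      rw [hDt]
      exact hsurj w w.2
    exact h1
  · ext Z
    constructor
    · intro hmem
      obtain ⟨hZ, g, hg, hgc, hgZ⟩ := (hs_iff Z).1 hmem
      -- θ is the solution of R(g, η - θ) = 0, so that Z - (θ, 0) is killed by dt, while (θ, 0) is
      -- killed by ds.
      let θ : W → EuclideanSpace ℝ (Fin n) := fun u => η Z u +
        Ring.inverse ((R u).comp (ContinuousLinearMap.inr ℝ _ _))
          ((R u).comp (ContinuousLinearMap.inl ℝ _ _) (g u))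
      have hθ : ContMDiff J 𝓘(ℝ, EuclideanSpace ℝ (Fin n)) ∞ θ :=
        (hη Z hZ).add (hαinv.clm_apply ((hcomp _).clm_apply hg))
      have hθc : HasCompactSupport θ := hasCompactSupport_of_zero hZ.2 hgc fun u hu h0 => by
        simp [θ, h0, η, hzero Z u hu, hR00]
      have hY : IsCompactlySupportedField J (verticalField (E := E) W θ) :=
        isCompactlySupportedField_of_support (isSmoothSection_verticalField hθ) hθc
          (isClosed_tsupport _) fun u hu =>
            Prod.ext (image_eq_zero_of_notMem_tsupport (f := θ) hu) rfl
      refine ⟨verticalField (E := E) W θ, ⟨hY, fun u => ?_⟩, Z + -verticalField (E := E) W θ,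
        ⟨hZ.add hY.neg, fun u => ?_⟩, by abel⟩
      · exact congrArg (fun L : EuclideanSpace ℝ (Fin n) × E →L[ℝ] E => L (θ u, 0)) (hDs u)
      · have h1 : modelDeriv J 𝓘(ℝ, E) t u (modelField Z u - (θ u, 0)) = 0 := by
          have h2 := hgZ u
          rw [hDs] at h2
          have h3 : modelField Z u - (θ u, 0) = (η Z u - θ u,
              ∑ j, g u j • modelField (fieldsOf F X j) (u : EuclideanSpace ℝ (Fin n) × M).2) :=
            Prod.ext rfl ((sub_zero _).trans h2)
          rw [h3, hRt u u.2]
          have h4 : R u (g u, η Z u - θ u) = 0 := by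
            rw [hpair]
            simp only [θ, sub_add_cancel_left, map_neg]
            rw [← mul_apply_eq_comp ((R u).comp (ContinuousLinearMap.inr ℝ _ _)),
              Ring.mul_inverse_cancel _ (hα u u.2)]
            exact add_neg_cancel _
          simp [h4]
        rw [← hDt] at h1
        refine Eq.trans ?_ h1
        exact congrArg (modelDeriv J 𝓘(ℝ, E) (fun w : W => t w) u) (sub_eq_add_neg _ _).symm
    · rintro ⟨Y, ⟨hY, hYs⟩, Y', ⟨hY', hYt⟩, rfl⟩
      have hmem : ∀ Z, Z ∈ F.preimage J (fun w : W => (w : EuclideanSpace ℝ (Fin n) × M).2) → _ :=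
        fun Z => (hs_iff Z).1
      -- A field in ker dt has zero coefficients along t, so it lies in the pull-back along t, which
      -- equals the one along s. Adding Y in ker ds does not change ds.
      have h1 : Y' ∈ F.preimage J (fun w : W => (w : EuclideanSpace ℝ (Fin n) × M).2) := by
        rw [hst]
        exact (ht_iff Y').2 ⟨hY', 0, contMDiff_const, HasCompactSupport.zero, fun u => by
          exact Eq.trans (hYt u) (Finset.sum_eq_zero fun j _ => zero_smul ℝ _).symm⟩
      obtain ⟨-, g, hg, hgc, hgZ⟩ := (hs_iff Y').1 h1
      refine (hs_iff _).2 ⟨hY.add hY', g, hg, hgc, fun u => ?_⟩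
      rw [← hgZ u]
      have h2 : modelField (Y + Y') u = modelField Y u + modelField Y' u := rfl
      rw [h2, map_add]
      refine (congrArg (· + _) ?_).trans (zero_add _)
      exact hYs u

end PathHolonomy


/-! ### Vector fields prescribed by their components in a chart. -/

section ChartLift

variable {G : Type*} [NormedAddCommGroup G] [NormedSpace ℝ G]
  {V : Type*} [TopologicalSpace V] [ChartedSpace G V] [IsManifold 𝓘(ℝ, G) ∞ V]

/-- The vector field with given components in the chart at `v`. -/
noncomputable def chartLift (v : V) (ζ : V → G) : ∀ u : V, TangentSpace 𝓘(ℝ, G) u := fun u =>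
  modelDeriv 𝓘(ℝ, G) 𝓘(ℝ, G) (chartAt G v).symm (chartAt G v u) (ζ u)

theorem chartLift_eq_zero {v u : V} {ζ : V → G} (h : ζ u = 0) : chartLift v ζ u = 0 :=
  (congrArg (modelDeriv (E := G) (E' := G) 𝓘(ℝ, G) 𝓘(ℝ, G) (chartAt G v).symm (chartAt G v u))
    h).trans (map_zero _)

theorem modelDeriv_chart_symm {v u : V} (hu : u ∈ (chartAt G v).source) (a : G) :
    modelDeriv 𝓘(ℝ, G) 𝓘(ℝ, G) (chartAt G v) u
      (modelDeriv 𝓘(ℝ, G) 𝓘(ℝ, G) (chartAt G v).symm (chartAt G v u) a) = a := by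
  have := mfderiv_chart_comp v ((chartAt G v).map_source hu) a
  rw [(chartAt G v).left_inv hu] at this
  exact this

theorem modelDeriv_symm_chart {v u : V} (hu : u ∈ (chartAt G v).source) (a : G) :
    modelDeriv 𝓘(ℝ, G) 𝓘(ℝ, G) (chartAt G v).symm (chartAt G v u)
      (modelDeriv 𝓘(ℝ, G) 𝓘(ℝ, G) (chartAt G v) u a) = a :=
  congrArg (fun L : G →L[ℝ] G => L a) ((chart_mdifferentiable v).symm_comp_deriv hu)

variable {E : Type*} [NormedAddCommGroup E] [NormedSpace ℝ E]

/-- The coordinate expression of the differential of a map to a vector space. -/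
theorem fderiv_comp_chart_symm {v u : V} (hu : u ∈ (chartAt G v).source) {f : V → E}
    (hf : MDifferentiableAt 𝓘(ℝ, G) 𝓘(ℝ, E) f u) (a : G) :
    fderiv ℝ (fun z => f ((chartAt G v).symm z)) (chartAt G v u) a =
      modelDeriv 𝓘(ℝ, G) 𝓘(ℝ, E) f u
        (modelDeriv 𝓘(ℝ, G) 𝓘(ℝ, G) (chartAt G v).symm (chartAt G v u) a) := by
  have h1 : HasMFDerivAt 𝓘(ℝ, G) 𝓘(ℝ, G) (chartAt G v).symm (chartAt G v u)
      (modelDeriv (E := G) (E' := G) 𝓘(ℝ, G) 𝓘(ℝ, G) (chartAt G v).symm (chartAt G v u)) :=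
    ((chart_mdifferentiable v).mdifferentiableAt_symm
      ((chartAt G v).map_source hu)).hasMFDerivAt_modelDeriv
  have h2 : HasMFDerivAt 𝓘(ℝ, G) 𝓘(ℝ, E) f ((chartAt G v).symm (chartAt G v u))
      (modelDeriv (E := G) (E' := E) 𝓘(ℝ, G) 𝓘(ℝ, E) f u) := by
    rw [(chartAt G v).left_inv hu]
    exact hf.hasMFDerivAt_modelDeriv
  have h3 := h2.comp (chartAt G v u) h1
  exact congrArg (fun L : G →L[ℝ] E => L a) (mfderiv_eq_fderiv.symm.trans h3.mfderiv)

theorem contMDiffOn_fderiv_comp_chart_symm (v : V) {f : V → E} {O : Set V} (hO : IsOpen O)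
    (hOv : O ⊆ (chartAt G v).source) (hf : ContMDiffOn 𝓘(ℝ, G) 𝓘(ℝ, E) ∞ f O) :
    ContMDiffOn 𝓘(ℝ, G) 𝓘(ℝ, G →L[ℝ] E) ∞
      (fun u => fderiv ℝ (fun z => f ((chartAt G v).symm z)) (chartAt G v u)) O := by
  have hO' : IsOpen ((chartAt G v).target ∩ (chartAt G v).symm ⁻¹' O) :=
    (chartAt G v).isOpen_inter_preimage_symm hO
  have h1 : ContDiffOn ℝ ∞ (fun z => f ((chartAt G v).symm z))
      ((chartAt G v).target ∩ (chartAt G v).symm ⁻¹' O) :=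
    (hf.comp ((contMDiffOn_chartAt_symm_self v).mono Set.inter_subset_left)
      fun z hz => hz.2).contDiffOn
  have h2 := (h1.fderiv_of_isOpen (m := ∞) hO' (by simp)).contMDiffOn
  refine h2.comp ((contMDiffOn_chartAt_self v).mono hOv) fun u hu => ⟨(chartAt G v).map_source
    (hOv hu), ?_⟩
  rw [Set.mem_preimage, (chartAt G v).left_inv (hOv hu)]
  exact hu

/-- In the chart at another point w the components are the derivative of the transition map applied
to ζ, and this is smooth. -/
theorem contMDiffAt_chartLift {v : V} {ζ : V → G} {O : Set V} (hO : IsOpen O)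
    (hOv : O ⊆ (chartAt G v).source) (hζ : ContMDiffOn 𝓘(ℝ, G) 𝓘(ℝ, G) ∞ ζ O) {w : V}
    (hw : w ∈ O) : ContMDiffAt 𝓘(ℝ, G) 𝓘(ℝ, G).tangent ∞
      (fun u => (⟨u, chartLift v ζ u⟩ : TangentBundle 𝓘(ℝ, G) V)) w := by
  refine contMDiffAt_field_iff.2 ?_
  have hO' : IsOpen (O ∩ (chartAt G w).source) := hO.inter (chartAt G w).open_source
  have hw' : w ∈ O ∩ (chartAt G w).source := ⟨hw, mem_chart_source G w⟩
  have h1 := contMDiffOn_fderiv_comp_chart_symm v hO' (fun u hu => hOv hu.1)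
    ((contMDiffOn_chartAt_self w).mono Set.inter_subset_right)
  have h2 := ((h1.clm_apply (hζ.mono Set.inter_subset_left)).contMDiffAt (hO'.mem_nhds hw'))
  refine h2.congr_of_eventuallyEq ?_
  filter_upwards [hO'.mem_nhds hw'] with u hu
  exact (fderiv_comp_chart_symm (hOv hu.1)
    ((chart_mdifferentiable w).mdifferentiableAt hu.2) (ζ u)).symm

theorem isCompactlySupportedField_chartLift [T2Space V] {v : V} {ζ : V → G} {O : Set V}
    (hO : IsOpen O) (hOv : O ⊆ (chartAt G v).source) (hζ : ContMDiffOn 𝓘(ℝ, G) 𝓘(ℝ, G) ∞ ζ O)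
    {χ : Smooth 𝓘(ℝ, G) V} (hχc : HasCompactSupport (χ : V → ℝ))
    (hχ : tsupport (χ : V → ℝ) ⊆ O) :
    IsCompactlySupportedField 𝓘(ℝ, G) (chartLift v fun u => χ u • ζ u) := by
  have hz : ∀ u, χ u = 0 → chartLift v (fun u => χ u • ζ u) u = 0 := fun u hu =>
    chartLift_eq_zero (by rw [hu, zero_smul])
  refine isCompactlySupportedField_of_support (fun w => ?_) hχc (isClosed_tsupport _)
    fun u hu => hz u (image_eq_zero_of_notMem_tsupport hu)
  by_cases hw : w ∈ O
  · exact contMDiffAt_chartLift hO hOv (χ.contMDiff.contMDiffOn.smul hζ) hw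
  · refine contMDiffAt_field_iff.2 ?_
    refine (contMDiffAt_const (c := (0 : G))).congr_of_eventuallyEq ?_
    filter_upwards [(isClosed_tsupport (χ : V → ℝ)).isOpen_compl.mem_nhds fun h => hw (hχ h)]
      with u hu
    have h0 : modelField (chartLift v fun u => χ u • ζ u) u = 0 :=
      hz u (image_eq_zero_of_notMem_tsupport hu)
    rw [h0, map_zero]

end ChartLift

/-! ### Smooth splittings of a submersion: lifts and kernel fields. -/

section Splitting

variable {G : Type*} [NormedAddCommGroup G] [NormedSpace ℝ G] [FiniteDimensional ℝ G]
  {V : Type*} [TopologicalSpace V] [ChartedSpace G V] [IsManifold 𝓘(ℝ, G) ∞ V]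
  {E : Type*} [NormedAddCommGroup E] [NormedSpace ℝ E] [FiniteDimensional ℝ E]
  {M : Type*} [TopologicalSpace M] [ChartedSpace E M] [IsManifold 𝓘(ℝ, E) ∞ M]

theorem exists_clm_rightInverse {A : G →L[ℝ] E} (hA : Function.Surjective A) :
    ∃ L : E →L[ℝ] G, A.comp L = ContinuousLinearMap.id ℝ E := by
  obtain ⟨L, hL⟩ := (A : G →ₗ[ℝ] E).exists_rightInverse_of_surjective
    (LinearMap.range_eq_top.2 hA)
  exact ⟨L.toContinuousLinearMap, ContinuousLinearMap.ext fun x => congrArg (fun f => f x) hL⟩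

/-- A submersion has a smooth family of right inverses of its differential. -/
theorem exists_local_splitting [T2Space V] {φ : V → M} (hφ : ContMDiff 𝓘(ℝ, G) 𝓘(ℝ, E) ∞ φ) {v : V}
    (hsurj : Function.Surjective (modelDeriv 𝓘(ℝ, G) 𝓘(ℝ, E) φ v)) :
    ∃ O : Set V, IsOpen O ∧ v ∈ O ∧ O ⊆ (chartAt G v).source ∧
      (∀ u ∈ O, φ u ∈ (chartAt E (φ v)).source) ∧
      ∃ (A : V → (G →L[ℝ] E)) (S : V → (E →L[ℝ] G)),
        ContMDiffOn 𝓘(ℝ, G) 𝓘(ℝ, G →L[ℝ] E) ∞ A O ∧ ContMDiffOn 𝓘(ℝ, G) 𝓘(ℝ, E →L[ℝ] G) ∞ S O ∧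
        (∀ u ∈ O, ∀ a, A u (S u a) = a) ∧
        ∀ u ∈ O, ∀ a, A u a = modelDeriv 𝓘(ℝ, E) 𝓘(ℝ, E) (chartAt E (φ v)) (φ u)
          (modelDeriv 𝓘(ℝ, G) 𝓘(ℝ, E) φ u
            (modelDeriv 𝓘(ℝ, G) 𝓘(ℝ, G) (chartAt G v).symm (chartAt G v u) a)) := by
  set O₀ : Set V := (chartAt G v).source ∩ φ ⁻¹' (chartAt E (φ v)).source with hO₀
  have hO₀o : IsOpen O₀ :=
    (chartAt G v).open_source.inter ((chartAt E (φ v)).open_source.preimage hφ.continuous)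
  have hvO₀ : v ∈ O₀ := ⟨mem_chart_source G v, mem_chart_source E (φ v)⟩
  set f : V → E := fun u => chartAt E (φ v) (φ u) with hf
  have hfs : ContMDiffOn 𝓘(ℝ, G) 𝓘(ℝ, E) ∞ f O₀ :=
    (contMDiffOn_chartAt_self (φ v)).comp hφ.contMDiffOn fun u hu => hu.2
  set A : V → (G →L[ℝ] E) := fun u => fderiv ℝ (fun z => f ((chartAt G v).symm z)) (chartAt G v u)
    with hA
  have hAs := contMDiffOn_fderiv_comp_chart_symm v hO₀o Set.inter_subset_left hfs
  have hAe : ∀ u ∈ O₀, ∀ a, A u a = modelDeriv 𝓘(ℝ, E) 𝓘(ℝ, E) (chartAt E (φ v)) (φ u)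
      (modelDeriv 𝓘(ℝ, G) 𝓘(ℝ, E) φ u
        (modelDeriv 𝓘(ℝ, G) 𝓘(ℝ, G) (chartAt G v).symm (chartAt G v u) a)) := fun u hu a => by
    rw [hA]
    refine (fderiv_comp_chart_symm hu.1 ((hfs.contMDiffAt
      (hO₀o.mem_nhds hu)).mdifferentiableAt (by simp)) a).trans ?_
    have h1 := ((chart_mdifferentiable (φ v)).mdifferentiableAt hu.2).hasMFDerivAt_modelDeriv
    have h2 := (hφ.mdifferentiableAt (x := u) (by simp)).hasMFDerivAt_modelDeriv
    exact congrArg (fun L : G →L[ℝ] E => L _) (h1.comp u h2).mfderiv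
  have hAv : Function.Surjective (A v) := fun a => by
    obtain ⟨ξ, hξ⟩ := hsurj (modelDeriv 𝓘(ℝ, E) 𝓘(ℝ, E) (chartAt E (φ v)).symm
      (chartAt E (φ v) (φ v)) a)
    refine ⟨modelDeriv 𝓘(ℝ, G) 𝓘(ℝ, G) (chartAt G v) v ξ, ?_⟩
    rw [hAe v hvO₀, modelDeriv_symm_chart hvO₀.1, hξ, modelDeriv_chart_symm hvO₀.2]
  obtain ⟨L, hL⟩ := exists_clm_rightInverse hAv
  -- L is a right inverse of A only at v, but A L stays invertible nearby, so L (A L)⁻¹ is a smooth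
  -- right inverse of A there.
  have hopen := isUnit_comp_nhds hO₀o hAs.continuousOn L
  refine ⟨_, hopen, ⟨hvO₀, ?_⟩, fun u hu => hu.1.1, fun u hu => hu.1.2, A,
    fun u => L.comp (Ring.inverse ((A u).comp L)), hAs.mono Set.inter_subset_left, ?_,
    fun u hu a => ?_, fun u hu => hAe u hu.1⟩
  · change IsUnit ((A v).comp L)
    rw [hL]
    exact isUnit_one
  · exact contMDiffOn_const.clm_comp (contMDiffOn_ringInverse
      ((hAs.mono Set.inter_subset_left).clm_comp contMDiffOn_const) fun u hu => hu.2)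
  · have h1 := Ring.mul_inverse_cancel _ hu.2
    exact congrArg (fun L : E →L[ℝ] E => L a) h1

/-- Lifting vector fields along a submersion. -/
theorem exists_lift_field [T2Space V] {φ : V → M} (hφ : ContMDiff 𝓘(ℝ, G) 𝓘(ℝ, E) ∞ φ) {v : V}
    (hsurj : Function.Surjective (modelDeriv 𝓘(ℝ, G) 𝓘(ℝ, E) φ v)) :
    ∃ χ : Smooth 𝓘(ℝ, G) V, HasCompactSupport (χ : V → ℝ) ∧ (∀ᶠ u in 𝓝 v, χ u = 1) ∧
      ∀ X : ∀ q : M, TangentSpace 𝓘(ℝ, E) q, IsSmoothSection 𝓘(ℝ, E) 𝓘(ℝ, E) (fun q : M => q) X →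
        ∃ T : ∀ u : V, TangentSpace 𝓘(ℝ, G) u, IsCompactlySupportedField 𝓘(ℝ, G) T ∧
          ∀ u, modelDeriv 𝓘(ℝ, G) 𝓘(ℝ, E) φ u (modelField T u) = χ u • modelField X (φ u) := by
  obtain ⟨O, hO, hvO, hOv, hφO, A, S, hA, hS, hAS, hAe⟩ := exists_local_splitting hφ hsurj
  obtain ⟨χ, hχc, hχ, O', hO', hvO', -, hχ1⟩ := exists_bump (I := 𝓘(ℝ, G)) (hO.mem_nhds hvO)
  refine ⟨χ, hχc, ?_, fun X hX => ?_⟩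
  · filter_upwards [hO'.mem_nhds hvO'] with u hu using hχ1 u hu
  set ζ : V → G := fun u => S u (modelDeriv 𝓘(ℝ, E) 𝓘(ℝ, E) (chartAt E (φ v)) (φ u)
    (modelField X (φ u))) with hζ
  have hζs : ContMDiffOn 𝓘(ℝ, G) 𝓘(ℝ, G) ∞ ζ O := by
    refine hS.clm_apply ?_
    exact (contMDiffOn_mfderiv_section hX (chartAt E (φ v)).open_source
      (contMDiffOn_chartAt_self (φ v))).comp hφ.contMDiffOn hφO
  refine ⟨_, isCompactlySupportedField_chartLift hO hOv hζs hχc hχ, fun u => ?_⟩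
  by_cases hu : u ∈ O
  · have h1 := hAe u hu (χ u • ζ u)
    rw [map_smul, hζ, hAS u hu, ← map_smul] at h1
    have h2 := congrArg (modelDeriv 𝓘(ℝ, E) 𝓘(ℝ, E) (chartAt E (φ v)).symm
      (chartAt E (φ v) (φ u))) h1
    rw [modelDeriv_symm_chart (hφO u hu), modelDeriv_symm_chart (hφO u hu)] at h2
    exact h2.symm
  · have h0 : χ u = 0 := image_eq_zero_of_notMem_tsupport fun h => hu (hχ h)
    have h1 : modelField (chartLift v fun u => χ u • ζ u) u = 0 :=
      chartLift_eq_zero (by rw [h0, zero_smul])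
    rw [h1, h0, zero_smul, map_zero]

/-- The kernel of the differential of a submersion is spanned by global kernel fields. -/
theorem exists_kernel_frame [T2Space V] {φ : V → M} (hφ : ContMDiff 𝓘(ℝ, G) 𝓘(ℝ, E) ∞ φ) {v : V}
    (hsurj : Function.Surjective (modelDeriv 𝓘(ℝ, G) 𝓘(ℝ, E) φ v)) :
    ∃ (m : ℕ) (K : Fin m → ∀ u : V, TangentSpace 𝓘(ℝ, G) u),
      (∀ j, K j ∈ kernelFields 𝓘(ℝ, E) 𝓘(ℝ, G) φ) ∧
      ∀ ξ : G, modelDeriv 𝓘(ℝ, G) 𝓘(ℝ, E) φ v ξ = 0 → ∃ a : Fin m → ℝ,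
        ξ = ∑ j, a j • modelField (K j) v := by
  obtain ⟨O, hO, hvO, hOv, hφO, A, S, hA, hS, hAS, hAe⟩ := exists_local_splitting hφ hsurj
  obtain ⟨χ, hχc, hχ, O', hO', hvO', -, hχ1⟩ := exists_bump (I := 𝓘(ℝ, G)) (hO.mem_nhds hvO)
  let B := Module.finBasis ℝ G
  -- The projection 1 - S A onto ker A is applied to a basis. It fixes kernel vectors, so a kernel
  -- vector is the combination of the projected basis with its own basis coordinates.
  set ζ : Fin (Module.finrank ℝ G) → V → G := fun j u => B j - S u (A u (B j)) with hζ
  have hζs : ∀ j, ContMDiffOn 𝓘(ℝ, G) 𝓘(ℝ, G) ∞ (ζ j) O := fun j =>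
    contMDiffOn_const.sub (hS.clm_apply (hA.clm_apply contMDiffOn_const))
  refine ⟨_, fun j => chartLift v fun u => χ u • ζ j u, fun j =>
    ⟨isCompactlySupportedField_chartLift hO hOv (hζs j) hχc hχ, fun u => ?_⟩, fun ξ hξ => ?_⟩
  · change modelDeriv 𝓘(ℝ, G) 𝓘(ℝ, E) φ u (modelField (chartLift v fun u => χ u • ζ j u) u) = 0
    by_cases hu : u ∈ O
    · have h1 := hAe u hu (χ u • ζ j u)
      have h3 : A u (ζ j u) = 0 := by rw [hζ, map_sub, hAS u hu, sub_self]
      rw [map_smul, h3, smul_zero] at h1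
      have h2 := congrArg (modelDeriv 𝓘(ℝ, E) 𝓘(ℝ, E) (chartAt E (φ v)).symm
        (chartAt E (φ v) (φ u))) h1
      rw [modelDeriv_symm_chart (hφO u hu), map_zero] at h2
      exact h2.symm
    · have h0 : χ u = 0 := image_eq_zero_of_notMem_tsupport fun h => hu (hχ h)
      have h1 : modelField (chartLift v fun u => χ u • ζ j u) u = 0 :=
        chartLift_eq_zero (by rw [h0, zero_smul])
      rw [h1, map_zero]
  · set a := modelDeriv 𝓘(ℝ, G) 𝓘(ℝ, G) (chartAt G v) v ξ with ha
    have hAa : A v a = 0 := by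
      rw [hAe v hvO, ha, modelDeriv_symm_chart (hOv hvO), hξ, map_zero]
    refine ⟨fun j => B.repr a j, ?_⟩
    have h1 : ∀ j, modelField (chartLift v fun u => χ u • ζ j u) v =
        modelDeriv 𝓘(ℝ, G) 𝓘(ℝ, G) (chartAt G v).symm (chartAt G v v) (B j - S v (A v (B j))) :=
      fun j => by
        change modelDeriv 𝓘(ℝ, G) 𝓘(ℝ, G) (chartAt G v).symm (chartAt G v v) (χ v • ζ j v) = _
        rw [hχ1 v hvO', one_smul]
    simp only [h1, ← map_smul]
    rw [← map_sum, ← modelDeriv_symm_chart (hOv hvO) ξ, ← ha]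
    refine congrArg _ ?_
    have h2 : ∑ j, B.repr a j • (B j - S v (A v (B j))) =
        (ContinuousLinearMap.id ℝ G - (S v).comp (A v)) (∑ j, B.repr a j • B j) := by
      rw [map_sum]
      simp only [map_smul]
      rfl
    rw [h2, B.sum_repr]
    simp [hAa]

end Splitting


/-! ### Local sections of submersions. -/

section LocalSections

variable {E' : Type*} [NormedAddCommGroup E'] [NormedSpace ℝ E'] [FiniteDimensional ℝ E']
  {H' : Type*} [TopologicalSpace H'] {J : ModelWithCorners ℝ E' H'} [J.Boundaryless]
  {N : Type*} [TopologicalSpace N] [ChartedSpace H' N] [IsManifold J ∞ N]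
  {G : Type*} [NormedAddCommGroup G] [NormedSpace ℝ G] [FiniteDimensional ℝ G]
  {V : Type*} [TopologicalSpace V] [ChartedSpace G V] [IsManifold 𝓘(ℝ, G) ∞ V]

/-- Submersions have local sections. -/
theorem exists_local_section {h : N → V} {O : Set N} (hO : IsOpen O)
    (hh : ContMDiffOn J 𝓘(ℝ, G) ∞ h O) {w : N} (hw : w ∈ O)
    (hsurj : Function.Surjective (modelDeriv J 𝓘(ℝ, G) h w)) :
    ∃ Q : Set V, IsOpen Q ∧ h w ∈ Q ∧ ∃ κ : V → N, ContMDiffOn 𝓘(ℝ, G) J ∞ κ Q ∧ κ (h w) = w ∧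
      ∀ u ∈ Q, κ u ∈ O ∧ h (κ u) = u := by
  set c := chartAt G (h w) with hc
  set ψ := extChartAt J w with hψ
  have hwc : h w ∈ c.source := mem_chart_source G (h w)
  have hψw : ψ.symm (ψ w) = w := ψ.left_inv (mem_extChartAt_source w)
  have hDψ : modelDeriv 𝓘(ℝ, E') J ψ.symm (ψ w) = ContinuousLinearMap.id ℝ E' := by
    have := mfderivWithin_range_extChartAt_symm (I := J) (x := w)
    rw [J.range_eq_univ, mfderivWithin_univ] at this
    exact this
  have hDc : Function.Surjective (modelDeriv 𝓘(ℝ, G) 𝓘(ℝ, G) c (h w)) := fun a =>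
    ⟨_, modelDeriv_chart_symm hwc a⟩
  obtain ⟨L, hL⟩ := exists_clm_rightInverse
    (A := (modelDeriv 𝓘(ℝ, G) 𝓘(ℝ, G) c (h w)).comp (modelDeriv J 𝓘(ℝ, G) h w))
    (hDc.comp hsurj)
  -- An affine slice through the base point, in the directions of a right inverse L of the
  -- differential. Along it the map has derivative the identity at 0 in charts, so the inverse
  -- function theorem applies.
  set ℓ : G → E' := fun a => ψ w + L a with hℓ
  have hℓ0 : ℓ 0 = ψ w := by simp [hℓ]
  have hℓs : ContMDiff 𝓘(ℝ, G) 𝓘(ℝ, E') ∞ ℓ :=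
    (contDiff_const.add L.contDiff).contMDiff
  set O₁ : Set N := O ∩ h ⁻¹' c.source with hO₁
  have hO₁o : IsOpen O₁ := hh.continuousOn.isOpen_inter_preimage hO c.open_source
  have hψs : ContMDiffOn 𝓘(ℝ, E') J ∞ ψ.symm ψ.target := contMDiffOn_extChartAt_symm w
  set O₂ : Set E' := ψ.target ∩ ψ.symm ⁻¹' O₁ with hO₂
  have hO₂o : IsOpen O₂ :=
    hψs.continuousOn.isOpen_inter_preimage (isOpen_extChartAt_target w) hO₁o
  set O₃ : Set G := ℓ ⁻¹' O₂ with hO₃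
  have hO₃o : IsOpen O₃ := hO₂o.preimage hℓs.continuous
  have h0 : (0 : G) ∈ O₃ := by
    change ℓ 0 ∈ O₂
    rw [hℓ0]
    refine ⟨mem_extChartAt_target w, ?_⟩
    change ψ.symm (ψ w) ∈ O₁
    rw [hψw]
    exact ⟨hw, hwc⟩
  set κ₀ : G → N := fun a => ψ.symm (ℓ a) with hκ₀
  have hκ₀s : ContMDiffOn 𝓘(ℝ, G) J ∞ κ₀ O₃ :=
    hψs.comp hℓs.contMDiffOn fun a ha => ha.1
  have hκ₀0 : κ₀ 0 = w := by
    change ψ.symm (ℓ 0) = w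
    rw [hℓ0, hψw]
  set g : G → G := fun a => c (h (κ₀ a)) with hg
  have hgs : ContDiffOn ℝ ∞ g O₃ := ContMDiffOn.contDiffOn <|
    (contMDiffOn_chartAt_self (h w)).comp (hh.comp hκ₀s fun a ha => ha.2.1) fun a ha => ha.2.2
  have hg0 : g 0 = c (h w) := by
    simp only [hg, hκ₀0]
  have hgd : HasFDerivAt g ((ContinuousLinearEquiv.refl ℝ G : G ≃L[ℝ] G) : G →L[ℝ] G) 0 := by
    have d1 : HasMFDerivAt 𝓘(ℝ, G) 𝓘(ℝ, E') ℓ 0 L :=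
      (L.hasFDerivAt.const_add (ψ w)).hasMFDerivAt
    have d2 : HasMFDerivAt 𝓘(ℝ, E') J ψ.symm (ℓ 0) (ContinuousLinearMap.id ℝ E') := by
      rw [hℓ0, ← hDψ]
      exact ((hψs.contMDiffAt ((isOpen_extChartAt_target w).mem_nhds
        (mem_extChartAt_target w))).mdifferentiableAt (by simp)).hasMFDerivAt_modelDeriv
    have d3 : HasMFDerivAt J 𝓘(ℝ, G) h (κ₀ 0) (modelDeriv (E := E') (E' := G) J 𝓘(ℝ, G) h w) := by
      rw [hκ₀0]
      exact ((hh.contMDiffAt (hO.mem_nhds hw)).mdifferentiableAt (by simp)).hasMFDerivAt_modelDeriv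
    have d4 : HasMFDerivAt 𝓘(ℝ, G) 𝓘(ℝ, G) c (h (κ₀ 0))
        (modelDeriv (E := G) (E' := G) 𝓘(ℝ, G) 𝓘(ℝ, G) c (h w)) := by
      rw [hκ₀0]
      exact ((chart_mdifferentiable (h w)).mdifferentiableAt hwc).hasMFDerivAt_modelDeriv
    have d5 := d4.comp 0 (d3.comp 0 (d2.comp 0 d1))
    have d6 : fderiv ℝ g 0 = ContinuousLinearMap.id ℝ G := by
      refine (mfderiv_eq_fderiv.symm.trans d5.mfderiv).trans ?_
      exact hL
    have d7 := ((hgs.contDiffAt (hO₃o.mem_nhds h0)).differentiableAt (by simp)).hasFDerivAt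
    rw [d6] at d7
    exact d7
  obtain ⟨Q, hQ, hQ0, S, hS, hS0, hSQ⟩ := exists_contDiffOn_rightInverse hO₃o hgs h0 hgd
  rw [hg0] at hQ0 hS0
  have hcs := contMDiffOn_chartAt_self (E := G) (h w)
  refine ⟨c.source ∩ c ⁻¹' Q, c.continuousOn.isOpen_inter_preimage c.open_source hQ, ⟨hwc, hQ0⟩,
    fun u => κ₀ (S (c u)), ?_, ?_, fun u hu => ⟨(hSQ _ hu.2).1.2.1, ?_⟩⟩
  · exact hκ₀s.comp (hS.contMDiffOn.comp (hcs.mono Set.inter_subset_left) fun u hu => hu.2)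
      fun u hu => (hSQ _ hu.2).1
  · change κ₀ (S (c (h w))) = w
    rw [hS0, hκ₀0]
  · exact c.injOn (hSQ _ hu.2).1.2.2 hu.1 (hSQ _ hu.2).2

end LocalSections

/-! ### Frames of ker ds adapted to a bi-submersion. -/

section Frames

variable {G : Type*} [NormedAddCommGroup G] [NormedSpace ℝ G] [FiniteDimensional ℝ G]
  {V : Type*} [TopologicalSpace V] [ChartedSpace G V] [IsManifold 𝓘(ℝ, G) ∞ V] [T2Space V]
  {E : Type*} [NormedAddCommGroup E] [NormedSpace ℝ E] [FiniteDimensional ℝ E]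
  {M : Type*} [TopologicalSpace M] [ChartedSpace E M] [IsManifold 𝓘(ℝ, E) ∞ M] [T2Space M]

/-- A bi-submersion carrying the identity has a common local section of source and target. -/
theorem Carries.exists_section {t s : V → M} {v : V} (h : Carries 𝓘(ℝ, E) 𝓘(ℝ, G) t s id v) :
    ∃ O : Set M, IsOpen O ∧ s v ∈ O ∧ ∃ σ : M → V, ContMDiffOn 𝓘(ℝ, E) 𝓘(ℝ, G) ∞ σ O ∧
      σ (s v) = v ∧ ∀ p ∈ O, s (σ p) = p ∧ t (σ p) = p := by
  obtain ⟨B, hB, hvB, hid⟩ := h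
  obtain ⟨hopen, σ, hσ, hinv⟩ := hB.source
  obtain ⟨O, hO, hOo, hvO⟩ := eventually_nhds_iff.1 hid
  refine ⟨O ∩ s '' B, hOo.inter hopen, ⟨hvO, v, hvB, rfl⟩, σ, hσ.mono Set.inter_subset_right,
    hinv hvB, ?_⟩
  rintro p ⟨hpO, u, huB, rfl⟩
  rw [hinv huB]
  exact ⟨rfl, hO _ hpO u huB rfl⟩

theorem modelField_sub_sum {ι : Type*} [Fintype ι] (K : ∀ u : V, TangentSpace 𝓘(ℝ, G) u)
    (Y : ι → ∀ u : V, TangentSpace 𝓘(ℝ, G) u) (f : ι → V → ℝ) (u : V) :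
    modelField (K - fun u => ∑ i, f i u • Y i u) u =
      modelField K u - ∑ i, f i u • modelField (Y i) u := rfl

/-- Local frames adapted to a bi-submersion: fields `Y i` tangent to the fibers of `s` that lift the
generators along `t`, and fields `Z j` tangent to the fibers of both `s` and `t`. -/
theorem IsBisubmersion.exists_frame {F : Foliation 𝓘(ℝ, E) M} {t s : V → M}
    (hV : IsBisubmersion 𝓘(ℝ, G) F t s) {n : ℕ} {X : Fin n → F.toModule} {U : Set M}
    (hU : IsOpen U) (hgen : ∀ ζ ∈ F.toModule,
      ∃ c : Fin n → M → ℝ, (∀ j, ContMDiffOn 𝓘(ℝ, E) 𝓘(ℝ, ℝ) ∞ (c j) U) ∧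
        ∀ p ∈ U, ζ p = ∑ j, c j p • (X j : ∀ x : M, TangentSpace 𝓘(ℝ, E) x) p) {v : V}
    (hv : t v ∈ U) :
    ∃ (m : ℕ) (Y : Fin n → ∀ u : V, TangentSpace 𝓘(ℝ, G) u)
      (Z : Fin m → ∀ u : V, TangentSpace 𝓘(ℝ, G) u),
      (∀ i, IsSmoothSection 𝓘(ℝ, G) 𝓘(ℝ, G) (fun u : V => u) (Y i)) ∧
      (∀ j, IsSmoothSection 𝓘(ℝ, G) 𝓘(ℝ, G) (fun u : V => u) (Z j)) ∧
      (∀ᶠ u in 𝓝 v,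
        (∀ i, modelDeriv 𝓘(ℝ, G) 𝓘(ℝ, E) s u (modelField (Y i) u) = 0) ∧
        (∀ i, modelDeriv 𝓘(ℝ, G) 𝓘(ℝ, E) t u (modelField (Y i) u) =
          modelField (fieldsOf F X i) (t u)) ∧
        (∀ j, modelDeriv 𝓘(ℝ, G) 𝓘(ℝ, E) s u (modelField (Z j) u) = 0) ∧
        ∀ j, modelDeriv 𝓘(ℝ, G) 𝓘(ℝ, E) t u (modelField (Z j) u) = 0) ∧
      ∀ ξ : G, modelDeriv 𝓘(ℝ, G) 𝓘(ℝ, E) s v ξ = 0 → ∃ (a : Fin n → ℝ) (c : Fin m → ℝ),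
        ξ = ∑ i, a i • modelField (Y i) v + ∑ j, c j • modelField (Z j) v := by
  have hts := hV.submersion_t.1
  have hss := hV.submersion_s.1
  obtain ⟨χ, hχc, hχ1, hlift⟩ := exists_lift_field hts (v := v) (hV.submersion_t.2 v)
  choose T hT hTX using fun i => hlift (fieldsOf F X i) (F.compactlySupported _ (X i).2).1
  -- The lift T_i of X_i along t lies in the common pull-back, hence splits as Y_i + Y_i' with Y_i
  -- in ker ds and Y_i' in ker dt. Thus Y_i still lifts χ X_i along t.
  have hTmem : ∀ i, T i ∈ F.preimage 𝓘(ℝ, G) s := fun i => by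
    rw [hV.preimage_eq]
    refine ⟨hT i, mem_pullback_of_coeff F X (g := fun j u => if j = i then χ u else 0)
      (fun j => ?_) (fun j => ?_) fun u => ?_⟩
    · by_cases h : j = i
      · simpa [h] using χ.contMDiff
      · simpa [h] using contMDiff_const
    · by_cases h : j = i
      · simpa [h] using hχc
      · simp only [h, if_false]
        exact HasCompactSupport.zero
    · refine (hTX i u).trans ?_
      have h1 : ∀ j, (if j = i then χ u else 0) • modelField (fieldsOf F X j) (t u) =
          if j = i then χ u • modelField (fieldsOf F X i) (t u) else 0 := fun j => by
        split_ifs with h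
        · rw [h]
        · exact zero_smul _ _
      have h2 : ∑ j, (if j = i then χ u else 0) • modelField (fieldsOf F X j) (t u) =
          χ u • modelField (fieldsOf F X i) (t u) := by
        rw [Finset.sum_congr rfl fun j _ => h1 j, Finset.sum_ite_eq' Finset.univ i,
          if_pos (Finset.mem_univ i)]
      exact h2.symm
  have hsplit : ∀ i, ∃ Y ∈ kernelFields 𝓘(ℝ, E) 𝓘(ℝ, G) s, ∃ Y' ∈ kernelFields 𝓘(ℝ, E) 𝓘(ℝ, G) t,
      T i = Y + Y' := fun i => by
    have := hTmem i
    rwa [hV.preimage_eq_add] at this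
  choose Y hY Y' hY' hTY using hsplit
  have hYt : ∀ i u, modelDeriv 𝓘(ℝ, G) 𝓘(ℝ, E) t u (modelField (Y i) u) =
      χ u • modelField (fieldsOf F X i) (t u) := fun i u => by
    rw [← hTX i u]
    have h1 : modelField (T i) u = modelField (Y i) u + modelField (Y' i) u := by
      rw [hTY]
      rfl
    have h2 : modelDeriv 𝓘(ℝ, G) 𝓘(ℝ, E) t u (modelField (Y' i) u) = 0 := (hY' i).2 u
    rw [h1, map_add, h2, add_zero]
  have hYs : ∀ i u, modelDeriv 𝓘(ℝ, G) 𝓘(ℝ, E) s u (modelField (Y i) u) = 0 := fun i u =>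
    (hY i).2 u
  obtain ⟨m, K, hK, hKspan⟩ := exists_kernel_frame hss (v := v) (hV.submersion_s.2 v)
  have hKs : ∀ j u, modelDeriv 𝓘(ℝ, G) 𝓘(ℝ, E) s u (modelField (K j) u) = 0 := fun j u =>
    (hK j).2 u
  have hKmem : ∀ j, K j ∈ F.preimage 𝓘(ℝ, G) t := fun j => by
    rw [← hV.preimage_eq, hV.preimage_eq_add]
    -- The ker dt part is the zero field; writing it as K_j - K_j makes its smoothness and compact
    -- support immediate.
    refine ⟨K j, hK j, K j + -K j, ⟨(hK j).1.add (hK j).1.neg, fun u => ?_⟩, by simp⟩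
    rw [add_neg_cancel]
    exact map_zero (modelDeriv (E := G) (E' := E) 𝓘(ℝ, G) 𝓘(ℝ, E) t u)
  have hOo : IsOpen (t ⁻¹' U) := hU.preimage hts.continuous
  choose f hf hfc hfK using fun j => exists_coeff_of_mem_pullback F hgen
    (O := t ⁻¹' U) hts.contMDiffOn (fun u hu => hu) (hKmem j).2
  -- On the preimage of U, dt(K_j) = ∑ f_ji X_i, so K_j - ∑ f_ji Y_i is killed by both differentials
  -- where χ = 1. Only the germs of the f_ji at v matter, so they are replaced by global smooth
  -- functions.
  choose f' hf' hff' using fun j i => exists_contMDiff_extension hOo (hf j i) (x := v) hv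
  refine ⟨m, Y, fun j => K j - fun u => ∑ i, f' j i u • Y i u, fun i => (hY i).1.1, fun j => ?_,
    ?_, fun ξ hξ => ?_⟩
  · refine ContMDiff.sub_section (hK j).1.1 (ContMDiff.sum_section fun i _ => ?_)
    exact ContMDiff.smul_section (hf' j i) (hY i).1.1
  · filter_upwards [hχ1, hOo.mem_nhds hv, Filter.eventually_all.2 fun j =>
      Filter.eventually_all.2 fun i => hff' j i] with u hu1 huU huf
    refine ⟨fun i => hYs i u, fun i => by rw [hYt, hu1, one_smul], fun j => ?_, fun j => ?_⟩
    · rw [modelField_sub_sum, map_sub, map_sum, hKs]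
      simp [hYs]
    · rw [modelField_sub_sum, map_sub, map_sum]
      simp only [map_smul, hYt, hu1, one_smul, huf]
      exact sub_eq_zero.2 (hfK j u huU)
  · obtain ⟨c, hc⟩ := hKspan ξ hξ
    refine ⟨fun i => ∑ j, c j * f' j i v, c, ?_⟩
    simp only [modelField_sub_sum, smul_sub, Finset.sum_sub_distrib]
    rw [hc]
    simp only [Finset.sum_smul, Finset.smul_sum, smul_smul]
    rw [Finset.sum_comm]
    abel

end Frames


/-! ### The submersive morphism to the exponential bi-submersion. -/

section Morphism

variable {G : Type*} [NormedAddCommGroup G] [NormedSpace ℝ G] [FiniteDimensional ℝ G]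
  {V : Type*} [TopologicalSpace V] [ChartedSpace G V] [IsManifold 𝓘(ℝ, G) ∞ V] [T2Space V]
  {E : Type*} [NormedAddCommGroup E] [NormedSpace ℝ E] [FiniteDimensional ℝ E]
  {M : Type*} [TopologicalSpace M] [ChartedSpace E M] [IsManifold 𝓘(ℝ, E) ∞ M] [T2Space M]

/-- Smooth maps send integral curves of a field to integral curves of a related field. -/
theorem hasMFDerivAt_comp_curve {φ : V → M} (hφ : ContMDiff 𝓘(ℝ, G) 𝓘(ℝ, E) ∞ φ) {γ : ℝ → V}
    {r : ℝ} {a : TangentSpace 𝓘(ℝ, G) (γ r)}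
    (hγ : HasMFDerivAt 𝓘(ℝ, ℝ) 𝓘(ℝ, G) γ r ((1 : ℝ →L[ℝ] ℝ).smulRight a))
    {a' : TangentSpace 𝓘(ℝ, E) (φ (γ r))}
    (ha : modelDeriv 𝓘(ℝ, G) 𝓘(ℝ, E) φ (γ r) a = a') :
    HasMFDerivAt 𝓘(ℝ, ℝ) 𝓘(ℝ, E) (fun r => φ (γ r)) r ((1 : ℝ →L[ℝ] ℝ).smulRight a') := by
  have h1 := (hφ.mdifferentiableAt (x := γ r) (by simp)).hasMFDerivAt_modelDeriv
  refine (h1.comp r hγ).congr_mfderiv (ContinuousLinearMap.ext fun c => ?_)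
  subst ha
  have key : ∀ (c : ℝ) (a : G), modelDeriv 𝓘(ℝ, G) 𝓘(ℝ, E) φ (γ r) (c • a) =
      c • modelDeriv 𝓘(ℝ, G) 𝓘(ℝ, E) φ (γ r) a := fun c a => map_smul _ c a
  exact key c a

theorem expMap_zero (F : Foliation 𝓘(ℝ, E) M) {n : ℕ} (X : Fin n → F.toModule) (p : M) :
    expMap 𝓘(ℝ, E) (fieldsOf F X) ((0 : EuclideanSpace ℝ (Fin n)), p) = p := by
  refine expMap_eq_of_curve F X 0 (γ := fun _ => p) fun r _ => ?_
  refine (hasMFDerivAt_const p r).congr_mfderiv (ContinuousLinearMap.ext fun c => ?_)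
  have h1 : ∑ i, (0 : EuclideanSpace ℝ (Fin n)) i • fieldsOf F X i p = 0 :=
    Finset.sum_eq_zero fun i _ => zero_smul ℝ _
  rw [h1]
  have key : ∀ c : ℝ, (0 : E) = c • (0 : E) := fun c => (smul_zero c).symm
  exact key c

/-- A bi-submersion carrying the identity at `v` maps submersively, near `v`, to the bi-submersion
given by the exponential map. -/
theorem IsBisubmersion.exists_morphism (F : Foliation 𝓘(ℝ, E) M) {n : ℕ}
    (X : Fin n → F.toModule) {t s : V → M} (hV : IsBisubmersion 𝓘(ℝ, G) F t s) {v : V}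
    (b : Module.Basis (Fin n) ℝ (F.Fiber (s v))) (hb : ∀ i, b i = F.toFiber (s v) (X i))
    (hid : Carries 𝓘(ℝ, E) 𝓘(ℝ, G) t s id v) {O : Set (EuclideanSpace ℝ (Fin n) × M)}
    (hO : IsOpen O) (hvO : ((0 : EuclideanSpace ℝ (Fin n)), s v) ∈ O) :
    ∃ V' : Set V, IsOpen V' ∧ v ∈ V' ∧ ∃ g : V → EuclideanSpace ℝ (Fin n) × M,
      ContMDiffOn 𝓘(ℝ, G) (𝓘(ℝ, EuclideanSpace ℝ (Fin n)).prod 𝓘(ℝ, E)) ∞ g V' ∧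
      g v = (0, s v) ∧ ∀ u ∈ V', g u ∈ O ∧ (g u).2 = s u ∧
        expMap 𝓘(ℝ, E) (fieldsOf F X) (g u) = t u ∧
        Function.Surjective (modelDeriv 𝓘(ℝ, G)
          (𝓘(ℝ, EuclideanSpace ℝ (Fin n)).prod 𝓘(ℝ, E)) g u) := by
  have hts := hV.submersion_t.1
  have hss := hV.submersion_s.1
  obtain ⟨U, hU, hxU, hgen, 𝒱, h𝒱, hx𝒱, hexp, -, -, -, -, R, hR, hR0, hRt, -, -⟩ :=
    exists_expMap_nhd F (s v) X b hb
  obtain ⟨Oσ, hOσ, hvOσ, σ, hσ, hσv, hσp⟩ := hid.exists_section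
  have htv : t v = s v := by
    have := (hσp _ hvOσ).2
    rwa [hσv] at this
  obtain ⟨m, Y, Z, hYsm, hZsm, hframe, hspan⟩ := hV.exists_frame hU hgen (v := v) (htv ▸ hxU)
  obtain ⟨O₁, hO₁f, hO₁, hvO₁⟩ := eventually_nhds_iff.1 hframe
  set Λ : Fin n ⊕ Fin m → ∀ u : V, TangentSpace 𝓘(ℝ, G) u := Sum.elim Y Z with hΛ
  have hΛs : ∀ k, IsSmoothSection 𝓘(ℝ, G) 𝓘(ℝ, G) (fun u : V => u) (Λ k) := by
    rintro (i | j)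
    exacts [hYsm i, hZsm j]
  obtain ⟨𝒰, h𝒰, hv𝒰, τ, hτ, hcurve, hzero, -⟩ := exists_local_flow_manifold Λ hΛs v hO₁ hvO₁
  -- The time-one flow of the frame of ker ds, started on the bisection. Its differential at (0, s
  -- v) is dσ plus the span of the frame at v. It is surjective, since subtracting dσ(ds(ξ)) from ξ
  -- leaves a vector of ker ds.
  set h : EuclideanSpace ℝ (Fin n ⊕ Fin m) × M → V := fun w => τ (w.1, σ w.2) with hh
  set ρ : EuclideanSpace ℝ (Fin n ⊕ Fin m) × M → EuclideanSpace ℝ (Fin n ⊕ Fin m) × V :=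
    fun w => (w.1, σ w.2) with hρ
  have hρs : ContMDiffOn (𝓘(ℝ, EuclideanSpace ℝ (Fin n ⊕ Fin m)).prod 𝓘(ℝ, E))
      (𝓘(ℝ, EuclideanSpace ℝ (Fin n ⊕ Fin m)).prod 𝓘(ℝ, G)) ∞ ρ (Prod.snd ⁻¹' Oσ) :=
    contMDiff_fst.contMDiffOn.prodMk (hσ.comp contMDiff_snd.contMDiffOn fun w hw => hw)
  set O₂ : Set (EuclideanSpace ℝ (Fin n ⊕ Fin m) × M) := Prod.snd ⁻¹' Oσ ∩ ρ ⁻¹' 𝒰 with hO₂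
  have hO₂o : IsOpen O₂ :=
    hρs.continuousOn.isOpen_inter_preimage (hOσ.preimage continuous_snd) h𝒰
  have hρv : ρ (0, s v) = (0, v) := by
    simp only [hρ, hσv]
  have hvO₂ : ((0 : EuclideanSpace ℝ (Fin n ⊕ Fin m)), s v) ∈ O₂ := by
    refine ⟨hvOσ, ?_⟩
    rw [Set.mem_preimage, hρv]
    exact hv𝒰
  have hhs : ContMDiffOn (𝓘(ℝ, EuclideanSpace ℝ (Fin n ⊕ Fin m)).prod 𝓘(ℝ, E)) 𝓘(ℝ, G) ∞ h O₂ :=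
    hτ.comp (hρs.mono Set.inter_subset_left) fun w hw => hw.2
  have hhv : h (0, s v) = v := by
    change τ (ρ (0, s v)) = v
    rw [hρv, (hzero v hv𝒰).1]
  have hDσ : ∀ ζ : E, modelDeriv 𝓘(ℝ, G) 𝓘(ℝ, E) s v
      (modelDeriv 𝓘(ℝ, E) 𝓘(ℝ, G) σ (s v) ζ) = ζ := fun ζ => by
    have h1 := ((hσ.contMDiffAt (hOσ.mem_nhds hvOσ)).mdifferentiableAt
      (by simp)).hasMFDerivAt_modelDeriv
    have h2 : HasMFDerivAt 𝓘(ℝ, G) 𝓘(ℝ, E) s (σ (s v))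
        (modelDeriv (E := G) (E' := E) 𝓘(ℝ, G) 𝓘(ℝ, E) s v) := by
      rw [hσv]
      exact (hss.mdifferentiableAt (by simp)).hasMFDerivAt_modelDeriv
    have h3 := (h2.comp (s v) h1).mfderiv
    have h4 : s ∘ σ =ᶠ[𝓝 (s v)] id := by
      filter_upwards [hOσ.mem_nhds hvOσ] with p hp using (hσp p hp).1
    have h5 := h4.mfderiv_eq (I := 𝓘(ℝ, E)) (I' := 𝓘(ℝ, E))
    exact congrArg (fun L : E →L[ℝ] E => L ζ) (h3.symm.trans (h5.trans mfderiv_id))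
  have hDh : ∀ (η : EuclideanSpace ℝ (Fin n ⊕ Fin m)) (ζ : E),
      modelDeriv (𝓘(ℝ, EuclideanSpace ℝ (Fin n ⊕ Fin m)).prod 𝓘(ℝ, E)) 𝓘(ℝ, G) h (0, s v) (η, ζ) =
        modelDeriv 𝓘(ℝ, E) 𝓘(ℝ, G) σ (s v) ζ + ∑ k, η k • modelField (Λ k) v := fun η ζ => by
    rw [← (hzero v hv𝒰).2]
    have h1 := ((hσ.contMDiffAt (hOσ.mem_nhds hvOσ)).mdifferentiableAt
      (by simp)).hasMFDerivAt_modelDeriv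
    have h2 := (hasMFDerivAt_fst (I := 𝓘(ℝ, EuclideanSpace ℝ (Fin n ⊕ Fin m))) (I' := 𝓘(ℝ, E))
      ((0 : EuclideanSpace ℝ (Fin n ⊕ Fin m)), s v)).prodMk (h1.comp
        ((0 : EuclideanSpace ℝ (Fin n ⊕ Fin m)), s v) (hasMFDerivAt_snd
          (I := 𝓘(ℝ, EuclideanSpace ℝ (Fin n ⊕ Fin m))) (I' := 𝓘(ℝ, E)) _))
    have h3 : HasMFDerivAt (𝓘(ℝ, EuclideanSpace ℝ (Fin n ⊕ Fin m)).prod 𝓘(ℝ, G)) 𝓘(ℝ, G) τ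
        (ρ (0, s v)) (modelDeriv (E := EuclideanSpace ℝ (Fin n ⊕ Fin m) × G) (E' := G)
          (𝓘(ℝ, EuclideanSpace ℝ (Fin n ⊕ Fin m)).prod 𝓘(ℝ, G)) 𝓘(ℝ, G) τ (0, v)) := by
      rw [hρv]
      exact ((hτ.contMDiffAt (h𝒰.mem_nhds hv𝒰)).mdifferentiableAt
        (by simp)).hasMFDerivAt_modelDeriv
    exact congrArg (fun L : EuclideanSpace ℝ (Fin n ⊕ Fin m) × E →L[ℝ] G => L (η, ζ))
      (h3.comp ((0 : EuclideanSpace ℝ (Fin n ⊕ Fin m)), s v) h2).mfderiv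
  have hhsurj : Function.Surjective (modelDeriv
      (𝓘(ℝ, EuclideanSpace ℝ (Fin n ⊕ Fin m)).prod 𝓘(ℝ, E)) 𝓘(ℝ, G) h (0, s v)) := fun ξ => by
    set ζ : E := modelDeriv 𝓘(ℝ, G) 𝓘(ℝ, E) s v ξ with hζ
    obtain ⟨a, c, hac⟩ := hspan (ξ - modelDeriv 𝓘(ℝ, E) 𝓘(ℝ, G) σ (s v) ζ) (by
      rw [map_sub, hDσ, ← hζ, sub_self])
    refine ⟨(WithLp.toLp 2 (Sum.elim a c), ζ), ?_⟩
    rw [hDh, Fintype.sum_sum_type]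
    simp only [Sum.elim_inl, Sum.elim_inr, hΛ]
    rw [← hac]
    abel
  obtain ⟨Q, hQ, hvQ, κ, hκ, hκv, hκh⟩ := exists_local_section hO₂o hhs hvO₂ hhsurj
  rw [hhv] at hvQ hκv
  -- Only the coefficients of the Y_i are kept; the Z_j move neither s nor t.
  let P : EuclideanSpace ℝ (Fin n ⊕ Fin m) →L[ℝ] EuclideanSpace ℝ (Fin n) :=
    ((EuclideanSpace.equiv (Fin n) ℝ).symm : (Fin n → ℝ) →L[ℝ] EuclideanSpace ℝ (Fin n)).comp
      (ContinuousLinearMap.pi fun i => EuclideanSpace.proj (Sum.inl i))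
  have hP : ∀ a i, P a i = a (Sum.inl i) := fun a i => rfl
  set y : V → EuclideanSpace ℝ (Fin n) := fun u => P (κ u).1 with hy
  have hys : ContMDiffOn 𝓘(ℝ, G) 𝓘(ℝ, EuclideanSpace ℝ (Fin n)) ∞ y Q :=
    P.contMDiff.comp_contMDiffOn (contMDiff_fst.comp_contMDiffOn hκ)
  have hyv : y v = 0 := by
    simp only [hy, hκv, map_zero]
  have hκst : ∀ u ∈ Q, expMap 𝓘(ℝ, E) (fieldsOf F X) (y u, s u) = t u := fun u hu => by
    obtain ⟨⟨hκσ, hκ𝒰⟩, hκu⟩ := hκh u hu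
    obtain ⟨γ, hγ0, hγ1, hγ⟩ := hcurve _ hκ𝒰
    have hγ0' : γ 0 = σ (κ u).2 := hγ0
    have hγ1' : γ 1 = u := hγ1.trans hκu
    -- Since the frame lies in ker ds, s along γ is an integral curve of the zero field: this gives
    -- s u = s(σ p) = p, where p is the base point of κ u. The curve t along γ follows ∑ y_i X_i
    -- from t(σ p) = p to t u.
    have hsγ := expMap_eq_of_curve F X 0 (γ := fun r => s (γ r)) fun r hr => by
      refine hasMFDerivAt_comp_curve hss (hγ r hr).2 ?_
      have hf := hO₁f _ (hγ r hr).1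
      have e1 : modelDeriv 𝓘(ℝ, G) 𝓘(ℝ, E) s (γ r)
          (∑ k, (κ u).1 k • modelField (Λ k) (γ r)) = 0 := by
        rw [map_sum, Fintype.sum_sum_type]
        simp [map_smul, hΛ, hf.1, hf.2.2.1]
      exact e1.trans (Finset.sum_eq_zero fun i _ => zero_smul ℝ _).symm
    have htγ := expMap_eq_of_curve F X (y u) (γ := fun r => t (γ r)) fun r hr => by
      refine hasMFDerivAt_comp_curve hts (hγ r hr).2 ?_
      have hf := hO₁f _ (hγ r hr).1
      have e1 : modelDeriv 𝓘(ℝ, G) 𝓘(ℝ, E) t (γ r)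
          (∑ k, (κ u).1 k • modelField (Λ k) (γ r)) =
          ∑ i, y u i • modelField (fieldsOf F X i) (t (γ r)) := by
        rw [map_sum, Fintype.sum_sum_type]
        simp [map_smul, hΛ, hf.2.1, hf.2.2.2, hy, hP]
      exact e1
    rw [expMap_zero] at hsγ
    simp only [hγ0', hγ1', (hσp _ hκσ).1, (hσp _ hκσ).2] at hsγ htγ
    rw [← hsγ]
    exact htγ
  set g : V → EuclideanSpace ℝ (Fin n) × M := fun u => (y u, s u) with hg
  have hgs : ContMDiffOn 𝓘(ℝ, G) (𝓘(ℝ, EuclideanSpace ℝ (Fin n)).prod 𝓘(ℝ, E)) ∞ g Q :=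
    hys.prodMk hss.contMDiffOn
  have hgv : g v = (0, s v) := by simp only [hg, hyv]
  have hDg : ∀ u ∈ Q, ∀ ξ : G, modelDeriv 𝓘(ℝ, G)
      (𝓘(ℝ, EuclideanSpace ℝ (Fin n)).prod 𝓘(ℝ, E)) g u ξ =
      (modelDeriv 𝓘(ℝ, G) 𝓘(ℝ, EuclideanSpace ℝ (Fin n)) y u ξ,
        modelDeriv 𝓘(ℝ, G) 𝓘(ℝ, E) s u ξ) := fun u hu ξ => by
    have h1 := ((hys.contMDiffAt (hQ.mem_nhds hu)).mdifferentiableAt (by simp)).hasMFDerivAt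
    have h2 := (hss.mdifferentiableAt (x := u) (by simp)).hasMFDerivAt
    exact congrArg (fun L : G →L[ℝ] EuclideanSpace ℝ (Fin n) × E => L ξ) (h1.prodMk h2).mfderiv
  set Q₁ : Set V := (Q ∩ g ⁻¹' (O ∩ 𝒱)) ∩ O₁ with hQ₁
  have hQ₁o : IsOpen Q₁ :=
    (hgs.continuousOn.isOpen_inter_preimage hQ (hO.inter h𝒱)).inter hO₁
  have hvQ₁ : v ∈ Q₁ := ⟨⟨hvQ, by rw [Set.mem_preimage, hgv]; exact ⟨hvO, hx𝒱⟩⟩, hvO₁⟩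
  set θ : Fin n → V → EuclideanSpace ℝ (Fin n) := fun i u =>
    modelDeriv 𝓘(ℝ, G) 𝓘(ℝ, EuclideanSpace ℝ (Fin n)) y u (modelField (Y i) u) with hθ
  have hθs : ∀ i, ContMDiffOn 𝓘(ℝ, G) 𝓘(ℝ, EuclideanSpace ℝ (Fin n)) ∞ (θ i) Q := fun i =>
    contMDiffOn_mfderiv_section (hYsm i) hQ hys
  -- The identity exp ∘ g = t is differentiated along Y_i: the right side gives X_i, and on the left
  -- dg(Y_i) = (θ_i, 0), to which the formula for R applies with b = 0.
  have hrel : ∀ u ∈ Q₁, ∀ i, modelField (fieldsOf F X i) (t u) =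
      ∑ k, R (g u) (0, θ i u) k • modelField (fieldsOf F X k) (t u) := fun u hu i => by
    have hev : (expMap 𝓘(ℝ, E) (fieldsOf F X)) ∘ g =ᶠ[𝓝 u] t := by
      filter_upwards [hQ.mem_nhds hu.1.1] with z hz using hκst z hz
    have h1 := ((hexp.contMDiffAt (h𝒱.mem_nhds hu.1.2.2)).mdifferentiableAt
      (by simp)).hasMFDerivAt_modelDeriv
    have h2 := ((hgs.contMDiffAt (hQ.mem_nhds hu.1.1)).mdifferentiableAt
      (by simp)).hasMFDerivAt_modelDeriv
    have h3 := (h1.comp u h2).mfderiv.symm.trans (hev.mfderiv_eq)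
    have h4 := congrArg (fun L : G →L[ℝ] E => L (modelField (Y i) u)) h3
    have hf := hO₁f u hu.2
    have h5 := hRt (g u) hu.1.2.2 0 (θ i u)
    have h6 : ∑ j, (0 : EuclideanSpace ℝ (Fin n)) j • modelField (fieldsOf F X j) (g u).2 = 0 := by
      simp
    rw [h6, hκst u hu.1.1] at h5
    rw [← h5, ← hf.2.1 i]
    refine h4.symm.trans ?_
    refine congrArg (modelDeriv (𝓘(ℝ, EuclideanSpace ℝ (Fin n)).prod 𝓘(ℝ, E)) 𝓘(ℝ, E)
      (expMap 𝓘(ℝ, E) (fieldsOf F X)) (g u)) ?_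
    refine (hDg u hu.1.1 _).trans ?_
    rw [hf.1 i]
  -- Pulled back along σ, `hrel` becomes a smooth relation between the X_k near s v in M, so its
  -- coefficients R(0, θ_i)_k - δ_ik vanish at s v. As R(0, η) = η at (0, s v), θ_i(v) is the i-th
  -- basis vector.
  have hθv : ∀ i k, θ i v k = if k = i then 1 else 0 := fun i k => by
    have hOm : IsOpen (Oσ ∩ σ ⁻¹' Q₁) := hσ.continuousOn.isOpen_inter_preimage hOσ hQ₁o
    have hvm : s v ∈ Oσ ∩ σ ⁻¹' Q₁ := ⟨hvOσ, by rw [Set.mem_preimage, hσv]; exact hvQ₁⟩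
    have hRs : ContMDiffOn 𝓘(ℝ, G) 𝓘(ℝ, EuclideanSpace ℝ (Fin n)) ∞
        (fun u => R (g u) ((0 : EuclideanSpace ℝ (Fin n)), θ i u)) Q₁ :=
      (hR.comp (hgs.mono fun u hu => hu.1.1) fun u hu => hu.1.2.2).clm_apply
        (contMDiffOn_const.prodMk_space ((hθs i).mono fun u hu => hu.1.1))
    have h1 := coeff_eq_zero_of_relation F (s v) X b hb
      (m := fun k p => R (g (σ p)) ((0 : EuclideanSpace ℝ (Fin n)), θ i (σ p)) k -
        if k = i then 1 else 0) hOm hvm (fun k => ?_) (fun p hp => ?_) k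
    · simp only [hσv, hgv, hR0, zero_add] at h1
      exact sub_eq_zero.1 h1
    · exact (contMDiffOn_coord (hRs.comp (hσ.mono Set.inter_subset_left) fun p hp => hp.2) k).sub
        contMDiffOn_const
    · have h2 := hrel (σ p) hp.2 i
      rw [(hσp p hp.1).2] at h2
      have h3 : ∑ k, (R (g (σ p)) ((0 : EuclideanSpace ℝ (Fin n)), θ i (σ p)) k -
          if k = i then 1 else 0) • modelField (fieldsOf F X k) p = 0 := by
        simp only [sub_smul, Finset.sum_sub_distrib, ← h2]
        simp
      exact h3
  set D : V → (EuclideanSpace ℝ (Fin n) →L[ℝ] EuclideanSpace ℝ (Fin n)) := fun u =>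
    rowOperator fun i k => θ i u k with hD
  have hDv : D v = 1 := by
    ext a k
    rw [hD, rowOperator_apply]
    simp [hθv]
  have hDc : ContinuousOn D Q₁ := by
    simp only [hD, rowOperator]
    refine continuousOn_finsetSum _ fun j _ => continuousOn_finsetSum _ fun k _ => ?_
    exact (contMDiffOn_coord ((hθs j).mono fun u hu => hu.1.1) k).continuousOn.smul continuousOn_const
  refine ⟨Q₁ ∩ D ⁻¹' {L | IsUnit L}, hDc.isOpen_inter_preimage hQ₁o Units.isOpen,
    ⟨hvQ₁, by rw [Set.mem_preimage, hDv]; exact isUnit_one⟩, g, hgs.mono fun u hu => hu.1.1.1, hgv,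
    fun u hu => ⟨hu.1.1.2.1, rfl, hκst u hu.1.1.1, ?_⟩⟩
  rintro ⟨η, ζ⟩
  obtain ⟨ξ, hξ⟩ : ∃ ξ : G, modelDeriv 𝓘(ℝ, G) 𝓘(ℝ, E) s u ξ = ζ := hV.submersion_s.2 u ζ
  -- A vector ξ with ds(ξ) = ζ is corrected by ∑ a_i Y_i, which leaves ds unchanged and adds D a = ∑
  -- a_i θ_i to dy.
  set a := Ring.inverse (D u) (η - modelDeriv 𝓘(ℝ, G) 𝓘(ℝ, EuclideanSpace ℝ (Fin n)) y u ξ) with ha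
  have hDa : D u a = η - modelDeriv 𝓘(ℝ, G) 𝓘(ℝ, EuclideanSpace ℝ (Fin n)) y u ξ := by
    rw [ha, ← mul_apply_eq_comp, Ring.mul_inverse_cancel _ hu.2]
    rfl
  have hsum : ∑ i, a i • θ i u = D u a := by
    ext k
    rw [hD, rowOperator_apply]
    simp
  refine ⟨ξ + ∑ i, a i • modelField (Y i) u, ?_⟩
  rw [hDg u hu.1.1.1]
  refine Prod.ext ?_ ?_
  · change modelDeriv 𝓘(ℝ, G) 𝓘(ℝ, EuclideanSpace ℝ (Fin n)) y u _ = η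
    rw [map_add, map_sum]
    simp only [map_smul]
    change _ + ∑ i, a i • θ i u = η
    rw [hsum, hDa]
    abel
  · change modelDeriv 𝓘(ℝ, G) 𝓘(ℝ, E) s u _ = ζ
    rw [map_add, map_sum, hξ]
    simp [(hO₁f u hu.1.2).1]

end Morphism

end SingFol

/-! ### The proposition, with the morphism restricted to open submanifolds. -/

theorem proposition2p10
    {E : Type*} [NormedAddCommGroup E] [NormedSpace ℝ E] [FiniteDimensional ℝ E]
    {M : Type*} [TopologicalSpace M] [T2Space M] [SecondCountableTopology M]
    [ChartedSpace E M] [IsManifold 𝓘(ℝ, E) ∞ M]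
    (F : SingFol.Foliation 𝓘(ℝ, E) M) (x : M) (n : ℕ)
    (X : Fin n → F.toModule) (b : Module.Basis (Fin n) ℝ (F.Fiber x))
    (hb : ∀ i, b i = F.toFiber x (X i)) :
    (∃ W : Opens (EuclideanSpace ℝ (Fin n) × M), ((0 : EuclideanSpace ℝ (Fin n)), x) ∈ W ∧
      SingFol.IsBisubmersion (𝓘(ℝ, EuclideanSpace ℝ (Fin n)).prod 𝓘(ℝ, E)) F
        (fun w : W => SingFol.expMap 𝓘(ℝ, E) (fun i => (X i : ∀ q : M, TangentSpace 𝓘(ℝ, E) q))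
          (w : EuclideanSpace ℝ (Fin n) × M))
        (fun w : W => (w : EuclideanSpace ℝ (Fin n) × M).2)) ∧
    (∀ (W : Opens (EuclideanSpace ℝ (Fin n) × M))
      (hxW : ((0 : EuclideanSpace ℝ (Fin n)), x) ∈ W),
      SingFol.IsBisubmersion (𝓘(ℝ, EuclideanSpace ℝ (Fin n)).prod 𝓘(ℝ, E)) F
        (fun w : W => SingFol.expMap 𝓘(ℝ, E) (fun i => (X i : ∀ q : M, TangentSpace 𝓘(ℝ, E) q))
          (w : EuclideanSpace ℝ (Fin n) × M))
        (fun w : W => (w : EuclideanSpace ℝ (Fin n) × M).2) →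
      ∀ (G : Type*) [NormedAddCommGroup G] [NormedSpace ℝ G] [FiniteDimensional ℝ G]
        (V : Type*) [TopologicalSpace V] [T2Space V] [SecondCountableTopology V]
        [ChartedSpace G V] [IsManifold 𝓘(ℝ, G) ∞ V] (tV sV : V → M),
        SingFol.IsBisubmersion 𝓘(ℝ, G) F tV sV →
        ∀ v : V, sV v = x → SingFol.Carries 𝓘(ℝ, E) 𝓘(ℝ, G) tV sV id v →
          ∃ (V' : Opens V) (hv : v ∈ V') (g : V' → W),
            SingFol.IsSmoothSubmersion (𝓘(ℝ, EuclideanSpace ℝ (Fin n)).prod 𝓘(ℝ, E)) 𝓘(ℝ, G) g ∧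
            (∀ u : V', (g u : EuclideanSpace ℝ (Fin n) × M).2 = sV u) ∧
            (∀ u : V', SingFol.expMap 𝓘(ℝ, E)
              (fun i => (X i : ∀ q : M, TangentSpace 𝓘(ℝ, E) q))
              (g u : EuclideanSpace ℝ (Fin n) × M) = tV u) ∧
            g ⟨v, hv⟩ = ⟨((0 : EuclideanSpace ℝ (Fin n)), x), hxW⟩) := by
  refine ⟨SingFol.exists_pathHolonomy_bisubmersion F x X b hb, ?_⟩
  intro W hxW _ G _ _ _ V _ _ _ _ _ tV sV hV v hv hid
  subst hv
  obtain ⟨V', hV', hvV', g, hg, hgv, hgu⟩ :=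
    hV.exists_morphism F X b hb hid W.isOpen hxW
  have hgU : ContMDiff 𝓘(ℝ, G) (𝓘(ℝ, EuclideanSpace ℝ (Fin n)).prod 𝓘(ℝ, E)) ∞
      (fun u : (⟨V', hV'⟩ : Opens V) => g u) := contMDiffOn_univ.1
    (hg.comp contMDiff_subtype_val.contMDiffOn fun u _ => u.2)
  have hgW : ContMDiff 𝓘(ℝ, G) (𝓘(ℝ, EuclideanSpace ℝ (Fin n)).prod 𝓘(ℝ, E)) ∞
      (fun u : (⟨V', hV'⟩ : Opens V) => (⟨g u, (hgu u u.2).1⟩ : W)) :=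
    (ContMDiff.subtypeVal_comp_iff _ _).1 hgU
  refine ⟨⟨V', hV'⟩, hvV', fun u => ⟨g u, (hgu u u.2).1⟩, ⟨hgW, fun u => ?_⟩,
    fun u => (hgu u u.2).2.1, fun u => (hgu u u.2).2.2.1, Subtype.ext hgv⟩
  have h1 := SingFol.modelDeriv_comp_val (J := 𝓘(ℝ, G))
    (I := 𝓘(ℝ, EuclideanSpace ℝ (Fin n)).prod 𝓘(ℝ, E)) (W := ⟨V', hV'⟩) (f := g) u
    ((hg.contMDiffAt (hV'.mem_nhds u.2)).mdifferentiableAt (by simp))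
  have h2 := ((hgW.mdifferentiableAt (x := u) (by simp)).hasMFDerivAt_modelDeriv)
  -- The inclusion of W has identity differential, so the corestricted map has the same differential
  -- as g.
  have h3 := ((SingFol.hasMFDerivAt_subtype_val W _).comp u h2).mfderiv
  have h4 := h3.symm.trans h1
  intro a
  obtain ⟨ξ, hξ⟩ := (hgu u u.2).2.2.2 a
  exact ⟨ξ, (congrArg (fun L : G →L[ℝ] EuclideanSpace ℝ (Fin n) × E => L ξ) h4).trans hξ⟩
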